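/- All Lie algebras are real and finite-dimensional. A \emph{Born structure} on a Lie algebra $\mathfrak g$ is a triple $(g,h,\omega)$, where $g,h$ are pseudo-Riemannian metrics (non-degenerate symmetric bilinear forms) and $\omega$ is a non-degenerate two-form, such that the endomorphisms $A,B,J$ defined by $g(A\cdot,\cdot)=\omega$, $g(B\cdot,\cdot)=h$, $\omega(-J\cdot,\cdot)=h$ satisfy $A^2=B^2=-J^2=\mathrm{Id}$. It is \emph{integrable} if $\omega$ is closed (Chevalley--Eilenberg), the Nijenhuis tensor of $J$ vanishes, and the $\pm1$-eigenspaces $\mathfrak g_\pm$ of $A$ are subalgebras. A Lie algebra is written $(de^1,\dots,de^n)$ for a basis $e^1,\dots,e^n$ of the dual, with $ij:=e^i\wedge e^j$. Let $\mathfrak{heis}_3=\langle e_1,e_2,e_3\mid [e_1,e_2]=e_3\rangle$ and $$\mathfrak h_4=(0,0,0,0,12,14+23),\quad \mathfrak h_7=(0,0,0,12,13,23),\quad \mathfrak h_{10}=(0,0,0,12,13,14),$$ $$\mathfrak h_{11}=(0,0,0,12,13,14+23),\quad \mathfrak h_{13}=(0,0,0,12,13+14,24).$$ Given Lie algebras $\mathfrak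 g_\pm$ and representations $\varphi:\mathfrak g_-\to\mathrm{End}(\mathfrak g_+)$, $\rho:\mathfrak g_+\to\mathrm{End}(\mathfrak g_-)$, call $(\varphi,\rho)$ a \emph{matched pair} if for all $X,Y\in\mathfrak g_+$ and $U,V\in\mathfrak g_-$ $$\varphi(U)[X,Y]-[\varphi(U)X,Y]-[X,\varphi(U)Y]+\varphi(\rho(X)U)Y-\varphi(\rho(Y)U)X=0,$$ $$\rho(X)[U,V]-[\rho(X)U,V]-[U,\rho(X)V]+\rho(\varphi(U)X)V-\rho(\varphi(V)X)U=0.$$ Then the \emph{bicross product} $\mathfrak g_\varphi^\rho$ is $\mathfrak g_+\oplus\mathfrak g_-$ with the Lie bracket extending those of $\mathfrak g_\pm$ and $[U,X]=\varphi(U)X-\rho(X)U$ for $U\in\mathfrak g_-$, $X\in\mathfrak g_+$. For a metric $h_-$ on $\mathfrak g_-$ and a linear isomorphism $Q:\mathfrak g_+\to\mathfrak g_-$, the associated Born structure on $\mathfrak g_\varphi^\rho$ has $h=Q^*h_-\oplus h_-$, $J(X+U)=-Q^{-1}U+QX$, $A=\pm\mathrm{Id}$ on $\mathfrak g_\pm$,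 $\omega=h(J\cdot,\cdot)$ and $g=\omega(A\cdot,\cdot)$. \textbf{Proposition.} (1) Let $\mathfrak g$ be a non-abelian six-dimensional nilpotent Lie algebra. Then $\mathfrak g$ admits an integrable Born structure with $\mathfrak g_-\cong\mathfrak{heis}_3$ if and only if $\mathfrak g$ is isomorphic to one of $\mathfrak h_4,\mathfrak h_7,\mathfrak h_{10},\mathfrak h_{11},\mathfrak h_{13}$. (2) Let $\mathfrak g_-\cong\mathfrak{heis}_3$ and let $h_-$ be a bilinear form on $\mathfrak g_-$. Then $h_-$ is a flat Lorentzian metric (signature $(2,1)$, vanishing curvature of the Levi-Civita connection of the left-invariant metric) if and only if $\mathfrak g_-$ has a basis $e_1,e_2,e_3$ with $[e_1,e_2]=e_3$, $[e_1,e_3]=[e_2,e_3]=0$ and $$h_-=e^1\otimes e^1-e^2\otimes e^2+e^2\otimes e^3+e^3\otimes e^2.$$ (3) Let $\mathfrak g_-$, $h_-$ and $e_1,e_2,e_3$ be as in (2), let $\mathfrak g_+$ be an abelian Lie algebra, $Q:\mathfrak g_+\to\mathfrak g_-$ a linear isomorphism, and $f_i=Q^{-1}e_i$. For representations $\varphi:\mathfrak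 g_-\to\mathrm{End}(\mathfrak g_+)$ and $\rho:\mathfrak g_+\to\mathrm{End}(\mathfrak g_-)$, the pair $(\varphi,\rho)$ is a matched pair whose associated Born structure on $\mathfrak g_\varphi^\rho$ is integrable if and only if there are $x_0,y_0,x,y\in\mathbb R$ such that, in the bases $(f_i)$ and $(e_i)$ respectively, $$\varphi(e_1)=\begin{pmatrix}0&0&0\\0&0&0\\0&x&0\end{pmatrix},\quad \varphi(e_2)=\begin{pmatrix}0&x+1&0\\0&0&0\\x-1&x_0&0\end{pmatrix},\quad \varphi(e_3)=0,$$ $$\rho(f_1)=\begin{pmatrix}0&0&0\\0&0&0\\0&y&0\end{pmatrix},\quad \rho(f_2)=\begin{pmatrix}0&y&0\\0&0&0\\y&y_0&0\end{pmatrix},\quad \rho(f_3)=0.$$ For all $x_0,y_0,x,y\in\mathbb R$ these formulas define representations, and, independently of $x_0,y_0$, $$\mathfrak g_\varphi^\rho\cong\begin{cases}\mathfrak h_4&\text{if }y=0,\ x=-1,\\ \mathfrak h_{10}&\text{if }y=0,\ x=0,\\ \mathfrak h_7&\text{if }y=0,\ x=1,\\ \mathfrak h_{11}&\text{if }y=0,\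 x\notin\{-1,0,1\},\\ \mathfrak h_{13}&\text{if }y\neq0.\end{cases}$$ -/

import Mathlib

/-! Endomorphism algebras carry the commutator bracket. -/
attribute [local instance] LieRing.ofAssociativeRing

noncomputable section

/-! ## Lie algebras given by structure equations -/

/-- The two-form `e^{ij} = e^i ∧ e^j` on `ℝⁿ` (indices starting from `0`). -/
def wedge {n : ℕ} (i j : Fin n) : LinearMap.BilinForm ℝ (Fin n → ℝ) :=
  LinearMap.BilinForm.linMulLin (LinearMap.proj i) (LinearMap.proj j) -
    LinearMap.BilinForm.linMulLin (LinearMap.proj j) (LinearMap.proj i)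

@[simp] theorem wedge_apply {n : ℕ} (i j : Fin n) (x y : Fin n → ℝ) :
    wedge i j x y = x i * y j - x j * y i := rfl

/-- Structure equations `(de^0, …, de^{n-1})` of an `n`-dimensional real Lie algebra: a two-form
`d k = de^k` for each `k`. The bracket is determined by `e^k([x, y]) = - de^k(x, y)`; the field
`jacobi` is the Jacobi identity (equivalently `d² = 0`). -/
structure StructureEquations (n : ℕ) where
  d : Fin n → LinearMap.BilinForm ℝ (Fin n → ℝ)
  alt : ∀ k x, d k x x = 0
  jacobi : ∀ k x y z, d k x (fun l => d l y z) + d k y (fun l => d l z x)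
    + d k z (fun l => d l x y) = 0

namespace StructureEquations

variable {n : ℕ}

/-- The Lie algebra with the given structure equations; its underlying space is `ℝⁿ`. -/
def Alg (_s : StructureEquations n) : Type := Fin n → ℝ

variable (s : StructureEquations n)

instance : AddCommGroup s.Alg := inferInstanceAs (AddCommGroup (Fin n → ℝ))
instance : Module ℝ s.Alg := inferInstanceAs (Module ℝ (Fin n → ℝ))

/-- The bracket `[x, y] = - ∑ₖ de^k(x, y) eₖ`. -/
def bracket (x y : Fin n → ℝ) : Fin n → ℝ := fun k => - s.d k x y

theorem d_swap (k : Fin n) (x y : Fin n → ℝ) : s.d k x y = - s.d k y x := by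
  have h := s.alt k (x + y)
  simp only [map_add, LinearMap.add_apply, s.alt] at h
  linarith

theorem bracket_leibniz (x y z : Fin n → ℝ) :
    s.bracket x (s.bracket y z) = s.bracket (s.bracket x y) z + s.bracket y (s.bracket x z) := by
  funext k
  have hn : ∀ u v : Fin n → ℝ, s.bracket u v = - (fun l => s.d l u v) := fun _ _ => rfl
  have h := s.jacobi k x y z
  have e1 : (fun l => s.d l z x) = - (fun l => s.d l x z) := by
    funext l; exact s.d_swap l z x
  rw [e1, s.d_swap k z] at h
  simp only [Pi.add_apply]
  change - s.d k x (s.bracket y z) = - s.d k (s.bracket x y) z + - s.d k y (s.bracket x z)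
  rw [hn, hn, hn]
  simp only [map_neg, LinearMap.neg_apply] at h ⊢
  linarith

theorem bracket_add_left (x y z : Fin n → ℝ) :
    s.bracket (x + y) z = s.bracket x z + s.bracket y z := by
  funext k
  simp only [bracket, Pi.add_apply, map_add, LinearMap.add_apply]; ring

theorem bracket_add_right (x y z : Fin n → ℝ) :
    s.bracket x (y + z) = s.bracket x y + s.bracket x z := by
  funext k
  simp only [bracket, Pi.add_apply, map_add]; ring

theorem bracket_self (x : Fin n → ℝ) : s.bracket x x = 0 := by
  funext k
  simp only [bracket, s.alt, neg_zero, Pi.zero_apply]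

theorem bracket_smul_right (t : ℝ) (x y : Fin n → ℝ) :
    s.bracket x (t • y) = t • s.bracket x y := by
  funext k
  simp only [bracket, Pi.smul_apply, map_smul, smul_eq_mul]; ring

instance : LieRing s.Alg where
  bracket x y := s.bracket x y
  add_lie x y z := s.bracket_add_left x y z
  lie_add x y z := s.bracket_add_right x y z
  lie_self x := s.bracket_self x
  leibniz_lie x y z := s.bracket_leibniz x y z

instance : LieAlgebra ℝ s.Alg where
  lie_smul t x y := s.bracket_smul_right t x y

end StructureEquations

/-- The Heisenberg algebra `⟨e₁, e₂, e₃ ∣ [e₁, e₂] = e₃⟩`, i.e. `de³ = - e^{12}`. -/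
def heis3 : StructureEquations 3 where
  d := ![0, 0, - wedge 0 1]
  alt k x := by fin_cases k <;> simp <;> ring
  jacobi k x y z := by fin_cases k <;> simp

/-- `𝔥₄ = (0,0,0,0,12,14+23)`. -/
def h4 : StructureEquations 6 where
  d := ![0, 0, 0, 0, wedge 0 1, wedge 0 3 + wedge 1 2]
  alt k x := by fin_cases k <;> simp <;> ring
  jacobi k x y z := by fin_cases k <;> simp

/-- `𝔥₇ = (0,0,0,12,13,23)`. -/
def h7 : StructureEquations 6 where
  d := ![0, 0, 0, wedge 0 1, wedge 0 2, wedge 1 2]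
  alt k x := by fin_cases k <;> simp <;> ring
  jacobi k x y z := by fin_cases k <;> simp

/-- `𝔥₁₀ = (0,0,0,12,13,14)`. -/
def h10 : StructureEquations 6 where
  d := ![0, 0, 0, wedge 0 1, wedge 0 2, wedge 0 3]
  alt k x := by fin_cases k <;> simp <;> ring
  jacobi k x y z := by fin_cases k <;> simp <;> ring

/-- `𝔥₁₁ = (0,0,0,12,13,14+23)`. -/
def h11 : StructureEquations 6 where
  d := ![0, 0, 0, wedge 0 1, wedge 0 2, wedge 0 3 + wedge 1 2]
  alt k x := by fin_cases k <;> simp <;> ring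
  jacobi k x y z := by fin_cases k <;> simp <;> ring

/-- `𝔥₁₃ = (0,0,0,12,13+14,24)`. -/
def h13 : StructureEquations 6 where
  d := ![0, 0, 0, wedge 0 1, wedge 0 2 + wedge 0 3, wedge 1 3]
  alt k x := by fin_cases k <;> simp <;> ring
  jacobi k x y z := by fin_cases k <;> simp <;> ring

/-! ## Born structures on Lie algebras -/

/-- A pseudo-Riemannian metric on a real vector space: a symmetric non-degenerate bilinear form
(of any signature). -/
structure IsPseudoMetric {V : Type*} [AddCommGroup V] [Module ℝ V]
    (b : LinearMap.BilinForm ℝ V) : Prop where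
  symm : ∀ x y, b x y = b y x
  nondegenerate : b.Nondegenerate

/-- `R` is the recursion operator from `a` to `b`: `a(R·,·) = b(·,·)`. -/
def IsRecursionOperator {V : Type*} [AddCommGroup V] [Module ℝ V]
    (a b : LinearMap.BilinForm ℝ V) (R : Module.End ℝ V) : Prop :=
  ∀ x y, a (R x) y = b x y

/-- A Born structure `(g, h, ω)` on a real Lie algebra, together with its recursion operators
`A` (from `g` to `ω`), `B` (from `g` to `h`) and `-J` (from `ω` to `h`). By non-degeneracy the
operators are uniquely determined by the three forms. -/
structure BornStructure (L : Type*) [LieRing L] [LieAlgebra ℝ L] where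
  g : LinearMap.BilinForm ℝ L
  h : LinearMap.BilinForm ℝ L
  ω : LinearMap.BilinForm ℝ L
  g_metric : IsPseudoMetric g
  h_metric : IsPseudoMetric h
  ω_alt : ω.IsAlt
  ω_nondegenerate : ω.Nondegenerate
  A : Module.End ℝ L
  B : Module.End ℝ L
  J : Module.End ℝ L
  rec_A : IsRecursionOperator g ω A
  rec_B : IsRecursionOperator g h B
  rec_J : IsRecursionOperator ω h (-J)
  A_sq : A * A = 1
  B_sq : B * B = 1
  J_sq : J * J = -1

/-- A subspace of a Lie algebra that is closed under the bracket. -/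
def IsSubalgebra {L : Type*} [LieRing L] [LieAlgebra ℝ L] (W : Submodule ℝ L) : Prop :=
  ∀ x ∈ W, ∀ y ∈ W, ⁅x, y⁆ ∈ W

namespace BornStructure

variable {L : Type*} [LieRing L] [LieAlgebra ℝ L] (S : BornStructure L)

/-- Integrability: `ω` is closed for the Chevalley-Eilenberg differential, the Nijenhuis tensor of
`J` vanishes, and the `±1`-eigenspaces of `A` are subalgebras. -/
structure IsIntegrable : Prop where
  closed : ∀ x y z, S.ω ⁅x, y⁆ z + S.ω ⁅y, z⁆ x + S.ω ⁅z, x⁆ y = 0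
  nijenhuis : ∀ x y, ⁅S.J x, S.J y⁆ - ⁅x, y⁆ - S.J (⁅S.J x, y⁆ + ⁅x, S.J y⁆) = 0
  plus_subalgebra : IsSubalgebra (S.A.eigenspace 1)
  minus_subalgebra : IsSubalgebra (S.A.eigenspace (-1))

variable {S}

/-- The subalgebra `𝔤₋`, the `-1`-eigenspace of `A`, of an integrable Born structure. -/
def minus (hS : S.IsIntegrable) : LieSubalgebra ℝ L where
  __ := S.A.eigenspace (-1)
  lie_mem' := fun {x y} hx hy => hS.minus_subalgebra x hx y hy

end BornStructure

/-! ## Bicross products and their Born structures -/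

section Bicross

variable {Lp Lm : Type*} [LieRing Lp] [LieAlgebra ℝ Lp] [LieRing Lm] [LieAlgebra ℝ Lm]

/-- The compatibility conditions on representations `φ : 𝔤₋ → End 𝔤₊` and `ρ : 𝔤₊ → End 𝔤₋`
under which the bicross product is defined. -/
structure IsMatchedPair (φ : Lm →ₗ⁅ℝ⁆ Module.End ℝ Lp) (ρ : Lp →ₗ⁅ℝ⁆ Module.End ℝ Lm) :
    Prop where
  left : ∀ (u : Lm) (x y : Lp),
    φ u ⁅x, y⁆ - ⁅φ u x, y⁆ - ⁅x, φ u y⁆ + φ (ρ x u) y - φ (ρ y u) x = 0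
  right : ∀ (x : Lp) (u v : Lm),
    ρ x ⁅u, v⁆ - ⁅ρ x u, v⁆ - ⁅u, ρ x v⁆ + ρ (φ u x) v - ρ (φ v x) u = 0

/-- The bracket of the bicross product on `𝔤₊ ⊕ 𝔤₋`. -/
def bicrossBracket (φ : Lm →ₗ⁅ℝ⁆ Module.End ℝ Lp) (ρ : Lp →ₗ⁅ℝ⁆ Module.End ℝ Lm)
    (X Y : Lp × Lm) : Lp × Lm :=
  (⁅X.1, Y.1⁆ + φ X.2 Y.1 - φ Y.2 X.1, ⁅X.2, Y.2⁆ + ρ X.1 Y.2 - ρ Y.1 X.2)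

variable {φ : Lm →ₗ⁅ℝ⁆ Module.End ℝ Lp} {ρ : Lp →ₗ⁅ℝ⁆ Module.End ℝ Lm}

theorem bicrossBracket_leibniz (hM : IsMatchedPair φ ρ) (X Y Z : Lp × Lm) :
    bicrossBracket φ ρ X (bicrossBracket φ ρ Y Z) =
      bicrossBracket φ ρ (bicrossBracket φ ρ X Y) Z +
        bicrossBracket φ ρ Y (bicrossBracket φ ρ X Z) := by
  obtain ⟨x, u⟩ := X
  obtain ⟨y, v⟩ := Y
  obtain ⟨z, w⟩ := Z
  have h1 := hM.left u y z
  have h2 := hM.left v x z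
  have h3 := hM.left w x y
  have k1 := hM.right x v w
  have k2 := hM.right y u w
  have k3 := hM.right z u v
  apply Prod.ext
  · simp only [bicrossBracket, Prod.fst_add, map_add, map_sub, LieHom.map_lie,
      LinearMap.add_apply, LinearMap.sub_apply, LieRing.of_associative_ring_bracket,
      Module.End.mul_apply, lie_add, lie_sub, add_lie, sub_lie]
    rw [leibniz_lie x y z, ← lie_skew y (φ w x)]
    linear_combination (norm := abel) h1 - h2 + h3
  · simp only [bicrossBracket, Prod.snd_add, map_add, map_sub, LieHom.map_lie,
      LinearMap.add_apply, LinearMap.sub_apply, LieRing.of_associative_ring_bracket,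
      Module.End.mul_apply, lie_add, lie_sub, add_lie, sub_lie]
    rw [leibniz_lie u v w, ← lie_skew v (ρ z u)]
    linear_combination (norm := abel) k1 - k2 + k3

theorem bicrossBracket_add_left (X Y Z : Lp × Lm) :
    bicrossBracket φ ρ (X + Y) Z = bicrossBracket φ ρ X Z + bicrossBracket φ ρ Y Z := by
  apply Prod.ext <;>
  · simp only [bicrossBracket, Prod.fst_add, Prod.snd_add, add_lie, map_add, LinearMap.add_apply]
    abel

theorem bicrossBracket_add_right (X Y Z : Lp × Lm) :
    bicrossBracket φ ρ X (Y + Z) = bicrossBracket φ ρ X Y + bicrossBracket φ ρ X Z := by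
  apply Prod.ext <;>
  · simp only [bicrossBracket, Prod.fst_add, Prod.snd_add, lie_add, map_add, LinearMap.add_apply]
    abel

theorem bicrossBracket_self (X : Lp × Lm) : bicrossBracket φ ρ X X = 0 := by
  apply Prod.ext <;> simp [bicrossBracket]

theorem bicrossBracket_smul_right (t : ℝ) (X Y : Lp × Lm) :
    bicrossBracket φ ρ X (t • Y) = t • bicrossBracket φ ρ X Y := by
  apply Prod.ext <;>
  simp only [bicrossBracket, Prod.smul_fst, Prod.smul_snd, lie_smul, map_smul,
    LinearMap.smul_apply, smul_add, smul_sub]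

/-- The bicross product `𝔤₊ ⋈ 𝔤₋`, with underlying vector space `𝔤₊ ⊕ 𝔤₋`. -/
def Bicross (_hM : IsMatchedPair φ ρ) : Type _ := Lp × Lm

namespace Bicross

variable (hM : IsMatchedPair φ ρ)

instance : AddCommGroup (Bicross hM) := inferInstanceAs (AddCommGroup (Lp × Lm))
instance : Module ℝ (Bicross hM) := inferInstanceAs (Module ℝ (Lp × Lm))

instance : LieRing (Bicross hM) where
  bracket X Y := bicrossBracket φ ρ X Y
  add_lie X Y Z := bicrossBracket_add_left X Y Z
  lie_add X Y Z := bicrossBracket_add_right X Y Z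
  lie_self X := bicrossBracket_self X
  leibniz_lie X Y Z := bicrossBracket_leibniz hM X Y Z

instance : LieAlgebra ℝ (Bicross hM) where
  lie_smul t X Y := bicrossBracket_smul_right t X Y

end Bicross

end Bicross

section BornOnSum

variable {Vp Vm : Type*} [AddCommGroup Vp] [Module ℝ Vp] [AddCommGroup Vm] [Module ℝ Vm]

/-- `J = (0, -Q⁻¹; Q, 0)` on `V₊ ⊕ V₋`. -/
def sumJ (Q : Vp ≃ₗ[ℝ] Vm) : Module.End ℝ (Vp × Vm) :=
  LinearMap.prod (-(Q.symm.toLinearMap ∘ₗ LinearMap.snd ℝ Vp Vm))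
    (Q.toLinearMap ∘ₗ LinearMap.fst ℝ Vp Vm)

/-- `A = ±1` on `V_±`. -/
def sumA : Module.End ℝ (Vp × Vm) :=
  LinearMap.prod (LinearMap.fst ℝ Vp Vm) (-LinearMap.snd ℝ Vp Vm)

/-- `h = h₊ ⊕ h₋` on `V₊ ⊕ V₋`, where `h₊ = Q^* h₋`, so that `Q` is an isometry. -/
def sumH (hm : LinearMap.BilinForm ℝ Vm) (Q : Vp ≃ₗ[ℝ] Vm) : LinearMap.BilinForm ℝ (Vp × Vm) :=
  hm.comp (Q.toLinearMap ∘ₗ LinearMap.fst ℝ Vp Vm) (Q.toLinearMap ∘ₗ LinearMap.fst ℝ Vp Vm) +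
    hm.comp (LinearMap.snd ℝ Vp Vm) (LinearMap.snd ℝ Vp Vm)

variable (hm : LinearMap.BilinForm ℝ Vm) (Q : Vp ≃ₗ[ℝ] Vm)

@[simp] theorem sumJ_apply (X : Vp × Vm) : sumJ Q X = (-Q.symm X.2, Q X.1) := rfl

@[simp] theorem sumA_apply (X : Vp × Vm) : sumA X = (X.1, -X.2) := rfl

/-- The recursion operator `B = -AJ`, which interchanges `V₊` and `V₋` through `Q`. -/
def sumB (Q : Vp ≃ₗ[ℝ] Vm) : Module.End ℝ (Vp × Vm) :=
  LinearMap.prod (Q.symm.toLinearMap ∘ₗ LinearMap.snd ℝ Vp Vm)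
    (Q.toLinearMap ∘ₗ LinearMap.fst ℝ Vp Vm)

@[simp] theorem sumB_apply (X : Vp × Vm) : sumB Q X = (Q.symm X.2, Q X.1) := rfl

@[simp] theorem sumH_apply (X Y : Vp × Vm) :
    sumH hm Q X Y = hm (Q X.1) (Q Y.1) + hm X.2 Y.2 := rfl

/-- The two-form `ω = h(J·,·)`. -/
def sumOmega : LinearMap.BilinForm ℝ (Vp × Vm) := (sumH hm Q).compLeft (sumJ Q)

/-- The neutral metric `g = ω(A·,·)`. -/
def sumG : LinearMap.BilinForm ℝ (Vp × Vm) := (sumOmega hm Q).compLeft sumA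

@[simp] theorem sumOmega_apply (X Y : Vp × Vm) :
    sumOmega hm Q X Y = - hm X.2 (Q Y.1) + hm (Q X.1) Y.2 := by
  simp [sumOmega]

@[simp] theorem sumG_apply (X Y : Vp × Vm) :
    sumG hm Q X Y = hm X.2 (Q Y.1) + hm (Q X.1) Y.2 := by
  simp [sumG]

theorem sum_rec_A : IsRecursionOperator (sumG hm Q) (sumOmega hm Q) sumA := by
  intro X Y; simp

theorem sum_rec_B : IsRecursionOperator (sumG hm Q) (sumH hm Q) (sumB Q) := by
  intro X Y; simp

theorem sum_rec_J : IsRecursionOperator (sumOmega hm Q) (sumH hm Q) (-sumJ Q) := by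
  intro X Y; simp

theorem sumA_sq : (sumA * sumA : Module.End ℝ (Vp × Vm)) = 1 :=
  LinearMap.ext fun X => by simp

theorem sumB_sq : sumB Q * sumB Q = 1 := LinearMap.ext fun X => by simp

theorem sumJ_sq : sumJ Q * sumJ Q = -1 :=
  LinearMap.ext fun X => Prod.ext (by simp) (by simp)

variable {hm}

theorem nondegenerate_of_offDiag (hh : IsPseudoMetric hm) (b : LinearMap.BilinForm ℝ (Vp × Vm))
    (c : ℝ) (hc : c ≠ 0)
    (hb : ∀ X Y, b X Y = c * hm X.2 (Q Y.1) + hm (Q X.1) Y.2) : b.Nondegenerate := by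
  obtain ⟨h1, h2⟩ := hh.nondegenerate
  constructor
  · intro X hX
    have e1 : X.2 = 0 := h1 _ fun v => by
      have := hX (Q.symm v, 0)
      simpa [hb, hc] using this
    have e2 : Q X.1 = 0 := h1 _ fun v => by
      have := hX (0, v)
      simpa [hb] using this
    exact Prod.ext (by simpa using e2) e1
  · intro X hX
    have e1 : X.2 = 0 := h2 _ fun v => by
      have := hX (Q.symm v, 0)
      simpa [hb] using this
    have e2 : Q X.1 = 0 := h2 _ fun v => by
      have := hX (0, v)
      simpa [hb, hc] using this
    exact Prod.ext (by simpa using e2) e1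

theorem sumH_metric (hh : IsPseudoMetric hm) : IsPseudoMetric (sumH hm Q) where
  symm X Y := by simp only [sumH_apply, hh.symm]
  nondegenerate := by
    obtain ⟨h1, h2⟩ := hh.nondegenerate
    constructor
    · intro X hX
      have e1 : X.2 = 0 := h1 _ fun v => by simpa using hX (0, v)
      have e2 : Q X.1 = 0 := h1 _ fun v => by simpa using hX (Q.symm v, 0)
      exact Prod.ext (by simpa using e2) e1
    · intro X hX
      have e1 : X.2 = 0 := h2 _ fun v => by simpa using hX (0, v)
      have e2 : Q X.1 = 0 := h2 _ fun v => by simpa using hX (Q.symm v, 0)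
      exact Prod.ext (by simpa using e2) e1

theorem sumG_metric (hh : IsPseudoMetric hm) : IsPseudoMetric (sumG hm Q) where
  symm X Y := by
    rw [sumG_apply, sumG_apply, hh.symm X.2, hh.symm (Q X.1)]; ring
  nondegenerate := nondegenerate_of_offDiag Q hh _ 1 one_ne_zero fun X Y => by simp

theorem sumOmega_nondegenerate (hh : IsPseudoMetric hm) : (sumOmega hm Q).Nondegenerate :=
  nondegenerate_of_offDiag Q hh _ (-1) (by norm_num) fun X Y => by simp

end BornOnSum

section BornOnBicross

variable {Lp Lm : Type*} [LieRing Lp] [LieAlgebra ℝ Lp] [LieRing Lm] [LieAlgebra ℝ Lm]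
  {φ : Lm →ₗ⁅ℝ⁆ Module.End ℝ Lp} {ρ : Lp →ₗ⁅ℝ⁆ Module.End ℝ Lm}
  {hm : LinearMap.BilinForm ℝ Lm}

/-- The (possibly non-integrable) Born structure on the bicross product associated with a metric
`h₋` on `𝔤₋`, a linear isomorphism `Q : 𝔤₊ → 𝔤₋`, and `h₊ = Q^* h₋`. -/
def bicrossBorn (hM : IsMatchedPair φ ρ) (hh : IsPseudoMetric hm) (Q : Lp ≃ₗ[ℝ] Lm) :
    BornStructure (Bicross hM) where
  g := sumG hm Q
  h := sumH hm Q
  ω := sumOmega hm Q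
  g_metric := sumG_metric Q hh
  h_metric := sumH_metric Q hh
  ω_alt := fun X => by
    refine (sumOmega_apply hm Q X X).trans ?_
    rw [hh.symm X.2]; ring
  ω_nondegenerate := sumOmega_nondegenerate Q hh
  A := sumA
  B := sumB Q
  J := sumJ Q
  rec_A := sum_rec_A hm Q
  rec_B := sum_rec_B hm Q
  rec_J := sum_rec_J hm Q
  A_sq := sumA_sq
  B_sq := sumB_sq Q
  J_sq := sumJ_sq Q

end BornOnBicross

/-! ## Flat Lorentzian metrics and the explicit family -/

section FlatLorentzian

/-- A Lorentzian metric of signature `(n-1, 1)`: there is an orthonormal basis with exactly one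
vector of square `-1`, all others having square `1`. -/
structure IsLorentzian {V : Type*} [AddCommGroup V] [Module ℝ V] (b : LinearMap.BilinForm ℝ V) :
    Prop extends IsPseudoMetric b where
  signature : ∃ (n : ℕ) (v : Module.Basis (Fin (n + 1)) ℝ V),
    ∀ i j, b (v i) (v j) = if i = j then (if i = 0 then -1 else 1) else 0

/-- `D` (with `D x y = ∇_x y`) is the Levi-Civita connection of the left-invariant metric `b`:
it is torsion-free and metric. -/
structure IsLeviCivita {L : Type*} [LieRing L] [LieAlgebra ℝ L] (b : LinearMap.BilinForm ℝ L)
    (D : L →ₗ[ℝ] Module.End ℝ L) : Prop where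
  torsion_free : ∀ x y, D x y - D y x = ⁅x, y⁆
  metric : ∀ x y z, b (D x y) z + b y (D x z) = 0

/-- The metric `b` is flat: the curvature of its Levi-Civita connection vanishes. -/
def IsFlat {L : Type*} [LieRing L] [LieAlgebra ℝ L] (b : LinearMap.BilinForm ℝ L) : Prop :=
  ∃ D : L →ₗ[ℝ] Module.End ℝ L, IsLeviCivita b D ∧
    ∀ x y z, D x (D y z) - D y (D x z) - D ⁅x, y⁆ z = 0

/-- A basis `e₁, e₂, e₃` of a Lie algebra with `[e₁, e₂] = e₃` and all other brackets of basis
vectors zero, in which the bilinear form is `e¹⊗e¹ - e²⊗e² + e²⊗e³ + e³⊗e²`. -/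
structure IsAdaptedBasis {L : Type*} [LieRing L] [LieAlgebra ℝ L]
    (b : LinearMap.BilinForm ℝ L) (e : Module.Basis (Fin 3) ℝ L) : Prop where
  lie_01 : ⁅e 0, e 1⁆ = e 2
  lie_02 : ⁅e 0, e 2⁆ = 0
  lie_12 : ⁅e 1, e 2⁆ = 0
  gram : ∀ i j, b (e i) (e j) = !![1, 0, 0; 0, -1, 1; 0, 1, 0] i j

/-- The representations `φ` and `ρ` are given by the displayed matrices, with parameters
`x₀, y₀, x, y`, in the basis `e` of `𝔤₋` and the basis `f` of `𝔤₊`. -/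
structure HasNormalForm {Lp Lm : Type*} [LieRing Lp] [LieAlgebra ℝ Lp] [LieRing Lm]
    [LieAlgebra ℝ Lm] (e : Module.Basis (Fin 3) ℝ Lm) (f : Module.Basis (Fin 3) ℝ Lp)
    (φ : Lm →ₗ⁅ℝ⁆ Module.End ℝ Lp) (ρ : Lp →ₗ⁅ℝ⁆ Module.End ℝ Lm) (x₀ y₀ x y : ℝ) : Prop where
  phi_0 : LinearMap.toMatrix f f (φ (e 0)) = !![0, 0, 0; 0, 0, 0; 0, x, 0]
  phi_1 : LinearMap.toMatrix f f (φ (e 1)) = !![0, x + 1, 0; 0, 0, 0; x - 1, x₀, 0]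
  phi_2 : φ (e 2) = 0
  rho_0 : LinearMap.toMatrix e e (ρ (f 0)) = !![0, 0, 0; 0, 0, 0; 0, y, 0]
  rho_1 : LinearMap.toMatrix e e (ρ (f 1)) = !![0, y, 0; 0, 0, 0; y, y₀, 0]
  rho_2 : ρ (f 2) = 0

end FlatLorentzian

end

noncomputable section

/-! ## Nilpotent operators -/

section Nilpotent

variable {V : Type*} [AddCommGroup V] [Module ℝ V]

/-! An integrable Born structure amounts to a pair of products on `V = 𝔤₋`. Since `A` and `J`
anticommute, `J` exchanges `𝔤₊` and `𝔤₋`, so `𝔤 = V ⊕ V`, and the two components of the mixed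
bracket define products `φ` and `ρ` on `V`. Vanishing of the Nijenhuis tensor says that the brackets
of `𝔤₋` and `𝔤₊` are the commutators of `φ` and `ρ`; the Jacobi identity then makes both products
flat (left-symmetric) and matched, and closedness of `ω` makes both Hessian for `η = h` restricted
to `𝔤₋`. This is `BornStructure.exists_isDouble`.

For (1), nilpotency of `𝔤` makes all the operators involved nilpotent. An Engel-type argument
(`IsHeisenbergBasis.apply_center`) shows that the Heisenberg centre annihilates `V` and is
annihilated under `φ`; matching transfers the second property to `ρ`, and the Hessian condition
makes the centre `η`-null. In a basis adapted to this null line both products are triangular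
(`IsHessianPair.exists_isTriangular`), so `𝔤` lies in a family with parameters `t, x, y, x₀, y₀`,
where `t` measures the non-commutativity of `𝔤₊`. A rotation mixing `𝔤₊` and `𝔤₋` removes `t`, and
explicit changes of basis give the five algebras. Conversely, each of the five is a bicross product
from (3), and Born structures pull back along isomorphisms.

For (2), flatness forces the centre `z` to be null because `∇_z` is skew with square zero; the
Lorentzian signature fixes the sign of the remaining scale, which is then normalised.

For (3) no nilpotency is assumed. Lowering an index with `h₋` turns the Hessian and torsion
conditions into symmetry relations between coefficients, and the flatness and matching equations
leave exactly four parameters (`flat_hessian_coefficients`,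
`IsHessianPair.isTriangular_of_isAdaptedBasis`). -/

theorem IsNilpotent.eq_zero_of_apply_eq_smul {T : Module.End ℝ V} (hT : IsNilpotent T) {x : V}
    (hx : x ≠ 0) {r : ℝ} (h : T x = r • x) : r = 0 := by
  obtain ⟨n, hn⟩ := hT
  have key : ∀ k : ℕ, (T ^ k) x = r ^ k • x := by
    intro k
    induction k with
    | zero => simp
    | succ k ih => rw [pow_succ', Module.End.mul_apply, ih, map_smul, h, smul_smul, _root_.pow_succ]
  have h0 := key n
  rw [hn, LinearMap.zero_apply, eq_comm, smul_eq_zero] at h0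
  exact eq_zero_of_pow_eq_zero (h0.resolve_right hx)

theorem IsNilpotent.apply_eq_zero_of_apply_eq_smul {T : Module.End ℝ V} (hT : IsNilpotent T)
    {x : V} {r : ℝ} (h : T x = r • x) : T x = 0 := by
  by_cases hx : x = 0
  · rw [hx, map_zero]
  · rw [h, hT.eq_zero_of_apply_eq_smul hx h, zero_smul]

/-- A nonzero invariant subset of a nilpotent operator contains a nonzero kernel vector. -/
theorem IsNilpotent.exists_ker {T : Module.End ℝ V} (hT : IsNilpotent T) (P : V → Prop)
    (hP : ∀ x, P x → P (T x)) {x : V} (hx : x ≠ 0) (hPx : P x) : ∃ y, y ≠ 0 ∧ P y ∧ T y = 0 := by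
  obtain ⟨n, hn⟩ := hT
  have key : ∀ k : ℕ, ∀ x : V, x ≠ 0 → P x → (T ^ k) x = 0 → ∃ y, y ≠ 0 ∧ P y ∧ T y = 0 := by
    intro k
    induction k with
    | zero => intro x hx _ h; exact absurd (by simpa using h) hx
    | succ k ih =>
      intro x hx hPx h
      by_cases hT : T x = 0
      · exact ⟨x, hx, hPx, hT⟩
      · exact ih (T x) hT (hP x hPx) (by rwa [_root_.pow_succ, Module.End.mul_apply] at h)
  exact key n x hx hPx (by rw [hn, LinearMap.zero_apply])

end Nilpotent

/-! ## Three-dimensional Heisenberg brackets -/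

section Heisenberg

variable {V : Type*} [AddCommGroup V] [Module ℝ V]

/-- The bracket `[e₀, e₁] = e₂` with `e₂` central. -/
structure IsHeisenbergBasis (c : V →ₗ[ℝ] V →ₗ[ℝ] V) (b : Module.Basis (Fin 3) ℝ V) : Prop where
  alt : ∀ u, c u u = 0
  bracket : c (b 0) (b 1) = b 2
  central : ∀ u, c u (b 2) = 0

theorem bilin_swap {c : V →ₗ[ℝ] V →ₗ[ℝ] V} (alt : ∀ u, c u u = 0) (u v : V) :
    c u v = - c v u := by
  have h := alt (u + v)
  simp only [map_add, LinearMap.add_apply, alt, zero_add, add_zero] at h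
  exact eq_neg_of_add_eq_zero_right h

theorem Module.Basis.eq_sum_three (b : Module.Basis (Fin 3) ℝ V) (u : V) :
    u = b.repr u 0 • b 0 + b.repr u 1 • b 1 + b.repr u 2 • b 2 := by
  conv_lhs => rw [← b.sum_repr u]
  rw [Fin.sum_univ_three]

variable {c : V →ₗ[ℝ] V →ₗ[ℝ] V}

theorem IsHeisenbergBasis.apply {b : Module.Basis (Fin 3) ℝ V} (h : IsHeisenbergBasis c b)
    (u v : V) : c u v = (b.repr u 0 * b.repr v 1 - b.repr u 1 * b.repr v 0) • b 2 := by
  have h' : ∀ v, c (b 2) v = 0 := fun v => by rw [bilin_swap h.alt, h.central, neg_zero]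
  have h'' : c (b 1) (b 0) = - b 2 := by rw [bilin_swap h.alt, h.bracket]
  conv_lhs => rw [b.eq_sum_three u, b.eq_sum_three v]
  simp only [map_add, map_smul, LinearMap.add_apply, LinearMap.smul_apply, h.alt, h.central, h',
    h.bracket, h'']
  module

/-- Apply `c u` and `c v` to a linear relation. If the coefficient of `c u v` is nonzero, then `c u
v` becomes an eigenvector of both operators, so nilpotency kills the other two coefficients and the
relation collapses to a multiple of `c u v`. -/
theorem linearIndependent_bracket (alt : ∀ u, c u u = 0) (nil : ∀ u, IsNilpotent (R := Module.End ℝ V) (c u))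
    {u v : V} (huv : c u v ≠ 0) : LinearIndependent ℝ ![u, v, c u v] := by
  rw [Fintype.linearIndependent_iff]
  intro g hg
  simp only [Fin.sum_univ_three, Matrix.cons_val_zero, Matrix.cons_val_one, Matrix.cons_val] at hg
  have hu := congrArg (c u) hg
  have hv := congrArg (c v) hg
  simp only [map_add, map_smul, alt, smul_zero, zero_add, add_zero, map_zero] at hu hv
  rw [bilin_swap alt v u] at hv
  by_cases h2 : g 2 = 0
  · rw [h2, zero_smul, add_zero] at hu hv
    have h1 : g 1 = 0 := (smul_eq_zero.1 hu).resolve_right huv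
    have h0 : g 0 = 0 := (smul_eq_zero.1 hv).resolve_right (neg_ne_zero.2 huv)
    intro i; fin_cases i <;> assumption
  · have e1 : c u (c u v) = (-(g 2)⁻¹ * g 1) • c u v := by
      linear_combination (norm := skip) (g 2)⁻¹ • hu
      match_scalars <;> field_simp <;> ring
    have e2 : c v (c u v) = ((g 2)⁻¹ * g 0) • c u v := by
      linear_combination (norm := skip) (g 2)⁻¹ • hv
      match_scalars <;> field_simp <;> ring
    have h1 := (nil u).eq_zero_of_apply_eq_smul huv e1
    have h0 := (nil v).eq_zero_of_apply_eq_smul huv e2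
    have h1 : g 1 = 0 := by simpa [h2] using h1
    have h0 : g 0 = 0 := by simpa [h2] using h0
    rw [h1, h0, zero_smul, zero_smul, zero_add, zero_add] at hg
    exact absurd ((smul_eq_zero.1 hg).resolve_right huv) h2

/-- In the basis `u, v, c u v` only the image of the last vector under `T = c u` is unknown, say
`(α, β, γ)`. The traces of `T` and `T ^ 2` give `γ = 0` and `β = 0`; then `u` is an eigenvector of
`c (c u v)` with eigenvalue `-α`, so `α = 0`. -/
theorem bracket_bracket_eq_zero (hV : Module.finrank ℝ V = 3) (alt : ∀ u, c u u = 0)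
    (nil : ∀ u, IsNilpotent (R := Module.End ℝ V) (c u)) (u v : V) : c u (c u v) = 0 := by
  by_cases huv : c u v = 0
  · rw [huv, map_zero]
  have hli := linearIndependent_bracket alt nil huv
  have : FiniteDimensional ℝ V := Module.finite_of_finrank_eq_succ hV
  let b : Module.Basis (Fin 3) ℝ V := basisOfLinearIndependentOfCardEqFinrank hli (by simp [hV])
  have b0 : b 0 = u := by simp [b]
  have b1 : b 1 = v := by simp [b]
  have b2 : b 2 = c u v := by simp [b]
  set T : Module.End ℝ V := c u with hT
  have T0 : T (b 0) = 0 := by rw [b0, hT, alt]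
  have T1 : T (b 1) = b 2 := by rw [b1, b2]
  have T2 := b.eq_sum_three (T (b 2))
  set α := b.repr (T (b 2)) 0
  set β := b.repr (T (b 2)) 1
  set γ := b.repr (T (b 2)) 2 with hγ
  have tr : ∀ S : Module.End ℝ V, LinearMap.trace ℝ V S =
      b.repr (S (b 0)) 0 + b.repr (S (b 1)) 1 + b.repr (S (b 2)) 2 := by
    intro S
    rw [LinearMap.trace_eq_matrix_trace ℝ b, Matrix.trace_fin_three]
    simp [LinearMap.toMatrix_apply]
  have t1 := (LinearMap.isNilpotent_trace_of_isNilpotent (nil u)).eq_zero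
  have t2 := (LinearMap.isNilpotent_trace_of_isNilpotent ((nil u).pow_of_pos two_ne_zero)).eq_zero
  rw [← hT] at t1 t2
  rw [tr] at t1 t2
  simp only [pow_two, Module.End.mul_apply, T0, T1, map_zero, T2] at t1 t2
  simp only [map_add, map_smul, T0, T1, T2] at t1 t2
  simp at t1 t2
  have hβ : β = 0 := by rw [t1] at t2; linarith
  rw [t1, hβ, zero_smul, zero_smul, add_zero, add_zero] at T2
  have hu : u ≠ 0 := by rintro rfl; exact huv (by rw [hT]; simp)
  have hα := (nil (c u v)).eq_zero_of_apply_eq_smul hu (r := -α) (by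
    rw [bilin_swap alt, ← b2, ← hT, T2, b0, neg_smul])
  rw [← b2, T2, neg_eq_zero.1 hα, zero_smul]

/-- A non-abelian three-dimensional bracket by nilpotent operators is a Heisenberg bracket. -/
theorem exists_isHeisenbergBasis (hV : Module.finrank ℝ V = 3) (alt : ∀ u, c u u = 0)
    (nil : ∀ u, IsNilpotent (R := Module.End ℝ V) (c u)) (hc : c ≠ 0) :
    ∃ b : Module.Basis (Fin 3) ℝ V, IsHeisenbergBasis c b := by
  obtain ⟨u, v, huv⟩ : ∃ u v, c u v ≠ 0 := by
    by_contra! h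
    exact hc (LinearMap.ext fun u => LinearMap.ext fun v => h u v)
  have hli := linearIndependent_bracket alt nil huv
  have : FiniteDimensional ℝ V := Module.finite_of_finrank_eq_succ hV
  let b : Module.Basis (Fin 3) ℝ V := basisOfLinearIndependentOfCardEqFinrank hli (by simp [hV])
  have b0 : b 0 = u := by simp [b]
  have b1 : b 1 = v := by simp [b]
  have b2 : b 2 = c u v := by simp [b]
  refine ⟨b, alt, by rw [b0, b1, b2], fun w => ?_⟩
  have h1 : c u (c u v) = 0 := bracket_bracket_eq_zero hV alt nil u v
  have h2 : c v (c u v) = 0 := by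
    rw [bilin_swap alt u v, map_neg, bracket_bracket_eq_zero hV alt nil, neg_zero]
  rw [b.eq_sum_three w]
  simp only [map_add, map_smul, LinearMap.add_apply, LinearMap.smul_apply]
  rw [b0, b1, b2, h1, h2, alt]
  simp

/-- A nilpotent left-symmetric product on the Heisenberg algebra is annihilated by the centre. -/
theorem IsHeisenbergBasis.apply_center {φ : V →ₗ[ℝ] V →ₗ[ℝ] V} {b : Module.Basis (Fin 3) ℝ V}
    (hb : IsHeisenbergBasis (φ - φ.flip) b)
    (flat : ∀ u v w, φ (φ u v - φ v u) w = φ u (φ v w) - φ v (φ u w))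
    (nil : ∀ u, IsNilpotent (R := Module.End ℝ V) (φ u)) : φ (b 2) = 0 ∧ ∀ u, φ u (b 2) = 0 := by
  have hz : b 2 ≠ 0 := b.ne_zero 2
  have br : ∀ u v, φ u v - φ v u =
      (b.repr u 0 * b.repr v 1 - b.repr u 1 * b.repr v 0) • b 2 := fun u v => hb.apply u v
  have brz : ∀ u, φ (b 2) u = φ u (b 2) := fun u => by
    have := br u (b 2)
    simp at this
    exact (sub_eq_zero.1 this).symm
  have comm : ∀ u v, φ (b 2) (φ u v) = φ u (φ (b 2) v) := fun u v => by
    have := flat u (b 2) v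
    rw [brz u, sub_self, map_zero, LinearMap.zero_apply, eq_comm, sub_eq_zero] at this
    exact this.symm
  have comm01 : ∀ v, φ (b 2) v = φ (b 0) (φ (b 1) v) - φ (b 1) (φ (b 0) v) := fun v => by
    have := flat (b 0) (b 1) v
    rwa [br, b.repr_self, b.repr_self, Finsupp.single_eq_same, Finsupp.single_eq_same,
      Finsupp.single_eq_of_ne (by decide), mul_one, zero_mul, sub_zero, one_smul] at this
  -- a common kernel vector
  obtain ⟨v₁, hv₁, -, h1⟩ := (nil (b 2)).exists_ker (fun _ => True) (fun _ _ => trivial) hz trivial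
  obtain ⟨v₂, hv₂, h2z, h2⟩ := (nil (b 0)).exists_ker (fun x => φ (b 2) x = 0)
    (fun x hx => by change φ (b 2) (φ _ _) = 0; rw [comm, hx, map_zero]) hv₁ h1
  obtain ⟨v, hv, ⟨hvz, hv0⟩, hv1⟩ := (nil (b 1)).exists_ker
    (fun x => φ (b 2) x = 0 ∧ φ (b 0) x = 0)
    (fun x hx => ⟨by change φ (b 2) (φ _ _) = 0; rw [comm, hx.1, map_zero], by
      have := comm01 x
      rw [hx.1, hx.2, LinearMap.map_zero, sub_zero] at this
      exact this.symm⟩) hv₂ ⟨h2z, h2⟩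
  have hvu : ∀ u, φ u v = 0 := fun u => by
    rw [b.eq_sum_three u]
    simp only [map_add, map_smul, LinearMap.add_apply, LinearMap.smul_apply, hvz, hv0, hv1,
      smul_zero, add_zero]
  -- Since `φ u v = 0`, left multiplication by `v` is just the bracket with `v`, hence takes values
  -- in the centre.
  have adv : ∀ u, φ v u = (b.repr v 0 * b.repr u 1 - b.repr v 1 * b.repr u 0) • b 2 := fun u => by
    rw [← br v u, hvu u, sub_zero]
  have sum := b.eq_sum_three v
  set p := b.repr v 0
  set q := b.repr v 1
  set r := b.repr v 2
  suffices h : φ (b 2) = 0 from ⟨h, fun u => by rw [← brz, h, LinearMap.zero_apply]⟩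
  by_cases hpq : p ^ 2 + q ^ 2 = 0
  · have hp : p = 0 := by nlinarith [sq_nonneg p, sq_nonneg q]
    have hq : q = 0 := by nlinarith [sq_nonneg p, sq_nonneg q]
    rw [hp, hq, zero_smul, zero_smul, zero_add, zero_add] at sum
    have hr : r ≠ 0 := by rintro h; rw [h, zero_smul] at sum; exact hv sum
    have : φ v = 0 := LinearMap.ext fun u => by rw [adv, hp, hq]; simp
    rw [sum, map_smul] at this
    exact (smul_eq_zero.1 this).resolve_left hr
  · -- `[v, u] = n z` with `n ≠ 0`
    set u : V := -q • b 0 + p • b 1 with hu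
    have hbr : φ v u - φ u v = (p ^ 2 + q ^ 2) • b 2 := by
      rw [hvu, sub_zero, adv, hu]
      congr 1
      simp
      ring
    set n := p ^ 2 + q ^ 2 with hn
    have rel : ∀ w, n • φ (b 2) w = φ v (φ u w) - φ u (φ v w) := fun w => by
      rw [← flat, hbr, map_smul, LinearMap.smul_apply]
    have advz : φ v (b 2) = 0 := by rw [adv]; simp
    -- The relation `n φ_z = [φ_v, φ_u]`, evaluated at `z`, has right-hand side in the image of
    -- `φ_v`, so `z` is an eigenvector of the nilpotent `φ_z`.
    have zz : φ (b 2) (b 2) = 0 := by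
      have h := rel (b 2)
      rw [advz, map_zero, sub_zero, adv] at h
      refine (nil (b 2)).apply_eq_zero_of_apply_eq_smul 
        (r := n⁻¹ * (p * b.repr (φ u (b 2)) 1 - q * b.repr (φ u (b 2)) 0)) ?_
      rw [mul_smul, ← h, smul_smul, inv_mul_cancel₀ hpq, one_smul]
    -- Here `φ_u φ_v u = n φ_u z = n φ_z u`, so the relation reads `2n φ_z u = s z`: the vector `z`
    -- is an eigenvector of the nilpotent `φ_u`.
    have zu : φ (b 2) u = 0 := by
      have h := rel u
      rw [adv (φ u u)] at h
      have h3 : φ v u = n • b 2 := by rw [← hbr, hvu, sub_zero]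
      rw [h3, map_smul, ← brz u] at h
      set s := p * b.repr (φ u u) 1 - q * b.repr (φ u u) 0
      have h4 : φ u (b 2) = ((2 * n)⁻¹ * s) • b 2 := by
        rw [← brz u]
        linear_combination (norm := skip) (2 * n)⁻¹ • h
        match_scalars <;> field_simp <;> ring
      rw [brz u, (nil u).apply_eq_zero_of_apply_eq_smul h4]
    have zv : φ (b 2) v = 0 := hvu _
    rw [sum] at zv
    rw [hu] at zu
    simp only [map_add, map_smul, zz, smul_zero, add_zero] at zv zu
    have h0 : φ (b 2) (b 0) = 0 := by
      have : n • φ (b 2) (b 0) = 0 := by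
        linear_combination (norm := skip) p • zv - q • zu
        rw [hn]; module
      exact (smul_eq_zero.1 this).resolve_left hpq
    have h1 : φ (b 2) (b 1) = 0 := by
      have : n • φ (b 2) (b 1) = 0 := by
        linear_combination (norm := skip) q • zv + p • zu
        rw [hn]; module
      exact (smul_eq_zero.1 this).resolve_left hpq
    exact b.ext fun i => by fin_cases i <;> simp [h0, h1, zz]

end Heisenberg

/-! ## Pairs of Hessian left-symmetric products -/

section HessianPair

variable {V : Type*} [AddCommGroup V] [Module ℝ V]

theorem IsHeisenbergBasis.exists_basis {c : V →ₗ[ℝ] V →ₗ[ℝ] V} {b : Module.Basis (Fin 3) ℝ V}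
    (hb : IsHeisenbergBasis c b) {u v : V} (huv : c u v ≠ 0) :
    ∃ b' : Module.Basis (Fin 3) ℝ V, IsHeisenbergBasis c b' ∧ b' 0 = u ∧ b' 1 = v ∧ b' 2 = c u v := by
  have hcc : ∀ u v w, c u (c v w) = 0 := fun u v w => by
    rw [hb.apply v w, map_smul, hb.central, smul_zero]
  have hV : Module.finrank ℝ V = 3 := by rw [Module.finrank_eq_card_basis b, Fintype.card_fin]
  have nil : ∀ u, IsNilpotent (R := Module.End ℝ V) (c u) := fun u =>
    ⟨2, LinearMap.ext fun v => by rw [pow_two]; exact hcc u u v⟩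
  have hli := linearIndependent_bracket hb.alt nil huv
  have : FiniteDimensional ℝ V := Module.finite_of_finrank_eq_succ hV
  refine ⟨basisOfLinearIndependentOfCardEqFinrank hli (by simp [hV]), ⟨hb.alt, ?_, fun w => ?_⟩,
    ?_, ?_, ?_⟩ <;> simp [hcc]

/-- The Gram matrix of `η` is, up to the factor `p` and the entry `η(e₁, e₁)`, that of an adapted
basis. -/
structure IsNullGram (η : LinearMap.BilinForm ℝ V) (b : Module.Basis (Fin 3) ℝ V) (p : ℝ) :
    Prop where
  ne_zero : p ≠ 0
  g00 : η (b 0) (b 0) = p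
  g01 : η (b 0) (b 1) = 0
  g02 : η (b 0) (b 2) = 0
  g12 : η (b 1) (b 2) = p
  g22 : η (b 2) (b 2) = 0

theorem IsHeisenbergBasis.exists_isNullGram {c : V →ₗ[ℝ] V →ₗ[ℝ] V} {b : Module.Basis (Fin 3) ℝ V}
    (hb : IsHeisenbergBasis c b) {η : LinearMap.BilinForm ℝ V} (hη : IsPseudoMetric η)
    (hz : η (b 2) (b 2) = 0) :
    ∃ (b' : Module.Basis (Fin 3) ℝ V) (p r : ℝ), IsHeisenbergBasis c b' ∧ IsNullGram η b' p ∧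
      b' 2 = r • b 2 := by
  obtain ⟨k, hk⟩ : ∃ k : Fin 2 → ℝ, k 0 = η (b 0) (b 2) ∧ k 1 = η (b 1) (b 2) :=
    ⟨![η (b 0) (b 2), η (b 1) (b 2)], rfl, rfl⟩
  obtain ⟨hk0, hk1⟩ := hk
  have ext0 : ∀ w, η (b 0) w = 0 → η (b 1) w = 0 → η (b 2) w = 0 → w = 0 := by
    intro w h0 h1 h2
    refine hη.nondegenerate.2 w fun v => ?_
    rw [b.eq_sum_three v]
    simp [h0, h1, h2]
  have hn : k 0 ^ 2 + k 1 ^ 2 ≠ 0 := by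
    intro h
    have e0 : k 0 = 0 := by nlinarith [sq_nonneg (k 0), sq_nonneg (k 1)]
    have e1 : k 1 = 0 := by nlinarith [sq_nonneg (k 0), sq_nonneg (k 1)]
    exact b.ne_zero 2 (ext0 _ (hk0 ▸ e0) (hk1 ▸ e1) hz)
  -- The covector `η(·, z)` is nonzero modulo the centre. The vector `u0` spans its kernel there,
  -- `u1` is normalised by `η(u1, z) = 1`, and the factor `n⁻¹` also gives `[u0, u1] = z`.
  set n := k 0 ^ 2 + k 1 ^ 2 with hn'
  set u0 := k 1 • b 0 - k 0 • b 1 with hu0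
  set u1 := n⁻¹ • (k 0 • b 0 + k 1 • b 1) with hu1
  have hc : c u0 u1 = b 2 := by
    rw [hb.apply, hu0, hu1]
    simp
    rw [show k 1 * (n⁻¹ * k 1) + k 0 * (n⁻¹ * k 0) = 1 by field_simp; rw [hn']; ring, one_smul]
  have h02 : η u0 (b 2) = 0 := by rw [hu0]; simp [← hk0, ← hk1]; ring
  have h12 : η u1 (b 2) = 1 := by
    rw [hu1]; simp [← hk0, ← hk1]; field_simp; rw [hn']
  obtain ⟨b₁, hb₁, b10, b11, b12⟩ := hb.exists_basis (u := u0) (v := u1) (by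
    rw [hc]; exact b.ne_zero 2)
  -- Otherwise `u0 - η(u0, u1) z` would be orthogonal to `u0`, `u1` and `z`.
  have hP : η u0 u0 ≠ 0 := by
    intro hP
    have h0 : u0 - η u0 u1 • b 2 = 0 := by
      refine hη.nondegenerate.2 _ fun v => ?_
      rw [b₁.eq_sum_three v, b10, b11, b12, hc]
      have h21 : η (b 2) u0 = 0 := by rw [hη.symm, h02]
      simp [hP, h02, h12, hz, h21, hη.symm u1 u0]
    have h1 : b₁ 0 - η u0 u1 • b₁ 2 = 0 := by rw [b10, b12, hc, h0]
    have h2 := congrArg (fun w => b₁.repr w 0) h1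
    simp at h2
  set P := η u0 u0
  -- Scaling `u0` by `P⁻¹` scales `z` by the same factor, and this makes the two nonzero Gram
  -- entries agree: `η(b₀, b₀) = η(b₁, b₂) = P⁻¹`. Subtracting a multiple of `u0` from `u1` makes
  -- `b₁` orthogonal to `b₀`.
  have hc' : c (P⁻¹ • u0) (u1 - (P⁻¹ * η u0 u1) • u0) = P⁻¹ • b 2 := by
    simp [hc, hb.alt]
  obtain ⟨b₂, hb₂, b20, b21, b22⟩ := hb.exists_basis (u := P⁻¹ • u0)
    (v := u1 - (P⁻¹ * η u0 u1) • u0) (by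
      rw [hc']; exact smul_ne_zero (inv_ne_zero hP) (b.ne_zero 2))
  refine ⟨b₂, P⁻¹, P⁻¹, hb₂, ⟨inv_ne_zero hP, ?_, ?_, ?_, ?_, ?_⟩, by rw [b22, hc']⟩
  · rw [b20]; simp [show η u0 u0 = P from rfl]; field_simp
  · rw [b20, b21]; simp [show η u0 u0 = P from rfl]; field_simp; ring_nf; simp
  · rw [b20, b22, hc']; simp [h02]
  · rw [b21, b22, hc']; simp [h02, h12]
  · rw [b22, hc']; simp [hz]

/-- Products `φ` and `ρ` on `V` that are flat, Hessian with respect to `η`, and matched. -/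
structure IsHessianPair (η : LinearMap.BilinForm ℝ V) (φ ρ : V →ₗ[ℝ] V →ₗ[ℝ] V) : Prop where
  metric : IsPseudoMetric η
  flat_left : ∀ u v w, φ (φ u v - φ v u) w = φ u (φ v w) - φ v (φ u w)
  hess_left : ∀ u v w, η (φ u v - φ v u) w = η u (φ v w) - η v (φ u w)
  flat_right : ∀ u v w, ρ (ρ u v - ρ v u) w = ρ u (ρ v w) - ρ v (ρ u w)
  hess_right : ∀ u v w, η (ρ u v - ρ v u) w = η u (ρ v w) - η v (ρ u w)
  left : ∀ u x y, φ u (ρ x y - ρ y x) - (ρ (φ u x) y - ρ y (φ u x)) - (ρ x (φ u y) - ρ (φ u y) x)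
    + φ (ρ x u) y - φ (ρ y u) x = 0
  right : ∀ x u v, ρ x (φ u v - φ v u) - (φ (ρ x u) v - φ v (ρ x u))
    - (φ u (ρ x v) - φ (ρ x v) u) + ρ (φ u x) v - ρ (φ v x) u = 0

variable {η : LinearMap.BilinForm ℝ V} {φ ρ : V →ₗ[ℝ] V →ₗ[ℝ] V}

theorem IsHessianPair.swap (h : IsHessianPair η φ ρ) : IsHessianPair η ρ φ :=
  ⟨h.metric, h.flat_right, h.hess_right, h.flat_left, h.hess_left, h.right, h.left⟩

/-- With `z = b 2` annihilated on both sides by `φ`, the matching condition reduces to `[w, ρ_u z] =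
ρ_{φ_w u} z`. The left side is a multiple of `z`, so nilpotency of `ρ_{φ_w u}` kills it. Thus `ρ_u
z` is central, a multiple of `z`, and nilpotency of `ρ_u` makes it zero. -/
theorem IsHessianPair.apply_center (h : IsHessianPair η φ ρ)
    {b : Module.Basis (Fin 3) ℝ V} (hb : IsHeisenbergBasis (φ - φ.flip) b)
    (nilφ : ∀ u, IsNilpotent (R := Module.End ℝ V) (φ u))
    (nilρ : ∀ u, IsNilpotent (R := Module.End ℝ V) (ρ u)) (u : V) : ρ u (b 2) = 0 := by
  obtain ⟨h1, h2⟩ := hb.apply_center h.flat_left nilφ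
  have br : ∀ u v, φ u v - φ v u =
      (b.repr u 0 * b.repr v 1 - b.repr u 1 * b.repr v 0) • b 2 := fun u v => hb.apply u v
  have key : ∀ w, b.repr w 0 * b.repr (ρ u (b 2)) 1 - b.repr w 1 * b.repr (ρ u (b 2)) 0 = 0 := by
    intro w
    have h3 := h.right u w (b 2)
    simp only [h1, h2, LinearMap.zero_apply, map_zero, sub_zero, zero_sub, sub_self] at h3
    rw [br, neg_add_eq_zero] at h3
    exact (nilρ _).eq_zero_of_apply_eq_smul (b.ne_zero 2) h3.symm
  have h0 : b.repr (ρ u (b 2)) 1 = 0 := by simpa using key (b 0)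
  have h1 : b.repr (ρ u (b 2)) 0 = 0 := by simpa using key (b 1)
  have h2 := b.eq_sum_three (ρ u (b 2))
  rw [h0, h1, zero_smul, zero_smul, zero_add, zero_add] at h2
  exact (nilρ u).apply_eq_zero_of_apply_eq_smul h2

/-- The normal form of a Hessian product whose bracket is `[e₀, e₁] = t e₂`. -/
structure IsTriangular (φ : V →ₗ[ℝ] V →ₗ[ℝ] V) (b : Module.Basis (Fin 3) ℝ V) (t x x₀ : ℝ) :
    Prop where
  a00 : φ (b 0) (b 0) = 0
  a01 : φ (b 0) (b 1) = x • b 2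
  a10 : φ (b 1) (b 0) = (x - t) • b 2
  a11 : φ (b 1) (b 1) = (x + t) • b 0 + x₀ • b 2
  center_left : φ (b 2) = 0
  center_right : ∀ u, φ u (b 2) = 0

theorem IsNullGram.exists_isTriangular {b : Module.Basis (Fin 3) ℝ V} {p t : ℝ}
    (hg : IsNullGram η b p) (hη : IsPseudoMetric η)
    (hess : ∀ u v w, η (φ u v - φ v u) w = η u (φ v w) - η v (φ u w))
    (nil : ∀ u, IsNilpotent (R := Module.End ℝ V) (φ u))
    (h1 : φ (b 2) = 0) (h2 : ∀ u, φ u (b 2) = 0) (ht : φ (b 0) (b 1) - φ (b 1) (b 0) = t • b 2) :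
    ∃ x x₀, IsTriangular φ b t x x₀ := by
  have hp := hg.ne_zero
  have g10 : η (b 1) (b 0) = 0 := by rw [hη.symm, hg.g01]
  have g20 : η (b 2) (b 0) = 0 := by rw [hη.symm, hg.g02]
  have g21 : η (b 2) (b 1) = p := by rw [hη.symm, hg.g12]
  -- The Hessian identity with `z = b 2` in the second slot says that `φ u w` is orthogonal to `z`,
  -- which removes its `b 1` component.
  have comp : ∀ u w, φ u w = b.repr (φ u w) 0 • b 0 + b.repr (φ u w) 2 • b 2 := by
    intro u w
    have h := hess u (b 2) w
    simp only [h1, h2, LinearMap.zero_apply, map_zero, sub_self, zero_sub] at h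
    rw [b.eq_sum_three (φ u w)] at h
    simp [g20, g21, hg.g22, hp] at h
    conv_lhs => rw [b.eq_sum_three (φ u w), h]
    rw [zero_smul, add_zero]
  -- Since `φ u` kills `b 2`, a nonzero `b 0` component would be an eigenvalue of `φ u` on the
  -- vector `φ u (b 0)`.
  have comp0 : ∀ u, b.repr (φ u (b 0)) 0 = 0 := by
    intro u
    by_contra h
    have h3 : φ u (φ u (b 0)) = b.repr (φ u (b 0)) 0 • φ u (b 0) := by
      conv_lhs => rw [comp u (b 0)]
      rw [map_add, map_smul, map_smul, h2, smul_zero, add_zero]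
    refine h ((nil u).eq_zero_of_apply_eq_smul ?_ h3)
    intro h4
    rw [h4] at h
    simp at h
  have e00 := comp (b 0) (b 0)
  have e10 := comp (b 1) (b 0)
  have e01 := comp (b 0) (b 1)
  have e11 := comp (b 1) (b 1)
  rw [comp0, zero_smul, zero_add] at e00 e10
  have ht0 := congrArg (fun w => b.repr w 0) ht
  have ht2 := congrArg (fun w => b.repr w 2) ht
  simp [comp0] at ht0 ht2
  rw [ht0, zero_smul, zero_add] at e01
  set x := b.repr (φ (b 0) (b 1)) 2
  have hx : b.repr (φ (b 1) (b 0)) 2 = x - t := by linarith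
  -- The two remaining Hessian identities give `φ (b 0) (b 0) = 0` and the coefficient `x + t`; the
  -- unknown entry `η (b 1) (b 1)` never enters.
  have h00 := hess (b 0) (b 1) (b 0)
  have h11 := hess (b 0) (b 1) (b 1)
  rw [ht, e00, e10] at h00
  rw [ht, e01, e11] at h11
  simp [hg.g12, hg.g02, hg.g00, g20, g21, hp] at h00 h11
  have hx' : b.repr (φ (b 1) (b 1)) 0 = x + t := by
    apply mul_right_cancel₀ hp; linarith
  refine ⟨x, b.repr (φ (b 1) (b 1)) 2, ?_, e01, by rw [e10, hx], by rw [← hx', ← e11], h1, h2⟩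
  rw [e00, h00, zero_smul]

theorem IsHessianPair.exists_isTriangular (h : IsHessianPair η φ ρ)
    (hV : Module.finrank ℝ V = 3)
    (nilφ : ∀ u, IsNilpotent (R := Module.End ℝ V) (φ u))
    (nilρ : ∀ u, IsNilpotent (R := Module.End ℝ V) (ρ u))
    (nilcφ : ∀ u, IsNilpotent (R := Module.End ℝ V) ((φ - φ.flip) u))
    (nilcρ : ∀ u, IsNilpotent (R := Module.End ℝ V) ((ρ - ρ.flip) u))
    (hφ : φ - φ.flip ≠ 0) :
    ∃ (b : Module.Basis (Fin 3) ℝ V) (x x₀ t y y₀ : ℝ),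
      IsTriangular φ b 1 x x₀ ∧ IsTriangular ρ b t y y₀ := by
  -- The Hessian identity makes the centre orthogonal to the image of the product, and the centre
  -- itself is a commutator of that product.
  have null : ∀ {φ : V →ₗ[ℝ] V →ₗ[ℝ] V} {b : Module.Basis (Fin 3) ℝ V},
      IsHeisenbergBasis (φ - φ.flip) b → φ (b 2) = 0 → (∀ u, φ u (b 2) = 0) →
      (∀ u v w, η (φ u v - φ v u) w = η u (φ v w) - η v (φ u w)) → η (b 2) (b 2) = 0 := by
    intro φ b hb h1 h2 hess
    have h3 : ∀ u w, η (b 2) (φ u w) = 0 := fun u w => by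
      have h := hess u (b 2) w
      simpa only [h1, h2, LinearMap.zero_apply, map_zero, sub_self, zero_sub, zero_eq_neg] using h
    have h4 : φ (b 0) (b 1) - φ (b 1) (b 0) = b 2 := hb.bracket
    have h5 := congrArg (η (b 2)) h4
    rw [map_sub, h3, h3, sub_zero] at h5
    exact h5.symm
  obtain ⟨b₀, hb₀⟩ := exists_isHeisenbergBasis hV (fun u => sub_self _) nilcφ hφ
  obtain ⟨h1, h2⟩ := hb₀.apply_center h.flat_left nilφ
  obtain ⟨b, p, -, hb, hg, -⟩ := hb₀.exists_isNullGram h.metric (null hb₀ h1 h2 h.hess_left)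
  obtain ⟨h1, h2⟩ := hb.apply_center h.flat_left nilφ
  obtain ⟨x, x₀, htri⟩ := hg.exists_isTriangular (t := 1) h.metric h.hess_left nilφ h1 h2 (by
    rw [one_smul]; exact hb.bracket)
  have hρz := h.apply_center hb nilφ nilρ
  suffices key : ρ (b 2) = 0 ∧ ∃ t : ℝ, ρ (b 0) (b 1) - ρ (b 1) (b 0) = t • b 2 by
    obtain ⟨h3, t, ht⟩ := key
    obtain ⟨y, y₀, htri'⟩ := hg.exists_isTriangular h.metric h.hess_right nilρ h3 hρz ht
    exact ⟨b, x, x₀, t, y, y₀, htri, htri'⟩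
  by_cases hρ : ρ - ρ.flip = 0
  · have hc : ∀ u v, ρ u v - ρ v u = 0 := fun u v => by
      simpa using congrArg (fun f : V →ₗ[ℝ] V →ₗ[ℝ] V => f u v) hρ
    refine ⟨LinearMap.ext fun u => ?_, 0, by rw [hc, zero_smul]⟩
    rw [sub_eq_zero.1 (hc (b 2) u), hρz, LinearMap.zero_apply]
  -- When `𝔤₊` is also Heisenberg, its centre `d 2` turns out to be the same line as `b 2`: being
  -- killed by every `φ u`, it has no `b 1` component since `x` and `x + 1` cannot both vanish, and
  -- being null, it has no `b 0` component.
  · obtain ⟨d, hd⟩ := exists_isHeisenbergBasis hV (fun u => sub_self _) nilcρ hρ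
    obtain ⟨k1, k2⟩ := hd.apply_center h.flat_right nilρ
    have hφz := h.swap.apply_center hd nilρ nilφ
    have hnull := null hd k1 k2 h.hess_right
    have sum := b.eq_sum_three (d 2)
    set r0 := b.repr (d 2) 0
    set r1 := b.repr (d 2) 1
    set r2 := b.repr (d 2) 2
    have hφ0 := hφz (b 0)
    have hφ1 := hφz (b 1)
    rw [sum] at hφ0 hφ1
    simp only [map_add, map_smul, htri.a00, htri.a01, htri.a10, htri.a11, h2, smul_zero, zero_add,
      add_zero] at hφ0 hφ1
    have hφ0' := congrArg (fun w => b.repr w 2) hφ0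
    have hφ1' := congrArg (fun w => b.repr w 0) hφ1
    simp only [map_add, map_smul, Module.Basis.repr_self, Finsupp.smul_single, Finsupp.add_apply,
      Finsupp.single_apply, Finsupp.smul_apply, map_zero, Finsupp.zero_apply] at hφ0' hφ1'
    simp at hφ0' hφ1'
    have hr1 : r1 = 0 := by
      rcases hφ0' with h | h
      · exact h
      · rcases hφ1' with h' | h'
        · exact h'
        · linarith
    rw [hr1, zero_smul, add_zero] at sum
    have g20 : η (b 2) (b 0) = 0 := by rw [h.metric.symm, hg.g02]
    have hr0 : r0 = 0 := by
      rw [sum] at hnull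
      simpa [hg.g00, hg.g02, g20, hg.g22, hg.ne_zero] using hnull
    rw [hr0, zero_smul, zero_add] at sum
    have hr2 : r2 ≠ 0 := by rintro h; rw [h, zero_smul] at sum; exact d.ne_zero 2 sum
    refine ⟨?_, _, (hd.apply (b 0) (b 1)).trans (by rw [sum, smul_smul])⟩
    rw [sum, map_smul] at k1
    exact (smul_eq_zero.1 k1).resolve_left hr2

end HessianPair

/-! ## The four-generator family of structure equations -/

namespace StructureEquations

variable {n : ℕ} (s : StructureEquations n)

theorem lie_apply (u v : s.Alg) (k : Fin n) :
    (⁅u, v⁆ : s.Alg) k = - s.d k u v := rfl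

/-- A Lie algebra with a basis satisfying the structure equations is isomorphic to the model. -/
theorem nonempty_equiv {L : Type*} [LieRing L] [LieAlgebra ℝ L] (b : Module.Basis (Fin n) ℝ L)
    (h : ∀ i j, i < j → ⁅b i, b j⁆ = - ∑ k, s.d k (Pi.single i 1) (Pi.single j 1) • b k) :
    Nonempty (L ≃ₗ⁅ℝ⁆ s.Alg) := by
  have hall : ∀ i j, ⁅b i, b j⁆ = - ∑ k, s.d k (Pi.single i 1) (Pi.single j 1) • b k := by
    intro i j
    rcases lt_trichotomy i j with hij | rfl | hij
    · exact h i j hij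
    · simp [s.alt]
    · rw [← lie_skew, h j i hij, neg_neg, ← Finset.sum_neg_distrib]
      exact Finset.sum_congr rfl fun k _ => by
        rw [s.d_swap k (Pi.single i 1), neg_smul, neg_neg]
  let e : (Fin n → ℝ) ≃ₗ[ℝ] L := b.equivFun.symm
  have he : ∀ i, e (Pi.single i 1) = b i := fun i => by
    simp [e, Module.Basis.equivFun_symm_apply, Pi.single_apply]
  have key : ∀ x y : Fin n → ℝ, e (s.bracket x y) = ⁅e x, e y⁆ := by
    let B₁ : (Fin n → ℝ) →ₗ[ℝ] (Fin n → ℝ) →ₗ[ℝ] L := LinearMap.mk₂ ℝ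
      (fun x y => e (s.bracket x y))
      (fun x y z => by rw [s.bracket_add_left, map_add])
      (fun c x y => by
        have : s.bracket (c • x) y = c • s.bracket x y := by
          funext k; simp [bracket]
        rw [this, map_smul])
      (fun x y z => by rw [s.bracket_add_right, map_add])
      (fun c x y => by rw [s.bracket_smul_right, map_smul])
    let B₂ : (Fin n → ℝ) →ₗ[ℝ] (Fin n → ℝ) →ₗ[ℝ] L := LinearMap.mk₂ ℝ
      (fun x y => ⁅e x, e y⁆)
      (fun x y z => by rw [map_add, add_lie])
      (fun c x y => by rw [map_smul, smul_lie])
      (fun x y z => by rw [map_add, lie_add])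
      (fun c x y => by rw [map_smul, lie_smul])
    have : B₁ = B₂ := by
      refine LinearMap.ext_basis (Pi.basisFun ℝ (Fin n)) (Pi.basisFun ℝ (Fin n)) fun i j => ?_
      simp only [Pi.basisFun_apply, B₁, B₂, LinearMap.mk₂_apply, he, hall]
      rw [show e = b.equivFun.symm from rfl, b.equivFun_symm_apply]
      simp [bracket]
    intro x y
    exact congrArg (fun B : (Fin n → ℝ) →ₗ[ℝ] (Fin n → ℝ) →ₗ[ℝ] L => B x y) this
  let f : s.Alg ≃ₗ⁅ℝ⁆ L :=
    { e with map_lie' := fun {x y} => key x y }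
  exact ⟨f.symm⟩

/-- An injective linear map compatible with the brackets is an isomorphism of models. -/
theorem nonempty_equiv_of_matrix (s s' : StructureEquations n) (M : Matrix (Fin n) (Fin n) ℝ)
    (hM : ∀ x, M.mulVec x = 0 → x = 0)
    (h : ∀ x y, s'.bracket (M.mulVec x) (M.mulVec y) = M.mulVec (s.bracket x y)) :
    Nonempty (s'.Alg ≃ₗ⁅ℝ⁆ s.Alg) := by
  let e : (Fin n → ℝ) ≃ₗ[ℝ] (Fin n → ℝ) := LinearEquiv.ofInjectiveEndo M.mulVecLin
    (by rw [← LinearMap.ker_eq_bot, LinearMap.ker_eq_bot']; exact hM)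
  let f : s.Alg ≃ₗ⁅ℝ⁆ s'.Alg := { e with map_lie' := fun {x y} => (h x y).symm }
  exact ⟨f.symm⟩

end StructureEquations

/-- The structure equations of the double with basis `f₀, f₁, f₂, e₀, e₁, e₂` and brackets
`[e₀, e₁] = e₂`, `[f₀, f₁] = t f₂`, `[e₀, f₁] = x f₂ - (y - t) e₂`,
`[e₁, f₀] = (x - 1) f₂ - y e₂`, `[e₁, f₁] = (x + 1) f₀ + x₀ f₂ - (y + t) e₀ - y₀ e₂`. -/
def doubleFamily (t x y x₀ y₀ : ℝ) : StructureEquations 6 where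
  d := ![(x + 1) • wedge 1 4, 0,
    -(t • wedge 0 1) + x • wedge 1 3 + (x - 1) • wedge 0 4 + x₀ • wedge 1 4,
    -((y + t) • wedge 1 4), 0,
    -wedge 3 4 - (y - t) • wedge 1 3 - y • wedge 0 4 - y₀ • wedge 1 4]
  alt k x := by fin_cases k <;> simp <;> first | ring1 | (right; ring1)
  jacobi k x y z := by fin_cases k <;> simp <;> ring


/-- Rotating each plane spanned by `f_i, e_i` replaces `𝔤₊` by the span of the `f_i - t e_i`, which
is abelian. The scales `n, 1, n²` on the three planes restore `[e₀, e₁] = e₂`. In complex notation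
`x' + iy' = (x + iy) / (1 + it)`, and `x₀ + iy₀` is multiplied by `(1 - it) / n²`. -/
theorem doubleFamily_equiv_zero (t x y x₀ y₀ : ℝ) :
    ∃ x' y' x₀' y₀', Nonempty ((doubleFamily t x y x₀ y₀).Alg ≃ₗ⁅ℝ⁆
      (doubleFamily 0 x' y' x₀' y₀').Alg) := by
  have hn : 1 + t ^ 2 ≠ 0 := by positivity
  obtain ⟨n, hn'⟩ : ∃ n, n = 1 + t ^ 2 := ⟨_, rfl⟩
  rw [← hn'] at hn
  refine ⟨(x + y * t) / n, (y - x * t) / n, (x₀ + t * y₀) / n ^ 2, (y₀ - t * x₀) / n ^ 2,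
    StructureEquations.nonempty_equiv_of_matrix _ _
    !![n, 0, 0, n * t, 0, 0;
      0, 1, 0, 0, t, 0;
      0, 0, n ^ 2, 0, 0, n ^ 2 * t;
      -n * t, 0, 0, n, 0, 0;
      0, -t, 0, 0, 1, 0;
      0, 0, -n ^ 2 * t, 0, 0, n ^ 2] ?_ ?_⟩
  · intro u hu
    have h0 := congrFun hu 0
    have h1 := congrFun hu 1
    have h2 := congrFun hu 2
    have h3 := congrFun hu 3
    have h4 := congrFun hu 4
    have h5 := congrFun hu 5
    simp [Matrix.mulVec, dotProduct, Fin.sum_univ_six] at h0 h1 h2 h3 h4 h5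
    have e0 : u 0 = 0 := mul_left_cancel₀ (pow_ne_zero 2 hn) (by
      linear_combination h0 - t * h3 + n * u 0 * hn')
    have e1 : u 1 = 0 := mul_left_cancel₀ hn (by
      linear_combination h1 - t * h4 + u 1 * hn')
    have e2 : u 2 = 0 := mul_left_cancel₀ (pow_ne_zero 3 hn) (by
      linear_combination h2 - t * h5 + n ^ 2 * u 2 * hn')
    have e3 : u 3 = 0 := mul_left_cancel₀ hn (by linear_combination h3 + n * t * e0)
    have e4 : u 4 = 0 := by linear_combination h4 + t * e1
    have e5 : u 5 = 0 := mul_left_cancel₀ (pow_ne_zero 2 hn) (by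
      linear_combination h5 + n ^ 2 * t * e2)
    funext i
    fin_cases i <;> assumption
  · intro u v
    funext l
    fin_cases l <;> simp [doubleFamily, StructureEquations.bracket, Matrix.mulVec, dotProduct, Fin.sum_univ_six]
    all_goals field_simp
    all_goals simp only [hn']
    all_goals ring

/-- In this and the next four results, the columns of the matrix are the images of the standard
basis of the model, written in the basis `f₀, f₁, f₂, e₀, e₁, e₂`. At `x = -1` the vector `f₀` drops
out of `[e₁, f₁]`, which leaves four generators. -/
theorem doubleFamily_equiv_h4 (x₀ y₀ : ℝ) :
    Nonempty ((doubleFamily 0 (-1) 0 x₀ y₀).Alg ≃ₗ⁅ℝ⁆ h4.Alg) := by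
  refine StructureEquations.nonempty_equiv_of_matrix _ _
    !![0, 0, x₀ / 2, 1 / 2, 0, 0;
      0, 0, 1, 0, 0, 0;
      0, 0, 0, 0, 0, 1;
      0, 1, -y₀, 0, 0, 0;
      1, 0, 0, 0, 0, 0;
      0, 0, 0, 0, 1, 0] ?_ ?_
  · intro u hu
    have k0 := congrFun hu 0
    have k1 := congrFun hu 1
    have k2 := congrFun hu 2
    have k3 := congrFun hu 3
    have k4 := congrFun hu 4
    have k5 := congrFun hu 5
    simp [Matrix.mulVec, dotProduct, Fin.sum_univ_six] at k0 k1 k2 k3 k4 k5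
    have e3 : u 3 = 0 := by linear_combination 2 * k0 - x₀ * k1
    have e1 : u 1 = 0 := by linear_combination k3 + y₀ * k1
    funext i
    fin_cases i <;> assumption
  · intro u v
    funext l
    fin_cases l <;> simp [doubleFamily, h4, StructureEquations.bracket, Matrix.mulVec,
      dotProduct, Fin.sum_univ_six]
    all_goals ring

/-- At `x = 0` the bracket `[e₀, f₁]` vanishes, so the term `23` in the last structure equation is
absent. -/
theorem doubleFamily_equiv_h10 (x₀ y₀ : ℝ) :
    Nonempty ((doubleFamily 0 0 0 x₀ y₀).Alg ≃ₗ⁅ℝ⁆ h10.Alg) := by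
  refine StructureEquations.nonempty_equiv_of_matrix _ _
    !![0, 0, 0, -1, 0, 0;
      0, 1, 0, 0, 0, 0;
      0, 0, 0, -x₀, 0, -1;
      0, 0, 1, 0, 0, 0;
      1, 0, 0, 0, 0, 0;
      0, 0, 0, y₀, 1, 0] ?_ ?_
  · intro u hu
    have k0 := congrFun hu 0
    have k1 := congrFun hu 1
    have k2 := congrFun hu 2
    have k3 := congrFun hu 3
    have k4 := congrFun hu 4
    have k5 := congrFun hu 5
    simp [Matrix.mulVec, dotProduct, Fin.sum_univ_six] at k0 k1 k2 k3 k4 k5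
    have e5 : u 5 = 0 := by linear_combination -k2 - x₀ * k0
    have e4 : u 4 = 0 := by linear_combination k5 - y₀ * k0
    funext i
    fin_cases i <;> assumption
  · intro u v
    funext l
    fin_cases l <;> simp [doubleFamily, h10, StructureEquations.bracket, Matrix.mulVec,
      dotProduct, Fin.sum_univ_six]
    all_goals ring

/-- At `x = 1` the bracket `[e₁, f₀]` vanishes, so the derived algebra is central. -/
theorem doubleFamily_equiv_h7 (x₀ y₀ : ℝ) :
    Nonempty ((doubleFamily 0 1 0 x₀ y₀).Alg ≃ₗ⁅ℝ⁆ h7.Alg) := by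
  refine StructureEquations.nonempty_equiv_of_matrix _ _
    !![0, 0, 0, 0, 0, -2;
      0, 0, 1, 0, 0, 0;
      0, 0, 0, 0, -1, -x₀;
      1, 0, 0, 0, 0, 0;
      0, 1, 0, 0, 0, 0;
      0, 0, 0, -1, 0, y₀] ?_ ?_
  · intro u hu
    have k0 := congrFun hu 0
    have k1 := congrFun hu 1
    have k2 := congrFun hu 2
    have k3 := congrFun hu 3
    have k4 := congrFun hu 4
    have k5 := congrFun hu 5
    simp [Matrix.mulVec, dotProduct, Fin.sum_univ_six] at k0 k1 k2 k3 k4 k5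
    have e4 : u 4 = 0 := by linear_combination -k2 - x₀ * k0
    have e3 : u 3 = 0 := by linear_combination -k5 + y₀ * k0
    funext i
    fin_cases i <;> assumption
  · intro u v
    funext l
    fin_cases l <;> simp [doubleFamily, h7, StructureEquations.bracket, Matrix.mulVec,
      dotProduct, Fin.sum_univ_six]
    all_goals ring

/-- Take `ε₁ = e₁`, `ε₂ = f₁` and `ε₄ = -[e₁, f₁]`. Then `[ε₁, ε₄] = -(x² - 1) f₂`, and `ε₃` is the
multiple of `e₀` for which `[ε₂, ε₃]` has this same value; this needs `x ≠ 0` and `x² ≠ 1`. -/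
theorem doubleFamily_equiv_h11 (x x₀ y₀ : ℝ) (h0 : x ≠ -1) (h1 : x ≠ 0) (h2 : x ≠ 1) :
    Nonempty ((doubleFamily 0 x 0 x₀ y₀).Alg ≃ₗ⁅ℝ⁆ h11.Alg) := by
  refine StructureEquations.nonempty_equiv_of_matrix _ _
    !![0, 0, 0, -(x + 1), 0, 0;
      0, 1, 0, 0, 0, 0;
      0, 0, 0, -x₀, 0, x ^ 2 - 1;
      0, 0, (x ^ 2 - 1) / x, 0, 0, 0;
      1, 0, 0, 0, 0, 0;
      0, 0, 0, y₀, (x ^ 2 - 1) / x, 0] ?_ ?_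
  · intro u hu
    have k0 := congrFun hu 0
    have k1 := congrFun hu 1
    have k2 := congrFun hu 2
    have k3 := congrFun hu 3
    have k4 := congrFun hu 4
    have k5 := congrFun hu 5
    simp [Matrix.mulVec, dotProduct, Fin.sum_univ_six] at k0 k1 k2 k3 k4 k5
    have hx : x ^ 2 - 1 ≠ 0 := by
      rw [show x ^ 2 - 1 = (x + 1) * (x - 1) by ring]
      exact mul_ne_zero (fun h => h0 (by linarith)) (sub_ne_zero.2 h2)
    have e3 : u 3 = 0 := k0.resolve_left fun h => h0 (by linarith)
    have e2 : u 2 = 0 := k3.resolve_left fun h => h.elim hx h1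
    have e5 : u 5 = 0 := mul_left_cancel₀ hx (by linear_combination k2 + x₀ * e3)
    have e4 : u 4 = 0 := mul_left_cancel₀ (div_ne_zero hx h1) (by linear_combination k5 - y₀ * e3)
    funext i
    fin_cases i <;> assumption
  · intro u v
    funext l
    fin_cases l <;> simp [doubleFamily, h11, StructureEquations.bracket, Matrix.mulVec,
      dotProduct, Fin.sum_univ_six]
    all_goals (field_simp <;> ring)

/-- The first column is `ε₁ = (1 - x) f₁ + y e₁`, with the multiple of `f₁` chosen so that `[ε₁,
ε₃]` and `[ε₁, ε₄]` coincide for `ε₃ = -y f₀`, `ε₄ = -[ε₁, f₁]`. -/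
theorem doubleFamily_equiv_h13 (x y x₀ y₀ : ℝ) (hy : y ≠ 0) :
    Nonempty ((doubleFamily 0 x y x₀ y₀).Alg ≃ₗ⁅ℝ⁆ h13.Alg) := by
  refine StructureEquations.nonempty_equiv_of_matrix _ _
    !![0, 0, -y, -y * (x + 1), 0, 0;
      1 - x, 1, 0, 0, 0, 0;
      0, 0, 0, -y * x₀, y ^ 2 * (x - 1), x * y ^ 2;
      0, 0, 0, y ^ 2, 0, 0;
      y, 0, 0, 0, 0, 0;
      0, 0, 0, y * y₀, -y ^ 3, -y ^ 3] ?_ ?_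
  · intro u hu
    have k0 := congrFun hu 0
    have k1 := congrFun hu 1
    have k2 := congrFun hu 2
    have k3 := congrFun hu 3
    have k4 := congrFun hu 4
    have k5 := congrFun hu 5
    simp [Matrix.mulVec, dotProduct, Fin.sum_univ_six] at k0 k1 k2 k3 k4 k5
    have e0 : u 0 = 0 := k4.resolve_left hy
    have e3 : u 3 = 0 := k3.resolve_left hy
    have e1 : u 1 = 0 := by linear_combination k1 - (1 - x) * e0
    have e2 : u 2 = 0 := mul_left_cancel₀ hy (by linear_combination -k0 - y * (x + 1) * e3)
    have e4 : u 4 = 0 := mul_left_cancel₀ (pow_ne_zero 3 hy) (by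
      linear_combination -y * k2 - x * k5 + (x * y * y₀ - y ^ 2 * x₀) * e3)
    have e5 : u 5 = 0 := mul_left_cancel₀ (pow_ne_zero 3 hy) (by
      linear_combination -k5 + y * y₀ * e3 - y ^ 3 * e4)
    funext i
    fin_cases i <;> assumption
  · intro u v
    funext l
    fin_cases l <;> simp [doubleFamily, h13, StructureEquations.bracket, Matrix.mulVec,
      dotProduct, Fin.sum_univ_six]
    all_goals ring

/-! ## Integrable Born structures as doubles -/

section Double

variable {L V : Type*} [LieRing L] [LieAlgebra ℝ L] [AddCommGroup V] [Module ℝ V]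

/-- The bracket of `L = V ⊕ V` is that of the double of the products `φ` and `ρ`. -/
structure IsDouble (Φ : (V × V) ≃ₗ[ℝ] L) (φ ρ : V →ₗ[ℝ] V →ₗ[ℝ] V) : Prop where
  lie_snd : ∀ u v, ⁅Φ (0, u), Φ (0, v)⁆ = Φ (0, φ u v - φ v u)
  lie_fst : ∀ u v, ⁅Φ (u, 0), Φ (v, 0)⁆ = Φ (ρ u v - ρ v u, 0)
  lie_mixed : ∀ u v, ⁅Φ (0, u), Φ (v, 0)⁆ = Φ (φ u v, - ρ v u)

variable {Φ : (V × V) ≃ₗ[ℝ] L} {φ ρ : V →ₗ[ℝ] V →ₗ[ℝ] V}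

/-- This symmetry halves the work: every fact proved for `φ` and `𝔤₋` holds for `ρ` and `𝔤₊`. -/
theorem IsDouble.swap (h : IsDouble Φ φ ρ) :
    IsDouble ((LinearEquiv.prodComm ℝ V V).trans Φ) ρ φ where
  lie_snd u v := h.lie_fst u v
  lie_fst u v := h.lie_snd u v
  lie_mixed u v := by
    change ⁅Φ (u, 0), Φ (0, v)⁆ = Φ (- φ v u, ρ u v)
    rw [← lie_skew, h.lie_mixed, ← map_neg]
    simp

theorem IsDouble.lie_snd_apply (h : IsDouble Φ φ ρ) (u : V) (a : V × V) :
    ⁅Φ (0, u), Φ a⁆ = Φ (φ u a.1, φ u a.2 - φ a.2 u - ρ a.1 u) := by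
  have : a = (a.1, 0) + (0, a.2) := by simp
  rw [this, map_add, lie_add, h.lie_mixed, h.lie_snd, ← map_add]
  congr 1
  simp only [Prod.mk_add_mk, add_zero, zero_add, Prod.mk.injEq, true_and]
  abel

/-- Both identities are components of the Jacobi identity for two vectors of the second summand and
one of the first. -/
theorem IsDouble.jacobi (h : IsDouble Φ φ ρ) :
    (∀ u v w, φ (φ u v - φ v u) w = φ u (φ v w) - φ v (φ u w)) ∧
    (∀ x u v, ρ x (φ u v - φ v u) - (φ (ρ x u) v - φ v (ρ x u))
      - (φ u (ρ x v) - φ (ρ x v) u) + ρ (φ u x) v - ρ (φ v x) u = 0) := by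
  have key : ∀ u v w, (φ u (φ v w), φ u (- ρ w v) - φ (- ρ w v) u - ρ (φ v w) u) =
      (φ (φ u v - φ v u) w, - ρ w (φ u v - φ v u)) +
      (φ v (φ u w), φ v (- ρ w u) - φ (- ρ w u) v - ρ (φ u w) v) := by
    intro u v w
    have := leibniz_lie (Φ (0, u)) (Φ (0, v)) (Φ (w, 0))
    rw [h.lie_mixed v w, h.lie_mixed u w, h.lie_snd u v, h.lie_mixed, h.lie_snd_apply,
      h.lie_snd_apply, ← map_add] at this
    exact Φ.injective this
  refine ⟨fun u v w => ?_, fun x u v => ?_⟩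
  · have := congrArg Prod.fst (key u v w)
    simp only [Prod.fst_add] at this
    rw [this, add_sub_cancel_right]
  · have := congrArg Prod.snd (key u v x)
    simp only [Prod.snd_add, map_neg, LinearMap.neg_apply] at this
    linear_combination (norm := abel) this

/-- The operator `ad (Φ (0, u))` preserves the second summand, acting there by the commutator
bracket, and induces `φ u` on the quotient; both inherit nilpotency. -/
theorem IsDouble.nilpotent [LieRing.IsNilpotent L] (h : IsDouble Φ φ ρ) (u : V) :
    IsNilpotent (R := Module.End ℝ V) (φ u) ∧
      IsNilpotent (R := Module.End ℝ V) ((φ - φ.flip) u) := by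
  obtain ⟨n, hn⟩ := LieModule.exists_forall_pow_toEnd_eq_zero ℝ L L
  have hn := hn (Φ (0, u))
  have step : ∀ a, (LieModule.toEnd ℝ L L (Φ (0, u))) (Φ a) =
      Φ (φ u a.1, φ u a.2 - φ a.2 u - ρ a.1 u) := fun a => h.lie_snd_apply u a
  set T := LieModule.toEnd ℝ L L (Φ (0, u))
  have h1 : ∀ (k : ℕ) (v : V × V),
      (Φ.symm ((T ^ k) (Φ v))).1 = ((φ u : Module.End ℝ V) ^ k) v.1 := by
    intro k
    induction k with
    | zero => intro v; simp
    | succ k ih => intro v; rw [pow_succ, Module.End.mul_apply, step, ih, pow_succ]; rfl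
  have h2 : ∀ (k : ℕ) (v : V),
      (T ^ k) (Φ (0, v)) = Φ (0, (((φ - φ.flip) u : Module.End ℝ V) ^ k) v) := by
    intro k
    induction k with
    | zero => intro v; simp
    | succ k ih =>
      intro v
      rw [pow_succ, Module.End.mul_apply, step, pow_succ, Module.End.mul_apply]
      simpa using ih (φ u v - φ v u)
  refine ⟨⟨n, LinearMap.ext fun v => ?_⟩, ⟨n, LinearMap.ext fun v => ?_⟩⟩
  · have := h1 n (v, 0)
    rw [hn] at this
    simpa using this.symm
  · have := h2 n v
    rw [hn, LinearMap.zero_apply, eq_comm, LinearEquiv.map_eq_zero_iff] at this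
    exact congrArg Prod.snd this

theorem IsDouble.equiv_doubleFamily (h : IsDouble Φ φ ρ) {b : Module.Basis (Fin 3) ℝ V}
    {t x y x₀ y₀ : ℝ} (hφ : IsTriangular φ b 1 x x₀) (hρ : IsTriangular ρ b t y y₀) :
    Nonempty (L ≃ₗ⁅ℝ⁆ (doubleFamily t x y x₀ y₀).Alg) := by
  let B : Module.Basis (Fin 6) ℝ L := ((b.prod b).map Φ).reindex (finSumFinEquiv (m := 3) (n := 3))
  have B0 : B 0 = Φ (b 0, 0) := by
    simp [B, show finSumFinEquiv.symm (0 : Fin (3 + 3)) = Sum.inl 0 from rfl]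
  have B1 : B 1 = Φ (b 1, 0) := by
    simp [B, show finSumFinEquiv.symm (1 : Fin (3 + 3)) = Sum.inl 1 from rfl]
  have B2 : B 2 = Φ (b 2, 0) := by
    simp [B, show finSumFinEquiv.symm (2 : Fin (3 + 3)) = Sum.inl 2 from rfl]
  have B3 : B 3 = Φ (0, b 0) := by
    simp [B, show finSumFinEquiv.symm (3 : Fin (3 + 3)) = Sum.inr 0 from rfl]
  have B4 : B 4 = Φ (0, b 1) := by
    simp [B, show finSumFinEquiv.symm (4 : Fin (3 + 3)) = Sum.inr 1 from rfl]
  have B5 : B 5 = Φ (0, b 2) := by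
    simp [B, show finSumFinEquiv.symm (5 : Fin (3 + 3)) = Sum.inr 2 from rfl]
  have mixed' : ∀ u v, ⁅Φ (u, 0), Φ (0, v)⁆ = Φ (- φ v u, ρ u v) := h.swap.lie_mixed
  have hIK : ∀ u v, Φ (u, v) = (Φ.toLinearMap ∘ₗ LinearMap.inl ℝ V V) u +
      (Φ.toLinearMap ∘ₗ LinearMap.inr ℝ V V) v := fun u v => by
    change _ = Φ (u, 0) + Φ (0, v)
    rw [← map_add]; simp
  refine StructureEquations.nonempty_equiv _ B fun i j hij => ?_
  fin_cases i <;> fin_cases j <;> first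
    | exact absurd hij (by decide)
    | (simp only [Fin.sum_univ_six, Fin.zero_eta, Fin.mk_one, Fin.reduceFinMk, B0, B1, B2, B3, B4,
        B5, h.lie_fst, h.lie_snd, mixed', hφ.a00, hφ.a01, hφ.a10, hφ.a11, hφ.center_left,
        hφ.center_right, hρ.a00, hρ.a01, hρ.a10, hρ.a11, hρ.center_left, hρ.center_right,
        LinearMap.zero_apply]
       simp [doubleFamily]
       try (simp only [hIK, map_add, map_sub, map_neg, map_smul, map_zero]; module))
  module

end Double

/-! ### From an integrable Born structure to a Hessian pair on `𝔤₋`. -/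

section Born

variable {L : Type*} [LieRing L] [LieAlgebra ℝ L] {S : BornStructure L}

/-- Comparing the three recursion relations through `g` gives `B = -AJ`; then `B² = 1` reads `AJAJ =
1`, which with `A² = 1` and `J² = -1` is anticommutation. -/
theorem BornStructure.A_J (S : BornStructure L) (x : L) : S.A (S.J x) = - S.J (S.A x) := by
  have hB : ∀ x, S.B x = - S.A (S.J x) := fun x => by
    refine sub_eq_zero.1 (S.g_metric.nondegenerate.1 _ fun y => ?_)
    have h1 := S.rec_A (S.J x) y
    have h2 := S.rec_B x y
    have h3 := S.rec_J x y
    rw [LinearMap.neg_apply, map_neg, LinearMap.neg_apply] at h3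
    rw [map_sub, LinearMap.sub_apply, map_neg, LinearMap.neg_apply, h2, h1, h3, sub_self]
  have hA2 : ∀ x, S.A (S.A x) = x := fun x => LinearMap.congr_fun S.A_sq x
  have hJ2 : ∀ x, S.J (S.J x) = - x := fun x => LinearMap.congr_fun S.J_sq x
  have hB2 := LinearMap.congr_fun S.B_sq (S.J x)
  rw [Module.End.mul_apply, hB, hB, hJ2, Module.End.one_apply] at hB2
  simp only [map_neg, neg_neg] at hB2
  rw [← hB2, map_neg, hA2]

theorem BornStructure.exists_isDouble (hS : S.IsIntegrable) :
    ∃ (η : LinearMap.BilinForm ℝ (BornStructure.minus hS))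
      (φ ρ : BornStructure.minus hS →ₗ[ℝ] BornStructure.minus hS →ₗ[ℝ] BornStructure.minus hS)
      (Φ : (BornStructure.minus hS × BornStructure.minus hS) ≃ₗ[ℝ] L),
      IsHessianPair η φ ρ ∧ IsDouble Φ φ ρ ∧ ∀ u v, (⁅u, v⁆ : BornStructure.minus hS) = φ u v - φ v u := by
  set V := BornStructure.minus hS
  have hA2 : ∀ x, S.A (S.A x) = x := fun x => LinearMap.congr_fun S.A_sq x
  have hJ2 : ∀ x, S.J (S.J x) = - x := fun x => LinearMap.congr_fun S.J_sq x
  have hAJ := S.A_J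
  have mem : ∀ x : L, x ∈ V ↔ S.A x = - x := fun x => by
    rw [show x ∈ V ↔ x ∈ S.A.eigenspace (-1) from Iff.rfl, Module.End.mem_eigenspace_iff,
      neg_smul, one_smul]
  have memp : ∀ x : L, x ∈ S.A.eigenspace 1 ↔ S.A x = x := fun x => by
    rw [Module.End.mem_eigenspace_iff, one_smul]
  have hAV : ∀ u : V, S.A u = - (u : L) := fun u => (mem u).1 u.2
  have hAJV : ∀ u : V, S.A (S.J u) = S.J u := fun u => by rw [hAJ, hAV, map_neg, neg_neg]
  let ι : V →ₗ[ℝ] L := V.toSubmodule.subtype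
  have hι : ∀ u, ι u = u := fun _ => rfl
  -- As `J² = -1`, the map `-J` on `V` inverts `J : 𝔤₊ → 𝔤₋`, so the first copy of `V` is identified
  -- with `𝔤₊`, and `J` becomes `(a, b) ↦ (-b, a)`.
  let Φ₀ : (V × V) →ₗ[ℝ] L := (-(S.J ∘ₗ ι)).coprod ι
  have hΦ₀ : ∀ a, Φ₀ a = - S.J a.1 + a.2 := fun a => rfl
  have hinj : ∀ a, Φ₀ a = 0 → a = 0 := by
    intro a ha
    rw [hΦ₀] at ha
    have h1 := congrArg S.A ha
    rw [map_add, map_neg, hAJV, hAV, map_zero] at h1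
    have h2 : (a.2 : L) = 0 := by
      have : (2 : ℝ) • (a.2 : L) = 0 := by linear_combination (norm := module) ha - h1
      exact (smul_eq_zero.1 this).resolve_left two_ne_zero
    rw [h2, add_zero, neg_eq_zero] at ha
    have h3 := hJ2 a.1
    rw [ha, map_zero, eq_comm, neg_eq_zero] at h3
    exact Prod.ext (Subtype.ext h3) (Subtype.ext h2)
  have hsurj : Function.Surjective Φ₀ := by
    intro x
    refine ⟨(⟨S.J ((1 / 2 : ℝ) • (x + S.A x)), ?_⟩, ⟨(1 / 2 : ℝ) • (x - S.A x), ?_⟩), ?_⟩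
    · rw [mem, hAJ, map_smul, map_add, hA2, add_comm (S.A x)]
    · rw [mem, map_smul, map_sub, hA2]; module
    · rw [hΦ₀]
      change - S.J (S.J _) + _ = _
      rw [hJ2]; module
  let Φ : (V × V) ≃ₗ[ℝ] L := LinearEquiv.ofBijective Φ₀
    ⟨by rw [← LinearMap.ker_eq_bot, LinearMap.ker_eq_bot']; exact hinj, hsurj⟩
  have hΦ : ∀ a, Φ a = - S.J a.1 + a.2 := fun a => rfl
  have hΦ1 : ∀ u : V, Φ (u, 0) = - S.J u := fun u => by rw [hΦ]; simp
  have hΦ2 : ∀ u : V, Φ (0, u) = u := fun u => by rw [hΦ]; simp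
  have hJΦ : ∀ a b : V, S.J (Φ (a, b)) = Φ (-b, a) := fun a b => by
    rw [hΦ, hΦ]; simp [hJ2, add_comm]
  let M : V →ₗ[ℝ] V →ₗ[ℝ] (V × V) := LinearMap.mk₂ ℝ
    (fun u v => Φ.symm ⁅Φ (0, u), Φ (v, 0)⁆)
    (fun u u' v => by rw [hΦ2, hΦ2, hΦ2, ← map_add, ← add_lie]; rfl)
    (fun c u v => by rw [hΦ2, hΦ2, ← map_smul, ← smul_lie]; rfl)
    (fun u v v' => by
      rw [← map_add, ← lie_add, ← map_add]; simp)
    (fun c u v => by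
      rw [← map_smul, ← lie_smul, ← map_smul]; simp)
  let φ : V →ₗ[ℝ] V →ₗ[ℝ] V := M.compr₂ (LinearMap.fst ℝ V V)
  let ρ : V →ₗ[ℝ] V →ₗ[ℝ] V := -(M.compr₂ (LinearMap.snd ℝ V V)).flip
  have hmix : ∀ u v, ⁅Φ (0, u), Φ (v, 0)⁆ = Φ (φ u v, - ρ v u) := fun u v => by
    have h1 : (φ u v, - ρ v u) = Φ.symm ⁅Φ (0, u), Φ (v, 0)⁆ := by
      simp [φ, ρ, M]
    rw [h1, Φ.apply_symm_apply]
  have hmix' : ∀ u v, ⁅Φ (u, 0), Φ (0, v)⁆ = Φ (- φ v u, ρ u v) := fun u v => by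
    rw [← lie_skew, hmix, ← map_neg]; simp
  have hbr : ∀ u v : V, ⁅Φ (0, u), Φ (0, v)⁆ = Φ (0, ⁅u, v⁆) := fun u v => by
    rw [hΦ2, hΦ2, hΦ2]; rfl
  obtain ⟨c, hc⟩ : ∃ c : V → V → V, ∀ u v, ⁅Φ (u, 0), Φ (v, 0)⁆ = Φ (c u v, 0) := by
    have : ∀ u v : V, ∃ w, ⁅Φ (u, 0), Φ (v, 0)⁆ = Φ (w, 0) := fun u v => by
      have h1 : S.A ⁅Φ (u, 0), Φ (v, 0)⁆ = ⁅Φ (u, 0), Φ (v, 0)⁆ := by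
        rw [← memp]
        refine hS.plus_subalgebra _ ?_ _ ?_ <;> rw [memp, hΦ1, map_neg, hAJV]
      refine ⟨⟨S.J ⁅Φ (u, 0), Φ (v, 0)⁆, by rw [mem, hAJ, h1]⟩, ?_⟩
      refine ((hΦ1 _).trans ?_).symm
      change - S.J (S.J _) = _
      rw [hJ2, neg_neg]
    choose c hc using this
    exact ⟨c, hc⟩
  -- The Nijenhuis tensor on two vectors of `𝔤₋` already contains both torsion identities, one in
  -- each component.
  have hnij : ∀ u v, ⁅u, v⁆ = φ u v - φ v u ∧ c u v = ρ u v - ρ v u := by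
    intro u v
    have h := hS.nijenhuis (Φ (0, u)) (Φ (0, v))
    have hneg : ∀ u, Φ (-u, 0) = - Φ (u, 0) := fun u => by rw [← map_neg]; simp
    have hsum : -⁅Φ (u, 0), Φ (0, v)⁆ + -⁅Φ (0, u), Φ (v, 0)⁆ =
        Φ (φ v u - φ u v, ρ v u - ρ u v) := by
      rw [hmix', hmix, ← map_neg Φ, ← map_neg Φ, ← map_add Φ, Prod.neg_mk, Prod.neg_mk,
        Prod.mk_add_mk]
      congr 2 <;> abel
    rw [hJΦ, hJΦ, hneg, hneg, neg_lie, lie_neg, neg_neg, neg_lie, lie_neg, hc, hbr, hsum, hJΦ,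
      ← map_sub, ← map_sub, LinearEquiv.map_eq_zero_iff, Prod.ext_iff] at h
    simp only [Prod.fst_sub, Prod.snd_sub, Prod.fst_zero, Prod.snd_zero] at h
    obtain ⟨h1, h2⟩ := h
    constructor
    · linear_combination (norm := abel) -h2
    · linear_combination (norm := abel) h1
  have hdouble : IsDouble Φ φ ρ := by
    refine ⟨fun u v => by rw [hbr, (hnij u v).1], fun u v => by rw [hc, (hnij u v).2], hmix⟩
  let η : LinearMap.BilinForm ℝ V := S.h.compl₁₂ ι ι
  have hη : ∀ u v : V, η u v = S.h u v := fun _ _ => rfl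
  have hω : ∀ x y, S.ω x y = S.h (S.J x) y := fun x y => by
    rw [← S.rec_J, LinearMap.neg_apply, hJ2, neg_neg]
  have hωA : ∀ x y, S.ω (S.A x) y = - S.ω x (S.A y) := fun x y => by
    rw [← S.rec_A, hA2, S.g_metric.symm, ← hA2 y, S.rec_A, hA2, S.ω_alt.neg_eq]
  -- `A` is skew for `ω` (`hωA`), so its eigenspace `𝔤₋` is isotropic. Hence only mixed terms
  -- survive in `hωΦ`.
  have hωV : ∀ u v : V, S.ω u v = 0 := fun u v => by
    have := hωA u v
    rw [hAV, hAV, map_neg, map_neg, LinearMap.neg_apply] at this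
    linarith
  have hωJ : ∀ x y, S.ω (S.J x) (S.J y) = S.ω x y := fun x y => by
    rw [hω, hJ2, map_neg, LinearMap.neg_apply, S.h_metric.symm, ← hω, S.ω_alt.neg_eq]
  have hωΦ : ∀ a b : V × V, S.ω (Φ a) (Φ b) = η a.1 b.2 - η b.1 a.2 := fun a b => by
    have e1 : S.ω (S.J a.1) b.2 = - S.h a.1 b.2 := by
      rw [hω, hJ2, map_neg, LinearMap.neg_apply]
    have e2 : S.ω a.2 (S.J b.1) = S.h b.1 a.2 := by
      rw [← S.ω_alt.neg_eq, hω, hJ2, map_neg, LinearMap.neg_apply, neg_neg]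
    rw [hΦ, hΦ, hη, hη]
    simp only [map_add, map_neg, LinearMap.add_apply, LinearMap.neg_apply, hωJ, hωV, e1, e2]
    ring
  have hsymm : ∀ u v, η u v = η v u := fun u v => S.h_metric.symm _ _
  have hmetric : IsPseudoMetric η := by
    refine ⟨hsymm, ?_⟩
    have hnd : ∀ u, (∀ v, η u v = 0) → u = 0 := fun u hu => by
      have : Φ (u, 0) = 0 := S.ω_nondegenerate.1 _ fun y => by
        obtain ⟨b, rfl⟩ := Φ.surjective y
        rw [hωΦ, hu, map_zero, sub_zero]
      exact congrArg Prod.fst ((LinearEquiv.map_eq_zero_iff Φ).1 this)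
    exact ⟨hnd, fun u hu => hnd u fun v => by rw [hsymm, hu]⟩
  refine ⟨η, φ, ρ, Φ, ⟨hmetric, hdouble.jacobi.1, fun u v w => ?_, hdouble.swap.jacobi.1,
    fun u v w => ?_, hdouble.swap.jacobi.2, hdouble.jacobi.2⟩, hdouble, fun u v => (hnij u v).1⟩
  -- Closedness on two vectors of one summand and one of the other is the Hessian identity.
  · have h := hS.closed (Φ (0, u)) (Φ (0, v)) (Φ (w, 0))
    rw [hdouble.lie_snd, hmix, hmix', hωΦ, hωΦ, hωΦ] at h
    simp only [map_zero, LinearMap.zero_apply, map_neg, LinearMap.neg_apply] at h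
    rw [hsymm, hsymm u, hsymm v]
    linarith
  · have h := hS.closed (Φ (u, 0)) (Φ (v, 0)) (Φ (0, w))
    rw [hdouble.lie_fst, hmix, hmix', hωΦ, hωΦ, hωΦ] at h
    simp only [map_zero, map_neg] at h
    linarith

end Born

/-! ### The nilpotent classification. -/

section Classification

theorem doubleFamily_zero_equiv (x y x₀ y₀ : ℝ) :
    let s := doubleFamily 0 x y x₀ y₀
    (y = 0 → x = -1 → Nonempty (s.Alg ≃ₗ⁅ℝ⁆ h4.Alg)) ∧
    (y = 0 → x = 0 → Nonempty (s.Alg ≃ₗ⁅ℝ⁆ h10.Alg)) ∧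
    (y = 0 → x = 1 → Nonempty (s.Alg ≃ₗ⁅ℝ⁆ h7.Alg)) ∧
    (y = 0 → x ≠ -1 → x ≠ 0 → x ≠ 1 → Nonempty (s.Alg ≃ₗ⁅ℝ⁆ h11.Alg)) ∧
    (y ≠ 0 → Nonempty (s.Alg ≃ₗ⁅ℝ⁆ h13.Alg)) := by
  refine ⟨?_, ?_, ?_, ?_, fun hy => doubleFamily_equiv_h13 x y x₀ y₀ hy⟩
  · rintro rfl rfl; exact doubleFamily_equiv_h4 x₀ y₀
  · rintro rfl rfl; exact doubleFamily_equiv_h10 x₀ y₀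
  · rintro rfl rfl; exact doubleFamily_equiv_h7 x₀ y₀
  · rintro rfl h0 h1 h2; exact doubleFamily_equiv_h11 x x₀ y₀ h0 h1 h2

theorem finrank_heis3 : Module.finrank ℝ heis3.Alg = 3 :=
  (Module.finrank_fin_fun ℝ : Module.finrank ℝ (Fin 3 → ℝ) = 3)

/-- The standard basis of the Heisenberg algebra, transported along an isomorphism. -/
theorem exists_isHeisenbergBasis_of_equiv {L : Type*} [LieRing L] [LieAlgebra ℝ L]
    (f : L ≃ₗ⁅ℝ⁆ heis3.Alg) {c : L →ₗ[ℝ] L →ₗ[ℝ] L} (hc : ∀ u v, c u v = ⁅u, v⁆) :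
    ∃ b : Module.Basis (Fin 3) ℝ L, IsHeisenbergBasis c b := by
  let std : Module.Basis (Fin 3) ℝ heis3.Alg :=
    (show Module.Basis (Fin 3) ℝ (Fin 3 → ℝ) from Pi.basisFun ℝ (Fin 3))
  have hstd : ∀ i, std i = (Pi.single i 1 : Fin 3 → ℝ) := fun i => Pi.basisFun_apply ℝ (Fin 3) i
  refine ⟨std.map f.symm.toLinearEquiv, fun u => by rw [hc, lie_self], ?_, fun u => ?_⟩
  · rw [hc]
    apply f.injective
    rw [LieHom.map_lie]
    change ⁅f (f.symm (std 0)), f (f.symm (std 1))⁆ = f (f.symm (std 2))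
    rw [f.apply_symm_apply, f.apply_symm_apply, f.apply_symm_apply]
    funext k
    rw [StructureEquations.lie_apply, hstd, hstd, hstd]
    fin_cases k <;> simp [heis3]
  · rw [hc]
    apply f.injective
    rw [LieHom.map_lie, map_zero]
    change ⁅f u, f (f.symm (std 2))⁆ = 0
    rw [f.apply_symm_apply, hstd]
    have key : ∀ (w : Fin 3 → ℝ) (k : Fin 3), - heis3.d k w (Pi.single 2 1) = 0 := by
      intro w k
      fin_cases k <;> simp [heis3]
    exact funext fun k => key (f u) k

theorem BornStructure.classification {L : Type*} [LieRing L] [LieAlgebra ℝ L]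
    [LieRing.IsNilpotent L] (S : BornStructure L) (hS : S.IsIntegrable)
    (f : BornStructure.minus hS ≃ₗ⁅ℝ⁆ heis3.Alg) :
    Nonempty (L ≃ₗ⁅ℝ⁆ h4.Alg) ∨ Nonempty (L ≃ₗ⁅ℝ⁆ h7.Alg) ∨ Nonempty (L ≃ₗ⁅ℝ⁆ h10.Alg) ∨
      Nonempty (L ≃ₗ⁅ℝ⁆ h11.Alg) ∨ Nonempty (L ≃ₗ⁅ℝ⁆ h13.Alg) := by
  obtain ⟨η, φ, ρ, Φ, hpair, hd, hbr⟩ := BornStructure.exists_isDouble hS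
  have hV : Module.finrank ℝ (BornStructure.minus hS) = 3 := by
    rw [← finrank_heis3]; exact f.toLinearEquiv.finrank_eq
  obtain ⟨b₀, hb₀⟩ := exists_isHeisenbergBasis_of_equiv f (c := φ - φ.flip)
    fun u v => (hbr u v).symm
  have hφ : φ - φ.flip ≠ 0 := fun h => b₀.ne_zero 2 (by
    rw [← hb₀.bracket, h, LinearMap.zero_apply, LinearMap.zero_apply])
  obtain ⟨b, x, x₀, t, y, y₀, h1, h2⟩ := hpair.exists_isTriangular hV
    (fun u => (hd.nilpotent u).1) (fun u => (hd.swap.nilpotent u).1)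
    (fun u => (hd.nilpotent u).2) (fun u => (hd.swap.nilpotent u).2) hφ
  obtain ⟨e₁⟩ := hd.equiv_doubleFamily h1 h2
  obtain ⟨x', y', x₀', y₀', ⟨e₂⟩⟩ := doubleFamily_equiv_zero t x y x₀ y₀
  obtain ⟨k4, k10, k7, k11, k13⟩ := doubleFamily_zero_equiv x' y' x₀' y₀'
  have tr : ∀ {s : StructureEquations 6},
      Nonempty ((doubleFamily 0 x' y' x₀' y₀').Alg ≃ₗ⁅ℝ⁆ s.Alg) → Nonempty (L ≃ₗ⁅ℝ⁆ s.Alg) :=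
    fun ⟨e₃⟩ => ⟨(e₁.trans e₂).trans e₃⟩
  by_cases hy : y' = 0
  · by_cases hx : x' = -1
    · exact Or.inl (tr (k4 hy hx))
    by_cases hx0 : x' = 0
    · exact Or.inr (Or.inr (Or.inl (tr (k10 hy hx0))))
    by_cases hx1 : x' = 1
    · exact Or.inr (Or.inl (tr (k7 hy hx1)))
    exact Or.inr (Or.inr (Or.inr (Or.inl (tr (k11 hy hx hx0 hx1)))))
  · exact Or.inr (Or.inr (Or.inr (Or.inr (tr (k13 hy)))))

end Classification

/-! ## Flat Lorentzian metrics on the Heisenberg algebra -/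

section FlatHeisenberg

variable {L : Type*} [LieRing L] [LieAlgebra ℝ L]

/-- The Lie bracket as a bilinear map. -/
def lieBilin (L : Type*) [LieRing L] [LieAlgebra ℝ L] : L →ₗ[ℝ] L →ₗ[ℝ] L :=
  (LieAlgebra.ad ℝ L : L →ₗ[ℝ] Module.End ℝ L)

@[simp] theorem lieBilin_apply (u v : L) : lieBilin L u v = ⁅u, v⁆ := rfl

variable {hm : LinearMap.BilinForm ℝ L} {b : Module.Basis (Fin 3) ℝ L}

theorem IsAdaptedBasis.isHeisenbergBasis (h : IsAdaptedBasis hm b) :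
    IsHeisenbergBasis (lieBilin L) b where
  alt u := lie_self u
  bracket := h.lie_01
  central u := by
    rw [b.eq_sum_three u]
    simp [h.lie_02, h.lie_12]

theorem IsAdaptedBasis.lie_eq (h : IsAdaptedBasis hm b) (u v : L) :
    ⁅u, v⁆ = (b.repr u 0 * b.repr v 1 - b.repr u 1 * b.repr v 0) • b 2 :=
  h.isHeisenbergBasis.apply u v

theorem IsAdaptedBasis.form_eq (h : IsAdaptedBasis hm b) (u v : L) :
    hm u v = b.repr u 0 * b.repr v 0 - b.repr u 1 * b.repr v 1 + b.repr u 1 * b.repr v 2 +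
      b.repr u 2 * b.repr v 1 := by
  conv_lhs => rw [b.eq_sum_three u, b.eq_sum_three v]
  simp [h.gram]
  ring

theorem IsAdaptedBasis.isPseudoMetric (h : IsAdaptedBasis hm b) : IsPseudoMetric hm := by
  have hs : ∀ x y, hm x y = hm y x := fun x y => by rw [h.form_eq, h.form_eq]; ring
  have hnd : ∀ u, (∀ v, hm u v = 0) → u = 0 := fun u hu => by
    have e0 := hu (b 0)
    have e1 := hu (b 1)
    have e2 := hu (b 2)
    rw [h.form_eq] at e0 e1 e2
    simp at e0 e1 e2
    rw [b.eq_sum_three u, e0, e2, show b.repr u 2 = 0 by linarith]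
    simp
  exact ⟨hs, hnd, fun u hu => hnd u fun v => by rw [hs, hu]⟩

theorem IsAdaptedBasis.isLorentzian (h : IsAdaptedBasis hm b) : IsLorentzian hm := by
  refine ⟨h.isPseudoMetric, 2, ?_⟩
  have hV : Module.finrank ℝ L = 3 := by rw [Module.finrank_eq_card_basis b, Fintype.card_fin]
  -- An orthonormal basis, with the timelike vector first as index `0` requires.
  have hli : LinearIndependent ℝ ![b 1, b 0, b 1 + b 2] := by
    rw [Fintype.linearIndependent_iff]
    intro g hg
    have e0 := congrArg (fun w => b.repr w 0) hg
    have e1 := congrArg (fun w => b.repr w 1) hg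
    have e2 := congrArg (fun w => b.repr w 2) hg
    simp [Fin.sum_univ_three] at e0 e1 e2
    intro i
    fin_cases i
    · change g 0 = 0; linarith
    · exact e0
    · exact e2
  have : FiniteDimensional ℝ L := Module.finite_of_finrank_eq_succ hV
  refine ⟨basisOfLinearIndependentOfCardEqFinrank hli (by simp [hV]), fun i j => ?_⟩
  fin_cases i <;> fin_cases j <;> simp [h.gram]

theorem IsAdaptedBasis.isFlat (h : IsAdaptedBasis hm b) : IsFlat hm := by
  -- Every covariant derivative is a multiple of the single skew operator `N`, so they commute; and
  -- `D` vanishes on brackets, which have no `b 1` component.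
  let N : Module.End ℝ L := (b.coord 1).smulRight (b 0) - (b.coord 0).smulRight (b 2)
  have hN : ∀ w, N w = b.repr w 1 • b 0 - b.repr w 0 • b 2 := fun w => rfl
  let D : L →ₗ[ℝ] Module.End ℝ L := (b.coord 1).smulRight N
  have hD : ∀ u w, D u w = b.repr u 1 • N w := fun u w => rfl
  refine ⟨D, ⟨fun x y => ?_, fun x y z => ?_⟩, fun x y z => ?_⟩
  · rw [hD, hD, hN, hN, h.lie_eq]; module
  · rw [hD, hD, hN, hN, h.form_eq, h.form_eq]
    simp
    ring
  · rw [hD, hD, hD, hD, hD, h.lie_eq, map_smul, map_smul, smul_smul, smul_smul]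
    simp
    module

/-- Put `z = b 2` and `N = D z`. Centrality gives `D u z = N u`, hence `N z = 0`, and the curvature
in the directions `u, z` applied to `z` gives `N² = 0`. As `N` is skew, its image is totally
isotropic and orthogonal to `z`. The Koszul-type relation `2 η(b₁, N b₀) = -η(z, z)` shows that a
non-null centre would make `N b₀` nonzero, whereas the orthogonality relations then make all its
coordinates vanish. -/
theorem IsFlat.center_null {hm : LinearMap.BilinForm ℝ L} (hη : IsPseudoMetric hm)
    (hflat : IsFlat hm) (hb : IsHeisenbergBasis (lieBilin L) b) : hm (b 2) (b 2) = 0 := by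
  obtain ⟨D, ⟨tor, met⟩, flat⟩ := hflat
  have hcz : ∀ u, D u (b 2) = D (b 2) u := fun u => by
    rw [← sub_eq_zero, tor]; exact hb.central u
  have hsk : ∀ u v w, hm (D u v) w = - hm v (D u w) := fun u v w => by linarith [met u v w]
  have hzz : D (b 2) (b 2) = 0 := hη.nondegenerate.1 _ fun w => by
    rw [hsk, ← hcz]
    have := met w (b 2) (b 2)
    rw [hη.symm (b 2)] at this ⊢
    linarith
  have hN2 : ∀ u, D (b 2) (D (b 2) u) = 0 := fun u => by
    have h := flat u (b 2) (b 2)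
    have h0 : ⁅u, b 2⁆ = 0 := hb.central u
    rw [hzz, map_zero, hcz, h0, map_zero, LinearMap.zero_apply, sub_zero, zero_sub,
      neg_eq_zero] at h
    exact h
  have hNN : ∀ u v, hm (D (b 2) u) (D (b 2) v) = 0 := fun u v => by
    rw [hsk, hN2, map_zero, neg_zero]
  have hzN : ∀ u, hm (b 2) (D (b 2) u) = 0 := fun u => by
    have := hsk (b 2) (b 2) u
    rw [hzz, map_zero, LinearMap.zero_apply] at this
    linarith
  have hself : ∀ u, hm u (D (b 2) u) = 0 := fun u => by
    have := met (b 2) u u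
    rw [hη.symm _ u] at this
    linarith
  have h01 : hm (b 0) (D (b 2) (b 1)) = - hm (b 1) (D (b 2) (b 0)) := by
    rw [hη.symm, hsk]
  have hk : 2 * hm (b 1) (D (b 2) (b 0)) = - hm (b 2) (b 2) := by
    have h1 := met (b 0) (b 1) (b 2)
    have h2 := met (b 1) (b 0) (b 2)
    rw [hcz] at h1 h2
    have h3 : D (b 0) (b 1) - D (b 1) (b 0) = b 2 := (tor _ _).trans hb.bracket
    have h4 := congrArg (fun w => hm w (b 2)) h3
    simp only [map_sub, LinearMap.sub_apply] at h4
    linarith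
  by_contra hc
  set k := hm (b 1) (D (b 2) (b 0)) with hk'
  have hk0 : k ≠ 0 := fun h => hc (by rw [h] at hk; linarith)
  have sum := b.eq_sum_three (D (b 2) (b 0))
  have e0 := hNN (b 0) (b 0)
  have e1 := hNN (b 0) (b 1)
  have ez := hzN (b 0)
  rw [hη.symm] at ez
  set w := D (b 2) (b 0)
  rw [sum] at ez
  have e0' : hm (b.repr w 0 • b 0 + b.repr w 1 • b 1 + b.repr w 2 • b 2) w = 0 := by rw [← sum, e0]
  have e1' : hm (b.repr w 0 • b 0 + b.repr w 1 • b 1 + b.repr w 2 • b 2) (D (b 2) (b 1)) = 0 := by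
    rw [← sum, e1]
  simp [hself, hzN, h01, ← hk', hk0, show hm (b 0) w = 0 from hself _,
    show hm (b 2) w = 0 from hzN _] at e0' e1'
  rw [e0', e1'] at ez sum
  simp [hc] at ez
  rw [ez] at sum
  apply hk0
  rw [hk', sum]
  simp

/-- In an orthonormal basis, nullity of `z` and orthogonality to `u` express `z₀²` and `u₀ z₀`
through the spatial parts; Cauchy–Schwarz gives `u₀² z₀² ≤ |u|² z₀²`, and `z₀ ≠ 0`. -/
theorem IsLorentzian.nonneg_of_orthogonal_null {V : Type*} [AddCommGroup V] [Module ℝ V]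
    {η : LinearMap.BilinForm ℝ V} (h : IsLorentzian η) {z u : V} (hz : z ≠ 0) (hzz : η z z = 0)
    (huz : η u z = 0) : 0 ≤ η u u := by
  obtain ⟨n, v, hv⟩ := h.signature
  have form : ∀ x y, η x y = - (v.repr x 0 * v.repr y 0) +
      ∑ i : Fin n, v.repr x i.succ * v.repr y i.succ := fun x y => by
    conv_lhs => rw [← v.sum_repr x, ← v.sum_repr y]
    simp only [map_sum, map_smul, LinearMap.sum_apply, LinearMap.smul_apply, hv, smul_eq_mul]
    simp only [Fin.sum_univ_succ]
    simp [Fin.succ_ne_zero, Fin.succ_inj, (Fin.succ_ne_zero _).symm]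
    simp only [mul_comm]
  rw [form] at hzz huz ⊢
  have cs := Finset.sum_mul_sq_le_sq_mul_sq Finset.univ (fun i : Fin n => v.repr u i.succ)
    (fun i => v.repr z i.succ)
  simp only [← pow_two] at hzz ⊢
  have hz0 : v.repr z 0 ≠ 0 := by
    intro h0
    rw [h0] at hzz
    have hs : ∑ i : Fin n, v.repr z i.succ ^ 2 = 0 := by linarith
    rw [Finset.sum_eq_zero_iff_of_nonneg fun i _ => sq_nonneg _] at hs
    apply hz
    refine v.ext_elem fun i => ?_
    rw [map_zero, Finsupp.zero_apply]
    refine Fin.cases h0 (fun i => ?_) i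
    exact pow_eq_zero_iff two_ne_zero |>.1 (hs i (Finset.mem_univ _))
  have e1 : ∑ i : Fin n, v.repr z i.succ ^ 2 = v.repr z 0 ^ 2 := by linarith
  have e2 : ∑ i : Fin n, v.repr u i.succ * v.repr z i.succ = v.repr u 0 * v.repr z 0 := by linarith
  rw [e1, e2, mul_pow] at cs
  have := le_of_mul_le_mul_right cs (by positivity)
  linarith

theorem exists_isAdaptedBasis (hL : IsLorentzian hm) (hF : IsFlat hm)
    (hb : IsHeisenbergBasis (lieBilin L) b) :
    ∃ e : Module.Basis (Fin 3) ℝ L, IsAdaptedBasis hm e := by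
  obtain ⟨b₁, p, -, hb₁, hg, -⟩ := hb.exists_isNullGram hL.toIsPseudoMetric
    (hF.center_null hL.toIsPseudoMetric hb)
  have hs := hL.symm
  have hp : 0 < p := by
    refine lt_of_le_of_ne ?_ hg.ne_zero.symm
    rw [← hg.g00]
    exact hL.nonneg_of_orthogonal_null (b₁.ne_zero 2) hg.g22 hg.g02
  -- For `e₀ = a b₀` and `e₁ = β b₁ + γ b₂` the bracket is `aβ b₂`. The Gram conditions are `a²p =
  -- 1` and `aβ²p = 1`, hence `β² = a`, while `γ` adjusts `η(e₁, e₁)` to `-1`.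
  obtain ⟨a, ha, hap⟩ : ∃ a : ℝ, 0 < a ∧ a ^ 2 * p = 1 :=
    ⟨√(p⁻¹), Real.sqrt_pos.2 (inv_pos.2 hp), by
      rw [Real.sq_sqrt (inv_pos.2 hp).le, inv_mul_cancel₀ hp.ne']⟩
  obtain ⟨β, hβ, hβa⟩ : ∃ β : ℝ, 0 < β ∧ β ^ 2 = a := ⟨√a, Real.sqrt_pos.2 ha, Real.sq_sqrt ha.le⟩
  obtain ⟨γ, hγ⟩ : ∃ γ : ℝ, β ^ 2 * hm (b₁ 1) (b₁ 1) + 2 * β * γ * p = -1 :=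
    ⟨(-1 - β ^ 2 * hm (b₁ 1) (b₁ 1)) / (2 * β * p), by field_simp; ring⟩
  have hc : lieBilin L (a • b₁ 0) (β • b₁ 1 + γ • b₁ 2) = (a * β) • b₁ 2 := by
    rw [hb₁.apply]
    simp
  obtain ⟨e, he, e0, e1, e2⟩ := hb₁.exists_basis (u := a • b₁ 0) (v := β • b₁ 1 + γ • b₁ 2) (by
    rw [hc]; exact smul_ne_zero (mul_ne_zero ha.ne' hβ.ne') (b₁.ne_zero 2))
  rw [hc] at e2
  have g10 : hm (b₁ 1) (b₁ 0) = 0 := by rw [hs, hg.g01]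
  have g20 : hm (b₁ 2) (b₁ 0) = 0 := by rw [hs, hg.g02]
  have g21 : hm (b₁ 2) (b₁ 1) = p := by rw [hs, hg.g12]
  refine ⟨e, he.bracket, he.central _, he.central _, fun i j => ?_⟩
  fin_cases i <;> fin_cases j <;>
    simp [e0, e1, e2, hg.g00, hg.g01, hg.g02, hg.g12, hg.g22, g10, g20, g21]
  · linear_combination hap
  · linear_combination hγ
  · linear_combination hap + a * p * hβa
  · linear_combination hap + a * p * hβa

theorem flatLorentzian_iff (f : L ≃ₗ⁅ℝ⁆ heis3.Alg) (hm : LinearMap.BilinForm ℝ L) :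
    (IsLorentzian hm ∧ IsFlat hm) ↔ ∃ e : Module.Basis (Fin 3) ℝ L, IsAdaptedBasis hm e := by
  constructor
  · rintro ⟨hL, hF⟩
    obtain ⟨b, hb⟩ := exists_isHeisenbergBasis_of_equiv f (c := lieBilin L) lieBilin_apply
    exact exists_isAdaptedBasis hL hF hb
  · rintro ⟨e, he⟩
    exact ⟨he.isLorentzian, he.isFlat⟩

end FlatHeisenberg

/-! ## Hessian pairs over the Heisenberg algebra with an adapted basis -/

section Cubic

/-- Coefficients of a flat Hessian product on the Heisenberg algebra with a flat metric. -/
theorem flat_hessian_coefficients (F : Fin 3 → Fin 3 → Fin 3 → ℝ) (B : Fin 3 → Fin 3 → Fin 3 → ℝ)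
    (hB : B = fun i j k => if k = 1 then (if i = 0 ∧ j = 1 then 1 else if i = 1 ∧ j = 0 then -1 else 0)
      else 0)
    (tor : ∀ i j k, F i j k - F j i k = B i j k)
    (hess : ∀ i j k, B i j k = F j k i - F i k j)
    (C : Fin 3 → Fin 3 → Fin 3 → Fin 3 → ℝ)
    (hC : C = fun i j k l => F j k 0 * F i 0 l + F j k 2 * F i 1 l + (F j k 1 + F j k 2) * F i 2 l)
    (flat01 : ∀ k l, F 2 k l = C 0 1 k l - C 1 0 k l)
    (flat02 : ∀ k l, 0 = C 0 2 k l - C 2 0 k l)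
    (flat12 : ∀ k l, 0 = C 1 2 k l - C 2 1 k l) :
    (∀ j k, F 2 j k = 0) ∧ F 0 0 0 = 0 ∧ F 0 0 1 = 0 ∧ F 0 0 2 = 0 ∧ F 0 1 0 = 0 ∧ F 0 1 2 = 0 ∧
      F 1 0 0 = 0 ∧ F 1 0 2 = 0 ∧ F 1 1 2 = 0 ∧ F 1 0 1 = F 0 1 1 - 1 ∧ F 1 1 0 = F 0 1 1 + 1 ∧
      (∀ i j, F i 2 j = 0) := by
  obtain ⟨a000, h000⟩ : ∃ s, s = F 0 0 0 := ⟨_, rfl⟩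
  obtain ⟨a001, h001⟩ : ∃ s, s = F 0 0 1 := ⟨_, rfl⟩
  obtain ⟨a002, h002⟩ : ∃ s, s = F 0 0 2 := ⟨_, rfl⟩
  obtain ⟨a011, h011⟩ : ∃ s, s = F 0 1 1 := ⟨_, rfl⟩
  obtain ⟨a012, h012⟩ : ∃ s, s = F 0 1 2 := ⟨_, rfl⟩
  obtain ⟨a022, h022⟩ : ∃ s, s = F 0 2 2 := ⟨_, rfl⟩
  obtain ⟨a111, h111⟩ : ∃ s, s = F 1 1 1 := ⟨_, rfl⟩
  obtain ⟨a112, h112⟩ : ∃ s, s = F 1 1 2 := ⟨_, rfl⟩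
  obtain ⟨a122, h122⟩ : ∃ s, s = F 1 2 2 := ⟨_, rfl⟩
  obtain ⟨a222, h222⟩ : ∃ s, s = F 2 2 2 := ⟨_, rfl⟩
  have T := fun i j k => (tor i j k).trans (congrFun (congrFun (congrFun hB i) j) k)
  have H := fun i j k => (hess i j k).symm.trans (congrFun (congrFun (congrFun hB i) j) k)
  have t010 := T 0 1 0
  have t011 := T 0 1 1
  have t012 := T 0 1 2
  have t020 := T 0 2 0
  have t021 := T 0 2 1
  have t022 := T 0 2 2
  have t120 := T 1 2 0
  have t121 := T 1 2 1
  have t122 := T 1 2 2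
  have e010 := H 0 1 0
  have e011 := H 0 1 1
  have e012 := H 0 1 2
  have e020 := H 0 2 0
  have e021 := H 0 2 1
  have e022 := H 0 2 2
  have e120 := H 1 2 0
  have e121 := H 1 2 1
  have e122 := H 1 2 2
  simp at t010 t011 t012 t020 t021 t022 t120 t121 t122 e010 e011 e012 e020 e021 e022 e120 e121 e122
  -- Up to the constants coming from the bracket, torsion and Hessian relations make `F` totally
  -- symmetric, leaving ten unknowns.
  have F010 : F 0 1 0 = a001 := by linarith
  have F020 : F 0 2 0 = a002 := by linarith
  have F021 : F 0 2 1 = a012 := by linarith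
  have F100 : F 1 0 0 = a001 := by linarith
  have F101 : F 1 0 1 = a011 - 1 := by linarith
  have F102 : F 1 0 2 = a012 := by linarith
  have F110 : F 1 1 0 = a011 + 1 := by linarith
  have F120 : F 1 2 0 = a012 := by linarith
  have F121 : F 1 2 1 = a112 := by linarith
  have F200 : F 2 0 0 = a002 := by linarith
  have F201 : F 2 0 1 = a012 := by linarith
  have F202 : F 2 0 2 = a022 := by linarith
  have F210 : F 2 1 0 = a012 := by linarith
  have F211 : F 2 1 1 = a112 := by linarith
  have F212 : F 2 1 2 = a122 := by linarith
  have F220 : F 2 2 0 = a022 := by linarith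
  have F221 : F 2 2 1 = a122 := by linarith
  subst hC
  simp only [Fin.forall_fin_succ, Fin.isValue, Fin.succ_zero_eq_one, Fin.succ_one_eq_two,
    IsEmpty.forall_iff, and_true, ← h000, ← h001, ← h002, ← h011, ← h012, ← h022, ← h111, ← h112,
    ← h122, ← h222, F010, F020, F021, F100, F101, F102, F110, F120, F121, F200, F201, F202, F210,
    F211, F212, F220, F221] at flat01 flat02 flat12 ⊢
  clear T H t010 t011 t012 t020 t021 t022 t120 t121 t122 e010 e011 e012 e020 e021 e022 e120 e121 e122 tor hess hB
  obtain ⟨⟨p00, p01, p02⟩, ⟨p10, p11, p12⟩, ⟨p20, p21, p22⟩⟩ := flat01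
  obtain ⟨⟨q00, q01, q02⟩, ⟨q10, q11, q12⟩, ⟨q20, q21, q22⟩⟩ := flat02
  obtain ⟨⟨r00, r01, r02⟩, ⟨r10, r11, r12⟩, ⟨r20, r21, r22⟩⟩ := flat12
  -- Flatness is quadratic, but in this order of elimination each unknown is obtained from a linear
  -- equation, except `a001`, whose square vanishes.
  have k222 : a222 = 0 := by linear_combination p22
  have k002 : a002 = 0 := by linear_combination (1 / 3) * p00
  have k022 : a022 = 0 := by linear_combination -(1 / 2) * r00
  clear h000 h001 h002 h011 h012 h022 h111 h112 h122 h222 F010 F020 F021 F100 F101 F102 F110 F120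
    F121 F200 F201 F202 F210 F211 F212 F220 F221
  subst k222 k002 k022
  have k122 : a122 = 0 := by linear_combination (1 / 2) * (p12 + p21)
  have k012 : a012 = 0 := by linear_combination (1 / 2) * r11
  subst k122 k012
  have k000 : a000 = 0 := by linear_combination -(1 / 2) * (p01 + p10)
  subst k000
  have k112 : a112 = 2 * a001 := by linear_combination p11
  have k001 : a001 = 0 := pow_eq_zero_iff two_ne_zero |>.1 (by
    linear_combination -p10 - a001 * k112)
  rw [k001, mul_zero] at k112
  simp [k001, k112]

variable {L : Type*} [LieRing L] [LieAlgebra ℝ L] {hm : LinearMap.BilinForm ℝ L}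
  {e : Module.Basis (Fin 3) ℝ L}

theorem IsTriangular.apply {V : Type*} [AddCommGroup V] [Module ℝ V] {φ : V →ₗ[ℝ] V →ₗ[ℝ] V}
    {b : Module.Basis (Fin 3) ℝ V} {t x x₀ : ℝ} (h : IsTriangular φ b t x x₀) (u v : V) :
    φ u v = ((x + t) * (b.repr u 1 * b.repr v 1)) • b 0 + (x * (b.repr u 0 * b.repr v 1) +
      (x - t) * (b.repr u 1 * b.repr v 0) + x₀ * (b.repr u 1 * b.repr v 1)) • b 2 := by
  conv_lhs => rw [b.eq_sum_three u, b.eq_sum_three v]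
  simp only [map_add, map_smul, LinearMap.add_apply, LinearMap.smul_apply, h.a00, h.a01, h.a10,
    h.a11, h.center_left, h.center_right, LinearMap.zero_apply]
  module

/-- The coefficients come from the inverse Gram matrix, whose lower block is `(0, 1; 1, 1)`. -/
theorem IsAdaptedBasis.eq_sum (he : IsAdaptedBasis hm e) (w : L) :
    w = hm w (e 0) • e 0 + hm w (e 2) • e 1 + (hm w (e 1) + hm w (e 2)) • e 2 := by
  conv_lhs => rw [e.eq_sum_three w]
  rw [he.form_eq w (e 0), he.form_eq w (e 1), he.form_eq w (e 2)]
  simp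

/-- The operators `φ u` are not assumed nilpotent here, so the Engel argument is replaced by solving
for the coefficients `η(φ(e_i) e_j, e_k)`. -/
theorem IsHessianPair.exists_left_isTriangular {φ ρ : L →ₗ[ℝ] L →ₗ[ℝ] L}
    (h : IsHessianPair hm φ ρ) (he : IsAdaptedBasis hm e) (hφ : ∀ u v, φ u v - φ v u = ⁅u, v⁆) :
    ∃ x x₀, IsTriangular φ e 1 x x₀ := by
  have hs := h.metric.symm
  have comp : ∀ i j k l, hm (φ (e i) (φ (e j) (e k))) (e l) =
      hm (φ (e j) (e k)) (e 0) * hm (φ (e i) (e 0)) (e l) +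
      hm (φ (e j) (e k)) (e 2) * hm (φ (e i) (e 1)) (e l) +
      (hm (φ (e j) (e k)) (e 1) + hm (φ (e j) (e k)) (e 2)) * hm (φ (e i) (e 2)) (e l) := by
    intro i j k l
    conv_lhs => rw [he.eq_sum (φ (e j) (e k))]
    simp
  have flat : ∀ i j k l, hm (φ ⁅e i, e j⁆ (e k)) (e l) =
      hm (φ (e i) (φ (e j) (e k))) (e l) - hm (φ (e j) (φ (e i) (e k))) (e l) := by
    intro i j k l
    rw [← hφ, h.flat_left, map_sub, LinearMap.sub_apply]
  obtain ⟨hz, h000, h001, h002, h010, h012, h100, h102, h112, h101, h110, hz'⟩ :=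
    flat_hessian_coefficients (fun i j k => hm (φ (e i) (e j)) (e k)) _ rfl
    (fun i j k => by
      rw [← LinearMap.sub_apply, ← map_sub, hφ, he.lie_eq, he.form_eq]
      fin_cases i <;> fin_cases j <;> fin_cases k <;> simp)
    (fun i j k => by
      rw [hs _ (e i), hs _ (e j), ← h.hess_left, hφ, he.lie_eq, he.form_eq]
      fin_cases i <;> fin_cases j <;> fin_cases k <;> simp) _ rfl
    (fun k l => by
      have := flat 0 1 k l
      rw [he.lie_01, comp, comp] at this
      exact this)
    (fun k l => by
      have := flat 0 2 k l
      rw [he.lie_02, map_zero, LinearMap.zero_apply, map_zero, LinearMap.zero_apply, comp, comp] at this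
      exact this)
    (fun k l => by
      have := flat 1 2 k l
      rw [he.lie_12, map_zero, LinearMap.zero_apply, map_zero, LinearMap.zero_apply, comp, comp] at this
      exact this)
  refine ⟨hm (φ (e 0) (e 1)) (e 1), hm (φ (e 1) (e 1)) (e 1), ?_, ?_, ?_, ?_, ?_, ?_⟩
  · rw [he.eq_sum (φ (e 0) (e 0)), h000, h001, h002]; simp
  · conv_lhs => rw [he.eq_sum (φ (e 0) (e 1)), h010, h012]
    simp
  · rw [he.eq_sum (φ (e 1) (e 0)), h100, h101, h102]; simp
  · conv_lhs => rw [he.eq_sum (φ (e 1) (e 1)), h110, h112]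
    simp
  · refine e.ext fun j => ?_
    rw [he.eq_sum (φ (e 2) (e j)), hz, hz, hz]; simp
  · intro u
    rw [e.eq_sum_three u]
    have : ∀ i, φ (e i) (e 2) = 0 := fun i => by
      rw [he.eq_sum (φ (e i) (e 2)), hz', hz', hz']; simp
    simp [this]

/-- Commutativity and the Hessian identity make `G i j k = η(ρ(e_i) e_j, e_k)` a symmetric cubic
form. Once `φ` is in normal form the matching conditions are linear in `G`; together with one
flatness equation they leave only `G 0 1 1` and `G 1 1 1`. -/
theorem IsHessianPair.isTriangular_of_isAdaptedBasis {φ ρ : L →ₗ[ℝ] L →ₗ[ℝ] L}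
    (h : IsHessianPair hm φ ρ) (he : IsAdaptedBasis hm e) (hφ : ∀ u v, φ u v - φ v u = ⁅u, v⁆)
    (hρ : ∀ u v, ρ u v = ρ v u) :
    ∃ x x₀ y y₀, IsTriangular φ e 1 x x₀ ∧ IsTriangular ρ e 0 y y₀ := by
  obtain ⟨x, x₀, hx⟩ := h.exists_left_isTriangular he hφ
  obtain ⟨G, hG⟩ : ∃ G : Fin 3 → Fin 3 → Fin 3 → ℝ, G = fun i j k => hm (ρ (e i) (e j)) (e k) :=
    ⟨_, rfl⟩
  have G01 : ∀ i j k, G i j k = G j i k := fun i j k => by simp only [hG]; rw [hρ]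
  have G02 : ∀ i j k, G i j k = G k j i := fun i j k => by
    have := h.hess_right (e k) (e i) (e j)
    rw [hρ (e k) (e i), sub_self, map_zero, LinearMap.zero_apply, eq_comm, sub_eq_zero,
      h.metric.symm, h.metric.symm (e i)] at this
    rw [hG]
    exact this
  have G12 : ∀ i j k, G i j k = G i k j := fun i j k => by rw [G02, G01, G02]
  have hr : ∀ i j, ρ (e i) (e j) = G i j 0 • e 0 + G i j 2 • e 1 + (G i j 1 + G i j 2) • e 2 :=
    fun i j => by rw [hG]; exact he.eq_sum _
  have left : ∀ u a b, φ (ρ a u) b - φ (ρ b u) a = 0 := fun u a b => by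
    have := h.left u a b
    rw [hρ a b, hρ (φ u a) b, hρ a (φ u b)] at this
    simpa using this
  have right : ∀ a u v, ρ a ⁅u, v⁆ - ⁅ρ a u, v⁆ - ⁅u, ρ a v⁆ + ρ (φ u a) v - ρ (φ v a) u = 0 :=
    fun a u v => by
      rw [← hφ, ← hφ, ← hφ]; exact h.right a u v
  have repr_r : ∀ i j, e.repr (ρ (e i) (e j)) 0 = G i j 0 ∧ e.repr (ρ (e i) (e j)) 1 = G i j 2 :=
    fun i j => by rw [hr]; simp
  have left₀ : ∀ i j k, (x + 1) * (G i j 2 * e.repr (e k) 1) = (x + 1) * (G k j 2 * e.repr (e i) 1) :=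
    fun i j k => by
      have := congrArg (fun w => e.repr w 0) (left (e j) (e i) (e k))
      rw [hx.apply, hx.apply] at this
      simp [repr_r] at this
      simp only [e.repr_self]
      linarith
  have left₂ : ∀ i j k, x * (G i j 0 * e.repr (e k) 1) + (x - 1) * (G i j 2 * e.repr (e k) 0) +
      x₀ * (G i j 2 * e.repr (e k) 1) = x * (G k j 0 * e.repr (e i) 1) +
      (x - 1) * (G k j 2 * e.repr (e i) 0) + x₀ * (G k j 2 * e.repr (e i) 1) :=
    fun i j k => by
      have := congrArg (fun w => e.repr w 2) (left (e j) (e i) (e k))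
      rw [hx.apply, hx.apply] at this
      simp [repr_r] at this
      simp only [e.repr_self]
      linarith
  -- The factors `x + 1` and `x - 1` cannot vanish together.
  have g22 : ∀ j, G 2 j 2 = 0 := fun j => by
    have h1 := left₀ 2 j 1
    have h2 := left₂ 2 j 0
    simp at h1 h2
    rcases h1 with h1 | h1
    · rcases h2 with h2 | h2
      · linarith
      · exact h2
    · exact h1
  have gx : ∀ j, x * G 2 j 0 = 0 := fun j => by
    have h1 := left₂ 2 j 1
    simp [g22] at h1 ⊢
    exact h1
  have r12 := right (e 1) (e 1) (e 2)
  have r12' : ρ ((x + 1) • e 0 + x₀ • e 2) (e 2) + G 1 2 0 • e 2 = 0 := by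
    rw [he.lie_12, hx.a11, hx.center_left, he.lie_eq, he.lie_eq, (repr_r 1 2).1] at r12
    simp at r12 ⊢
    linear_combination (norm := module) r12
  rw [map_add, map_smul, map_smul, LinearMap.add_apply, LinearMap.smul_apply,
    LinearMap.smul_apply, hr, hr] at r12'
  have r120 := congrArg (fun w => e.repr w 0) r12'
  have r122 := congrArg (fun w => e.repr w 2) r12'
  simp at r120 r122
  have g220 : G 2 2 0 = 0 := by rw [G12, g22]
  have g022 : G 0 2 2 = 0 := by rw [G01, g22]
  -- Matching gives both `(x + 1) G 2 0 0 = 0` and `x G 2 0 0 = 0`; their difference is the claim.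
  have g200 : G 2 0 0 = 0 := by
    rw [G01 0 2 0, g220] at r120
    linarith [gx 0]
  have g210 : G 2 1 0 = 0 := by
    rw [g022, g22, G01 0 2 1, G12 2 0 1, G01 1 2 0, G12 2 2 1, g22] at r122
    linarith [gx 1]
  have g012 : G 0 1 2 = 0 := by rw [G02, g210]
  have g002 : G 0 0 2 = 0 := by rw [G02, g200]
  have g120 : G 1 2 0 = 0 := by rw [G01, g210]
  have g020 : G 0 2 0 = 0 := by rw [G01, g200]
  have g021 : G 0 2 1 = 0 := by rw [G12, g012]
  have e22 : ρ (e 2) (e 2) = 0 := by rw [hr, g220, g22, G12 2 2 1, g22]; simp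
  have e20 : ρ (e 2) (e 0) = 0 := by rw [hr, g200, g22, G12, g210]; simp
  have g000 : G 0 0 0 = 0 := by
    have h1 := right (e 0) (e 0) (e 1)
    rw [he.lie_01, hx.a00, hx.a10, he.lie_eq, he.lie_eq, hρ (e 0) (e 2), e20] at h1
    simp [repr_r, g012, e20] at h1
    exact h1.resolve_right (e.ne_zero 2)
  have s1 : G 1 1 2 = 2 * G 0 0 1 ∧ x * G 1 1 2 = (x + 2) * G 0 0 1 := by
    have h1 := left₂ 1 1 0
    have h2 := congrArg (fun w => e.repr w 2) (right (e 1) (e 0) (e 1))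
    rw [he.lie_01, hx.a01, hx.a11, he.lie_eq, he.lie_eq] at h2
    simp [repr_r, e20] at h1 h2
    simp [hr, g000, g002, G01 1 0, g012, G12 1 2 1, G12 0 1 0] at h1 h2
    have k1 : G 1 2 2 = 0 := by rw [G01, g22]
    have k2 : G 2 1 1 = G 1 1 2 := by rw [G02]
    rw [k1, k2, g22] at h2
    constructor <;> linarith
  -- The linear relation `G 1 1 2 = 2 G 0 0 1` turns this flatness equation into `(G 0 0 1)² = 0`.
  have g001 : G 0 0 1 = 0 := by
    have h1 := h.flat_right (e 0) (e 1) (e 1)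
    rw [hρ (e 1) (e 0), sub_self, map_zero, LinearMap.zero_apply, hr 1 1, hr 0 1] at h1
    have h2 := congrArg (fun w => e.repr w 0) h1
    simp [repr_r, g000, g020, g120, g012, G12 0 1 0, G01 1 0] at h2
    exact pow_eq_zero_iff two_ne_zero |>.1 (by linear_combination -h2 - G 0 0 1 * s1.1)
  have g112 : G 1 1 2 = 0 := by rw [s1.1, g001, mul_zero]
  have e21 : ρ (e 2) (e 1) = 0 := by
    rw [hr, g210, g22, G02 2 1 1, g112]; simp
  have g010 : G 0 1 0 = 0 := by rw [G12, g001]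
  refine ⟨x, x₀, G 0 1 1, G 1 1 1, hx, ?_, ?_, ?_, ?_, ?_, ?_⟩
  · rw [hr, g000, g001, g002]; simp
  · rw [hr, g010, g012]; simp
  · rw [hρ, hr, g010, g012]; simp
  · rw [hr, g112, G02 1 1 0]; simp
  · refine e.ext fun j => ?_
    fin_cases j <;> simp [e20, e21, e22]
  · intro u
    rw [hρ, e.eq_sum_three u]
    simp [e20, e21, e22]

end Cubic

/-! ## Integrability of the Born structure of a bicross product -/

section BicrossBorn

theorem real_self_eq_neg {V : Type*} [AddCommGroup V] [Module ℝ V] {v : V} : v = -v ↔ v = 0 := by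
  refine ⟨fun h => ?_, fun h => by rw [h, neg_zero]⟩
  have : (2 : ℝ) • v = 0 := by rw [two_smul]; nth_rewrite 2 [h]; exact add_neg_cancel v
  exact (smul_eq_zero.1 this).resolve_left two_ne_zero

theorem real_neg_eq_self {V : Type*} [AddCommGroup V] [Module ℝ V] {v : V} : -v = v ↔ v = 0 := by
  rw [eq_comm, real_self_eq_neg]

variable {Lp Lm : Type*} [LieRing Lp] [LieAlgebra ℝ Lp] [LieRing Lm] [LieAlgebra ℝ Lm]
  {φ : Lm →ₗ⁅ℝ⁆ Module.End ℝ Lp} {ρ : Lp →ₗ⁅ℝ⁆ Module.End ℝ Lm}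
  {hm : LinearMap.BilinForm ℝ Lm}

/-- The representation `φ`, transported to a product on `𝔤₋` through `Q`. -/
def leftProduct (φ : Lm →ₗ⁅ℝ⁆ Module.End ℝ Lp) (Q : Lp ≃ₗ[ℝ] Lm) : Lm →ₗ[ℝ] Lm →ₗ[ℝ] Lm :=
  LinearMap.mk₂ ℝ (fun u v => Q (φ u (Q.symm v)))
    (fun u u' v => by simp) (fun c u v => by simp) (fun u v v' => by simp) (fun c u v => by simp)

/-- The representation `ρ`, transported to a product on `𝔤₋` through `Q`. -/
def rightProduct (ρ : Lp →ₗ⁅ℝ⁆ Module.End ℝ Lm) (Q : Lp ≃ₗ[ℝ] Lm) : Lm →ₗ[ℝ] Lm →ₗ[ℝ] Lm :=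
  LinearMap.mk₂ ℝ (fun u v => ρ (Q.symm u) v)
    (fun u u' v => by simp) (fun c u v => by simp) (fun u v v' => by simp) (fun c u v => by simp)

theorem leftProduct_apply (φ : Lm →ₗ⁅ℝ⁆ Module.End ℝ Lp) (Q : Lp ≃ₗ[ℝ] Lm) (u v : Lm) :
    leftProduct φ Q u v = Q (φ u (Q.symm v)) := rfl

theorem rightProduct_apply (ρ : Lp →ₗ⁅ℝ⁆ Module.End ℝ Lm) (Q : Lp ≃ₗ[ℝ] Lm) (u v : Lm) :
    rightProduct ρ Q u v = ρ (Q.symm u) v := rfl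

/-- The identification `𝔤₋ ⊕ 𝔤₋ = 𝔤₊ ⊕ 𝔤₋` given by `Q`. -/
def bicrossSplitting (hM : IsMatchedPair φ ρ) (Q : Lp ≃ₗ[ℝ] Lm) : (Lm × Lm) ≃ₗ[ℝ] Bicross hM :=
  (Q.symm.prodCongr (LinearEquiv.refl ℝ Lm) : (Lm × Lm) ≃ₗ[ℝ] (Lp × Lm))

theorem bicross_isDouble (hM : IsMatchedPair φ ρ) (Q : Lp ≃ₗ[ℝ] Lm)
    (h₁ : ∀ u v, leftProduct φ Q u v - leftProduct φ Q v u = ⁅u, v⁆)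
    (h₂ : ∀ u v, rightProduct ρ Q u v - rightProduct ρ Q v u = Q ⁅Q.symm u, Q.symm v⁆) :
    IsDouble (bicrossSplitting hM Q) (leftProduct φ Q) (rightProduct ρ Q) where
  lie_snd u v := by
    rw [h₁]
    change bicrossBracket φ ρ (Q.symm 0, u) (Q.symm 0, v) = (Q.symm 0, ⁅u, v⁆)
    simp [bicrossBracket]
  lie_fst u v := by
    rw [h₂]
    change bicrossBracket φ ρ (Q.symm u, 0) (Q.symm v, 0) = (Q.symm (Q ⁅Q.symm u, Q.symm v⁆), 0)
    simp [bicrossBracket]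
  lie_mixed u v := by
    change bicrossBracket φ ρ (Q.symm 0, u) (Q.symm v, 0) =
      (Q.symm (Q (φ u (Q.symm v))), - ρ (Q.symm v) u)
    simp [bicrossBracket]

/-- Closedness follows from the two Hessian identities by symmetry of `hm`, and the Nijenhuis
condition from the two torsion identities; both eigenspaces are the summands. -/
theorem bicrossBorn_isIntegrable (hM : IsMatchedPair φ ρ) (hh : IsPseudoMetric hm)
    (Q : Lp ≃ₗ[ℝ] Lm)
    (h₁ : ∀ u v, leftProduct φ Q u v - leftProduct φ Q v u = ⁅u, v⁆)
    (h₂ : ∀ u v, rightProduct ρ Q u v - rightProduct ρ Q v u = Q ⁅Q.symm u, Q.symm v⁆)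
    (h₃ : ∀ u v w, hm ⁅u, v⁆ w = hm u (leftProduct φ Q v w) - hm v (leftProduct φ Q u w))
    (h₄ : ∀ u v w, hm (Q ⁅Q.symm u, Q.symm v⁆) w =
      hm u (rightProduct ρ Q v w) - hm v (rightProduct ρ Q u w)) :
    (bicrossBorn hM hh Q).IsIntegrable := by
  have hs := hh.symm
  refine ⟨?_, ?_, ?_, ?_⟩
  · rintro ⟨x, u⟩ ⟨y, v⟩ ⟨z, w⟩
    obtain ⟨a, rfl⟩ := Q.symm.surjective x
    obtain ⟨b, rfl⟩ := Q.symm.surjective y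
    obtain ⟨c, rfl⟩ := Q.symm.surjective z
    change sumOmega hm Q (bicrossBracket φ ρ (Q.symm a, u) (Q.symm b, v)) (Q.symm c, w) +
      sumOmega hm Q (bicrossBracket φ ρ (Q.symm b, v) (Q.symm c, w)) (Q.symm a, u) +
      sumOmega hm Q (bicrossBracket φ ρ (Q.symm c, w) (Q.symm a, u)) (Q.symm b, v) = 0
    simp only [sumOmega_apply, bicrossBracket, map_add, map_sub, LinearMap.add_apply,
      LinearMap.sub_apply, Q.apply_symm_apply, h₃, h₄, ← leftProduct_apply, ← rightProduct_apply]
    rw [hs (leftProduct φ Q u b), hs (leftProduct φ Q v a), hs (leftProduct φ Q v c),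
      hs (leftProduct φ Q w b), hs (leftProduct φ Q w a), hs (leftProduct φ Q u c),
      hs (rightProduct ρ Q a v), hs (rightProduct ρ Q b u), hs (rightProduct ρ Q b w),
      hs (rightProduct ρ Q c v), hs (rightProduct ρ Q c u), hs (rightProduct ρ Q a w)]
    ring
  · rintro ⟨x, u⟩ ⟨y, v⟩
    obtain ⟨a, rfl⟩ := Q.symm.surjective x
    obtain ⟨b, rfl⟩ := Q.symm.surjective y
    change bicrossBracket φ ρ (sumJ Q (Q.symm a, u)) (sumJ Q (Q.symm b, v)) -
      bicrossBracket φ ρ (Q.symm a, u) (Q.symm b, v) -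
      sumJ Q (bicrossBracket φ ρ (sumJ Q (Q.symm a, u)) (Q.symm b, v) +
        bicrossBracket φ ρ (Q.symm a, u) (sumJ Q (Q.symm b, v))) = 0
    have h₂' : ∀ u v, ⁅Q.symm u, Q.symm v⁆ =
        Q.symm (rightProduct ρ Q u v - rightProduct ρ Q v u) := fun u v => by
      rw [h₂, Q.symm_apply_apply]
    have h₁' : ∀ u v, φ u (Q.symm v) = Q.symm (leftProduct φ Q u v) := fun u v => by
      rw [leftProduct_apply, Q.symm_apply_apply]
    apply Prod.ext
    · apply Q.injective
      simp [bicrossBracket, h₁', h₂', ← h₁, ← rightProduct_apply]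
      abel
    · simp [bicrossBracket, h₁', h₂', ← h₁, ← rightProduct_apply]
      abel
  · intro X hX Y hY
    have key : ∀ X : Bicross hM, X ∈ (bicrossBorn hM hh Q).A.eigenspace 1 ↔ X.2 = 0 := by
      intro X
      rw [Module.End.mem_eigenspace_iff, one_smul]
      change (X.1, -X.2) = (X.1, X.2) ↔ _
      simp [Prod.ext_iff, real_neg_eq_self]
    rw [key] at hX hY ⊢
    change ⁅X.2, Y.2⁆ + ρ X.1 Y.2 - ρ Y.1 X.2 = 0
    rw [hX, hY]; simp
  · intro X hX Y hY
    have key : ∀ X : Bicross hM, X ∈ (bicrossBorn hM hh Q).A.eigenspace (-1) ↔ X.1 = 0 := by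
      intro X
      rw [Module.End.mem_eigenspace_iff, neg_smul, one_smul]
      change (X.1, -X.2) = (-X.1, -X.2) ↔ _
      simp [Prod.ext_iff, real_self_eq_neg]
    rw [key] at hX hY ⊢
    change ⁅X.1, Y.1⁆ + φ X.2 Y.1 - φ Y.2 X.1 = 0
    rw [hX, hY]; simp

theorem bicrossBorn_isHessianPair (hM : IsMatchedPair φ ρ) (hh : IsPseudoMetric hm)
    (Q : Lp ≃ₗ[ℝ] Lm) (hI : (bicrossBorn hM hh Q).IsIntegrable) :
    IsHessianPair hm (leftProduct φ Q) (rightProduct ρ Q) ∧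
    (∀ u v, leftProduct φ Q u v - leftProduct φ Q v u = ⁅u, v⁆) ∧
    (∀ u v, rightProduct ρ Q u v - rightProduct ρ Q v u = Q ⁅Q.symm u, Q.symm v⁆) := by
  have hs := hh.symm
  have nij : ∀ u v,
      bicrossBracket φ ρ (sumJ Q (0, u)) (sumJ Q (0, v)) - bicrossBracket φ ρ (0, u) (0, v) -
      sumJ Q (bicrossBracket φ ρ (sumJ Q (0, u)) (0, v) +
        bicrossBracket φ ρ (0, u) (sumJ Q (0, v))) = 0 := fun u v => hI.nijenhuis (0, u) (0, v)
  have closed : ∀ X Y Z : Lp × Lm, sumOmega hm Q (bicrossBracket φ ρ X Y) Z +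
      sumOmega hm Q (bicrossBracket φ ρ Y Z) X + sumOmega hm Q (bicrossBracket φ ρ Z X) Y = 0 :=
    hI.closed
  have h₁ : ∀ u v, leftProduct φ Q u v - leftProduct φ Q v u = ⁅u, v⁆ := fun u v => by
    have h := congrArg Prod.snd (nij u v)
    simp [bicrossBracket, ← leftProduct_apply] at h
    rw [← lie_skew v u] at h
    linear_combination (norm := abel) h
  have h₂ : ∀ u v, rightProduct ρ Q u v - rightProduct ρ Q v u = Q ⁅Q.symm u, Q.symm v⁆ :=
    fun u v => by
      have h := congrArg (fun X => Q X.1) (nij u v)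
      simp [bicrossBracket, ← rightProduct_apply] at h
      linear_combination (norm := abel) -h
  have hd := bicross_isDouble hM Q h₁ h₂
  refine ⟨⟨hh, hd.jacobi.1, fun u v w => ?_, hd.swap.jacobi.1, fun u v w => ?_, hd.swap.jacobi.2,
    hd.jacobi.2⟩, h₁, h₂⟩
  · have h := closed (0, u) (0, v) (Q.symm w, 0)
    simp [bicrossBracket, ← leftProduct_apply] at h
    rw [h₁, hs u, hs v]
    linarith
  · have h := closed (Q.symm u, 0) (Q.symm v, 0) (0, w)
    simp [bicrossBracket, ← rightProduct_apply] at h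
    rw [h₂, hs u, hs v]
    linarith

/-- The subalgebra `𝔤₋` of the Born structure of a bicross product. -/
def bicrossBornMinusEquiv (hM : IsMatchedPair φ ρ) (hh : IsPseudoMetric hm) (Q : Lp ≃ₗ[ℝ] Lm)
    (hI : (bicrossBorn hM hh Q).IsIntegrable) : BornStructure.minus hI ≃ₗ⁅ℝ⁆ Lm :=
  have key : ∀ X : Bicross hM, X ∈ BornStructure.minus hI ↔ X.1 = 0 := by
    intro X
    change X ∈ (bicrossBorn hM hh Q).A.eigenspace (-1) ↔ _
    rw [Module.End.mem_eigenspace_iff, neg_smul, one_smul]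
    change (X.1, -X.2) = (-X.1, -X.2) ↔ _
    simp [Prod.ext_iff, real_self_eq_neg]
  { toFun := fun X => X.1.2
    map_add' := fun X Y => rfl
    map_smul' := fun c X => rfl
    map_lie' := fun {X Y} => by
      have hX := (key X.1).1 X.2
      have hY := (key Y.1).1 Y.2
      change ⁅X.1.2, Y.1.2⁆ + ρ X.1.1 Y.1.2 - ρ Y.1.1 X.1.2 = ⁅X.1.2, Y.1.2⁆
      rw [hX, hY]; simp
    invFun := fun u => ⟨((0, u) : Lp × Lm), (key _).2 rfl⟩
    left_inv := fun X => Subtype.ext (Prod.ext ((key X.1).1 X.2).symm rfl)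
    right_inv := fun u => rfl }

end BicrossBorn

/-! ## The explicit family of bicross products -/

section NormalForm

theorem toMatrix_eq_iff_three {V : Type*} [AddCommGroup V] [Module ℝ V]
    (b : Module.Basis (Fin 3) ℝ V) (T : Module.End ℝ V) (M : Matrix (Fin 3) (Fin 3) ℝ) :
    LinearMap.toMatrix b b T = M ↔
      ∀ j, T (b j) = M 0 j • b 0 + M 1 j • b 1 + M 2 j • b 2 := by
  constructor
  · rintro rfl j
    rw [b.eq_sum_three (T (b j))]
    simp [LinearMap.toMatrix_apply]
  · intro h
    ext i j
    rw [LinearMap.toMatrix_apply, h]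
    fin_cases i <;> simp

variable {Lp Lm : Type*} [LieRing Lp] [LieAlgebra ℝ Lp] [LieRing Lm] [LieAlgebra ℝ Lm]
  {φ : Lm →ₗ⁅ℝ⁆ Module.End ℝ Lp} {ρ : Lp →ₗ⁅ℝ⁆ Module.End ℝ Lm}
  {hm : LinearMap.BilinForm ℝ Lm} {e : Module.Basis (Fin 3) ℝ Lm}

/-- In the basis `f_i = Q⁻¹ e_i` the matrix entries of `φ` and `ρ` are the structure constants of
the transported products; the zero last columns encode that `e₂` is annihilated from the right. -/
theorem hasNormalForm_iff (Q : Lp ≃ₗ[ℝ] Lm) (x₀ y₀ x y : ℝ) :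
    HasNormalForm e (e.map Q.symm) φ ρ x₀ y₀ x y ↔
      IsTriangular (leftProduct φ Q) e 1 x x₀ ∧ IsTriangular (rightProduct ρ Q) e 0 y y₀ := by
  have hl : ∀ u M, LinearMap.toMatrix (e.map Q.symm) (e.map Q.symm) (φ u) = M ↔
      ∀ j, leftProduct φ Q u (e j) = M 0 j • e 0 + M 1 j • e 1 + M 2 j • e 2 := fun u M => by
    rw [toMatrix_eq_iff_three]
    refine forall_congr' fun j => ?_
    rw [leftProduct_apply, ← Q.injective.eq_iff]
    simp
  have hl0 : ∀ u, φ u = 0 ↔ leftProduct φ Q u = 0 := fun u => by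
    refine ⟨fun h => LinearMap.ext fun v => by simp [leftProduct_apply, h], fun h =>
      LinearMap.ext fun v => Q.injective ?_⟩
    have := LinearMap.congr_fun h (Q v)
    simpa [leftProduct_apply] using this
  have hr : ∀ u M, LinearMap.toMatrix e e (ρ (Q.symm u)) = M ↔
      ∀ j, rightProduct ρ Q u (e j) = M 0 j • e 0 + M 1 j • e 1 + M 2 j • e 2 := fun u M =>
    toMatrix_eq_iff_three _ _ _
  have hr0 : ∀ u, ρ (Q.symm u) = 0 ↔ rightProduct ρ Q u = 0 := fun u =>
    ⟨fun h => LinearMap.ext fun v => LinearMap.congr_fun h v,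
      fun h => LinearMap.ext fun v => LinearMap.congr_fun h v⟩
  constructor
  · rintro ⟨p0, p1, p2, r0, r1, r2⟩
    rw [hl] at p0 p1
    rw [hl0] at p2
    rw [Module.Basis.map_apply, hr] at r0 r1
    rw [Module.Basis.map_apply, hr0] at r2
    refine ⟨⟨by simpa using p0 0, by simpa using p0 1, by simpa using p1 0, by simpa using p1 1, p2,
      fun u => ?_⟩, ⟨by simpa using r0 0, by simpa using r0 1, by simpa using r1 0,
      by simpa using r1 1, r2, fun u => ?_⟩⟩
    · rw [e.eq_sum_three u]
      have q0 := p0 2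
      have q1 := p1 2
      simp at q0 q1
      simp [p2, q0, q1]
    · rw [e.eq_sum_three u]
      have q0 := r0 2
      have q1 := r1 2
      simp at q0 q1
      simp [r2, q0, q1]
  · rintro ⟨p, r⟩
    refine ⟨(hl _ _).2 fun j => ?_, (hl _ _).2 fun j => ?_, (hl0 _).2 p.center_left, ?_, ?_, ?_⟩
    · fin_cases j <;> simp [p.a00, p.a01, p.center_right]
    · fin_cases j <;> simp [p.a10, p.a11, p.center_right]
    · rw [Module.Basis.map_apply]
      refine (hr _ _).2 fun j => ?_
      fin_cases j <;> simp [r.a00, r.a01, r.center_right]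
    · rw [Module.Basis.map_apply]
      refine (hr _ _).2 fun j => ?_
      fin_cases j <;> simp [r.a10, r.a11, r.center_right]
    · rw [Module.Basis.map_apply]
      exact (hr0 _).2 r.center_left

theorem IsTriangular.torsion_eq {φ : Lm →ₗ[ℝ] Lm →ₗ[ℝ] Lm} {x x₀ : ℝ}
    (h : IsTriangular φ e 1 x x₀) (he : IsAdaptedBasis hm e) (u v : Lm) :
    φ u v - φ v u = ⁅u, v⁆ := by
  rw [h.apply, h.apply, he.lie_eq]
  module

theorem IsTriangular.apply_comm {φ : Lm →ₗ[ℝ] Lm →ₗ[ℝ] Lm} {x x₀ : ℝ}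
    (h : IsTriangular φ e 0 x x₀) (u v : Lm) : φ u v = φ v u := by
  rw [h.apply, h.apply]
  module

theorem IsTriangular.hessian {φ : Lm →ₗ[ℝ] Lm →ₗ[ℝ] Lm} {t x x₀ : ℝ}
    (h : IsTriangular φ e t x x₀) (he : IsAdaptedBasis hm e) (u v w : Lm) :
    hm (φ u v - φ v u) w = hm u (φ v w) - hm v (φ u w) := by
  rw [h.apply, h.apply, h.apply, h.apply]
  simp only [map_add, map_sub, map_smul, LinearMap.add_apply, LinearMap.sub_apply,
    LinearMap.smul_apply, smul_eq_mul, he.form_eq]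
  simp
  ring

variable [IsLieAbelian Lp]

/-- With `𝔤₊` abelian, the first condition reduces to symmetry of `φ(ρ(a) u) b` in `a` and `b`. -/
theorem IsTriangular.isMatchedPair {Q : Lp ≃ₗ[ℝ] Lm} {x x₀ y y₀ : ℝ}
    (hφ : IsTriangular (leftProduct φ Q) e 1 x x₀) (hρ : IsTriangular (rightProduct ρ Q) e 0 y y₀)
    (he : IsAdaptedBasis hm e) : IsMatchedPair φ ρ where
  left u a b := by
    obtain ⟨a, rfl⟩ := Q.symm.surjective a
    obtain ⟨b, rfl⟩ := Q.symm.surjective b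
    have h : leftProduct φ Q (rightProduct ρ Q a u) b = leftProduct φ Q (rightProduct ρ Q b u) a := by
      simp only [hφ.apply, hρ.apply]
      simp
      module
    have h' : φ (ρ (Q.symm a) u) (Q.symm b) = φ (ρ (Q.symm b) u) (Q.symm a) := Q.injective h
    simp only [h', trivial_lie_zero, map_zero, zero_add, sub_self]
  right a u v := by
    obtain ⟨a, rfl⟩ := Q.symm.surjective a
    have h : rightProduct ρ Q a ⁅u, v⁆ - ⁅rightProduct ρ Q a u, v⁆ - ⁅u, rightProduct ρ Q a v⁆ +
        rightProduct ρ Q (leftProduct φ Q u a) v - rightProduct ρ Q (leftProduct φ Q v a) u = 0 := by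
      simp only [hφ.apply, hρ.apply, he.lie_eq]
      simp
      module
    simpa [leftProduct_apply, rightProduct_apply] using h

theorem IsTriangular.bicrossBorn_isIntegrable {Q : Lp ≃ₗ[ℝ] Lm} {x x₀ y y₀ : ℝ}
    (hφ : IsTriangular (leftProduct φ Q) e 1 x x₀) (hρ : IsTriangular (rightProduct ρ Q) e 0 y y₀)
    (he : IsAdaptedBasis hm e) (hM : IsMatchedPair φ ρ) (hh : IsPseudoMetric hm) :
    (bicrossBorn hM hh Q).IsIntegrable := by
  have h₂ : ∀ u v, rightProduct ρ Q u v - rightProduct ρ Q v u = Q ⁅Q.symm u, Q.symm v⁆ :=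
    fun u v => by rw [hρ.apply_comm u v, sub_self, trivial_lie_zero, map_zero]
  refine _root_.bicrossBorn_isIntegrable hM hh Q (hφ.torsion_eq he) h₂ (fun u v w => ?_)
    fun u v w => ?_
  · rw [← hφ.torsion_eq he, hφ.hessian he]
  · rw [← h₂, hρ.hessian he]

theorem exists_isIntegrable_iff_hasNormalForm (he : IsAdaptedBasis hm e) (hh : IsPseudoMetric hm)
    (Q : Lp ≃ₗ[ℝ] Lm) :
    (∃ hM : IsMatchedPair φ ρ, (bicrossBorn hM hh Q).IsIntegrable) ↔
      ∃ x₀ y₀ x y : ℝ, HasNormalForm e (e.map Q.symm) φ ρ x₀ y₀ x y := by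
  simp only [hasNormalForm_iff]
  constructor
  · rintro ⟨hM, hI⟩
    obtain ⟨h, h₁, h₂⟩ := bicrossBorn_isHessianPair hM hh Q hI
    obtain ⟨x, x₀, y, y₀, hx, hy⟩ := h.isTriangular_of_isAdaptedBasis he h₁ fun u v => by
      rw [← sub_eq_zero, h₂, trivial_lie_zero, map_zero]
    exact ⟨x₀, y₀, x, y, hx, hy⟩
  · rintro ⟨x₀, y₀, x, y, hx, hy⟩
    exact ⟨hx.isMatchedPair hy he, hx.bicrossBorn_isIntegrable hy he _ hh⟩

theorem HasNormalForm.bicross_equiv {Q : Lp ≃ₗ[ℝ] Lm} {x₀ y₀ x y : ℝ}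
    (h : HasNormalForm e (e.map Q.symm) φ ρ x₀ y₀ x y) (he : IsAdaptedBasis hm e)
    (hM : IsMatchedPair φ ρ) :
    (y = 0 → x = -1 → Nonempty (Bicross hM ≃ₗ⁅ℝ⁆ h4.Alg)) ∧
    (y = 0 → x = 0 → Nonempty (Bicross hM ≃ₗ⁅ℝ⁆ h10.Alg)) ∧
    (y = 0 → x = 1 → Nonempty (Bicross hM ≃ₗ⁅ℝ⁆ h7.Alg)) ∧
    (y = 0 → x ≠ -1 → x ≠ 0 → x ≠ 1 → Nonempty (Bicross hM ≃ₗ⁅ℝ⁆ h11.Alg)) ∧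
    (y ≠ 0 → Nonempty (Bicross hM ≃ₗ⁅ℝ⁆ h13.Alg)) := by
  obtain ⟨hφ, hρ⟩ := (hasNormalForm_iff Q x₀ y₀ x y).1 h
  have hd := bicross_isDouble hM Q (hφ.torsion_eq he) fun u v => by
    rw [hρ.apply_comm u v, sub_self, trivial_lie_zero, map_zero]
  obtain ⟨f⟩ := hd.equiv_doubleFamily hφ hρ
  obtain ⟨k4, k10, k7, k11, k13⟩ := doubleFamily_zero_equiv x y x₀ y₀
  have tr : ∀ {s : StructureEquations 6}, Nonempty ((doubleFamily 0 x y x₀ y₀).Alg ≃ₗ⁅ℝ⁆ s.Alg) →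
      Nonempty (Bicross hM ≃ₗ⁅ℝ⁆ s.Alg) := fun ⟨g⟩ => ⟨f.trans g⟩
  exact ⟨fun h h' => tr (k4 h h'), fun h h' => tr (k10 h h'), fun h h' => tr (k7 h h'),
    fun h h1 h2 h3 => tr (k11 h h1 h2 h3), fun h => tr (k13 h)⟩

/-- The representation `u ↦ α(u) S + β(u) T` on `V`, for commuting endomorphisms `S` and `T`. -/
def commutingRep {L V : Type*} [LieRing L] [LieAlgebra ℝ L] [AddCommGroup V] [Module ℝ V]
    (α β : L →ₗ[ℝ] ℝ) (hα : ∀ u v : L, α ⁅u, v⁆ = 0) (hβ : ∀ u v : L, β ⁅u, v⁆ = 0)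
    (S T : Module.End ℝ V) (h : S * T = T * S) : L →ₗ⁅ℝ⁆ Module.End ℝ V where
  __ := α.smulRight S + β.smulRight T
  map_lie' {u v} := by
    change α ⁅u, v⁆ • S + β ⁅u, v⁆ • T =
      ⁅α u • S + β u • T, (α v • S + β v • T : Module.End ℝ V)⁆
    rw [hα, hβ, LieRing.of_associative_ring_bracket]
    simp only [add_mul, mul_add, smul_mul_smul_comm, h]
    module

theorem commutingRep_apply {L V : Type*} [LieRing L] [LieAlgebra ℝ L] [AddCommGroup V]
    [Module ℝ V] {α β : L →ₗ[ℝ] ℝ} (hα : ∀ u v : L, α ⁅u, v⁆ = 0) (hβ : ∀ u v : L, β ⁅u, v⁆ = 0)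
    {S T : Module.End ℝ V} (h : S * T = T * S) (u : L) :
    commutingRep α β hα hβ S T h u = α u • S + β u • T := rfl

theorem toLin_mul_comm_of_strict {V : Type*} [AddCommGroup V] [Module ℝ V]
    (f : Module.Basis (Fin 3) ℝ V) (p q r s : ℝ) :
    Matrix.toLin f f !![0, 0, 0; 0, 0, 0; 0, p, 0] * Matrix.toLin f f !![0, q, 0; 0, 0, 0; r, s, 0] =
      Matrix.toLin f f !![0, q, 0; 0, 0, 0; r, s, 0] *
        Matrix.toLin f f !![0, 0, 0; 0, 0, 0; 0, p, 0] := by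
  rw [Module.End.mul_eq_comp, Module.End.mul_eq_comp, ← Matrix.toLin_mul, ← Matrix.toLin_mul]
  congr 1
  ext i j
  fin_cases i <;> fin_cases j <;> simp [Matrix.mul_apply, Fin.sum_univ_three]

/-- Both representations kill the last basis vector, and the two remaining matrices commute, so each
is a combination of commuting operators with coordinate functionals that vanish on brackets. -/
theorem exists_hasNormalForm (he : IsAdaptedBasis hm e) (Q : Lp ≃ₗ[ℝ] Lm) (x₀ y₀ x y : ℝ) :
    ∃ (φ : Lm →ₗ⁅ℝ⁆ Module.End ℝ Lp) (ρ : Lp →ₗ⁅ℝ⁆ Module.End ℝ Lm),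
      HasNormalForm e (e.map Q.symm) φ ρ x₀ y₀ x y := by
  refine ⟨commutingRep (e.coord 0) (e.coord 1) (fun u v => ?_) (fun u v => ?_) _ _
      (toLin_mul_comm_of_strict (e.map Q.symm) x (x + 1) (x - 1) x₀),
    commutingRep ((e.map Q.symm).coord 0) ((e.map Q.symm).coord 1) (fun u v => ?_) (fun u v => ?_)
      _ _ (toLin_mul_comm_of_strict e y y y y₀), ?_⟩
  · simp [he.lie_eq]
  · simp [he.lie_eq]
  · rw [trivial_lie_zero, map_zero]
  · rw [trivial_lie_zero, map_zero]
  · constructor <;> simp [commutingRep_apply]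

end NormalForm

/-! ## Transport of Born structures and the models -/

section Transport

variable {L M : Type*} [LieRing L] [LieAlgebra ℝ L] [LieRing M] [LieAlgebra ℝ M]

theorem nondegenerate_comp_equiv {V W : Type*} [AddCommGroup V] [Module ℝ V] [AddCommGroup W]
    [Module ℝ W] (f : V ≃ₗ[ℝ] W) {b : LinearMap.BilinForm ℝ W} (hb : b.Nondegenerate) :
    (b.comp f.toLinearMap f.toLinearMap).Nondegenerate := by
  obtain ⟨h1, h2⟩ := hb
  refine ⟨fun x hx => ?_, fun x hx => ?_⟩
  · exact (map_eq_zero_iff f f.injective).1 (h1 _ fun y => by simpa using hx (f.symm y))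
  · exact (map_eq_zero_iff f f.injective).1 (h2 _ fun y => by simpa using hx (f.symm y))

theorem IsPseudoMetric.comp_equiv {V W : Type*} [AddCommGroup V] [Module ℝ V] [AddCommGroup W]
    [Module ℝ W] (f : V ≃ₗ[ℝ] W) {b : LinearMap.BilinForm ℝ W} (hb : IsPseudoMetric b) :
    IsPseudoMetric (b.comp f.toLinearMap f.toLinearMap) :=
  ⟨fun x y => hb.symm (f x) (f y), nondegenerate_comp_equiv f hb.nondegenerate⟩

theorem conj_end_mul {V W : Type*} [AddCommGroup V] [Module ℝ V] [AddCommGroup W] [Module ℝ W]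
    (f : V ≃ₗ[ℝ] W) (S T : Module.End ℝ V) : f.conj (S * T) = f.conj S * f.conj T :=
  f.conj_comp T S

theorem conj_end_one {V W : Type*} [AddCommGroup V] [Module ℝ V] [AddCommGroup W] [Module ℝ W]
    (f : V ≃ₗ[ℝ] W) : f.conj (1 : Module.End ℝ V) = 1 := f.conj_id

/-- The pullback of a Born structure along an isomorphism. -/
def BornStructure.comap (S : BornStructure M) (f : L ≃ₗ⁅ℝ⁆ M) : BornStructure L where
  g := S.g.comp f.toLinearEquiv.toLinearMap f.toLinearEquiv.toLinearMap
  h := S.h.comp f.toLinearEquiv.toLinearMap f.toLinearEquiv.toLinearMap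
  ω := S.ω.comp f.toLinearEquiv.toLinearMap f.toLinearEquiv.toLinearMap
  g_metric := S.g_metric.comp_equiv f.toLinearEquiv
  h_metric := S.h_metric.comp_equiv f.toLinearEquiv
  ω_alt := fun x => S.ω_alt (f x)
  ω_nondegenerate := nondegenerate_comp_equiv f.toLinearEquiv S.ω_nondegenerate
  A := f.toLinearEquiv.symm.conj S.A
  B := f.toLinearEquiv.symm.conj S.B
  J := f.toLinearEquiv.symm.conj S.J
  rec_A := fun x y => by simpa [LinearEquiv.conj_apply] using S.rec_A (f x) (f y)
  rec_B := fun x y => by simpa [LinearEquiv.conj_apply] using S.rec_B (f x) (f y)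
  rec_J := fun x y => by simpa [LinearEquiv.conj_apply] using S.rec_J (f x) (f y)
  A_sq := by rw [← conj_end_mul, S.A_sq, conj_end_one]
  B_sq := by rw [← conj_end_mul, S.B_sq, conj_end_one]
  J_sq := by rw [← conj_end_mul, S.J_sq, map_neg, conj_end_one]

theorem BornStructure.comap_J (S : BornStructure M) (f : L ≃ₗ⁅ℝ⁆ M) (x : L) :
    f ((S.comap f).J x) = S.J (f x) := f.apply_symm_apply (S.J (f x))

theorem BornStructure.mem_eigenspace_comap (S : BornStructure M) (f : L ≃ₗ⁅ℝ⁆ M) (c : ℝ) (x : L) :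
    x ∈ (S.comap f).A.eigenspace c ↔ f x ∈ S.A.eigenspace c := by
  rw [Module.End.mem_eigenspace_iff, Module.End.mem_eigenspace_iff, ← f.injective.eq_iff]
  change f (f.symm (S.A (f x))) = _ ↔ _
  rw [f.apply_symm_apply]
  change _ = f.toLinearEquiv (c • x) ↔ _
  rw [map_smul]
  rfl

theorem BornStructure.IsIntegrable.comap {S : BornStructure M} (hS : S.IsIntegrable)
    (f : L ≃ₗ⁅ℝ⁆ M) : (S.comap f).IsIntegrable where
  closed x y z := by
    change S.ω (f ⁅x, y⁆) (f z) + S.ω (f ⁅y, z⁆) (f x) + S.ω (f ⁅z, x⁆) (f y) = 0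
    simp only [LieEquiv.map_lie, hS.closed]
  nijenhuis x y := f.injective (by
    have hsub : ∀ u v, f (u - v) = f u - f v := f.toLinearEquiv.map_sub
    have hadd : ∀ u v, f (u + v) = f u + f v := f.toLinearEquiv.map_add
    have hzero : f 0 = 0 := f.toLinearEquiv.map_zero
    change f (_ - _ - _) = f 0
    rw [hsub, hsub, S.comap_J, hadd, hzero]
    simp only [LieEquiv.map_lie, S.comap_J]
    exact hS.nijenhuis (f x) (f y))
  plus_subalgebra x hx y hy := by
    rw [S.mem_eigenspace_comap] at hx hy ⊢
    rw [LieEquiv.map_lie]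
    exact hS.plus_subalgebra _ hx _ hy
  minus_subalgebra x hx y hy := by
    rw [S.mem_eigenspace_comap] at hx hy ⊢
    rw [LieEquiv.map_lie]
    exact hS.minus_subalgebra _ hx _ hy

theorem BornStructure.nonempty_minus_comap {S : BornStructure M} (hS : S.IsIntegrable)
    (f : L ≃ₗ⁅ℝ⁆ M) : Nonempty (BornStructure.minus (hS.comap f) ≃ₗ⁅ℝ⁆ BornStructure.minus hS) := by
  refine ⟨LieEquiv.ofSubalgebras _ _ f (SetLike.ext fun y => ?_)⟩
  rw [LieSubalgebra.mem_map]
  constructor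
  · rintro ⟨x, hx, rfl⟩
    exact (S.mem_eigenspace_comap f (-1) x).1 hx
  · intro hy
    exact ⟨f.symm y, (S.mem_eigenspace_comap f (-1) _).2 (by
      rw [f.apply_symm_apply]; exact hy), f.apply_symm_apply y⟩

end Transport

/-! ### Realisation of the five algebras by bicross products. -/

section Models

/-- The abelian Lie algebra of dimension three. -/
def abelian3 : StructureEquations 3 where
  d := 0
  alt k x := rfl
  jacobi k x y z := by simp

instance : IsLieAbelian abelian3.Alg where
  trivial _ _ := funext fun _ => neg_zero

theorem exists_isAdaptedBasis_heis3 :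
    ∃ (hm : LinearMap.BilinForm ℝ heis3.Alg) (e : Module.Basis (Fin 3) ℝ heis3.Alg),
      IsAdaptedBasis hm e := by
  obtain ⟨e, he⟩ := exists_isHeisenbergBasis_of_equiv (LieEquiv.refl (R := ℝ) (L₁ := heis3.Alg))
    (c := lieBilin heis3.Alg) lieBilin_apply
  refine ⟨Matrix.toBilin e !![1, 0, 0; 0, -1, 1; 0, 1, 0], e, he.bracket, he.central _,
    he.central _, fun i j => ?_⟩
  rw [← LinearMap.BilinForm.toMatrix_apply e, LinearMap.BilinForm.toMatrix_toBilin]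

theorem exists_bornStructure_model (x y : ℝ) :
    ∃ (φ : heis3.Alg →ₗ⁅ℝ⁆ Module.End ℝ abelian3.Alg)
      (ρ : abelian3.Alg →ₗ⁅ℝ⁆ Module.End ℝ heis3.Alg) (hM : IsMatchedPair φ ρ),
      (∃ (S : BornStructure (Bicross hM)) (hS : S.IsIntegrable),
        Nonempty (BornStructure.minus hS ≃ₗ⁅ℝ⁆ heis3.Alg)) ∧
      (y = 0 → x = -1 → Nonempty (Bicross hM ≃ₗ⁅ℝ⁆ h4.Alg)) ∧
      (y = 0 → x = 0 → Nonempty (Bicross hM ≃ₗ⁅ℝ⁆ h10.Alg)) ∧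
      (y = 0 → x = 1 → Nonempty (Bicross hM ≃ₗ⁅ℝ⁆ h7.Alg)) ∧
      (y = 0 → x ≠ -1 → x ≠ 0 → x ≠ 1 → Nonempty (Bicross hM ≃ₗ⁅ℝ⁆ h11.Alg)) ∧
      (y ≠ 0 → Nonempty (Bicross hM ≃ₗ⁅ℝ⁆ h13.Alg)) := by
  obtain ⟨hm, e, he⟩ := exists_isAdaptedBasis_heis3
  let Q : abelian3.Alg ≃ₗ[ℝ] heis3.Alg := LinearEquiv.refl ℝ (Fin 3 → ℝ)
  obtain ⟨φ, ρ, h⟩ := exists_hasNormalForm he Q 0 0 x y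
  obtain ⟨hM, hI⟩ := (exists_isIntegrable_iff_hasNormalForm he he.isPseudoMetric Q).2
    ⟨0, 0, x, y, h⟩
  exact ⟨φ, ρ, hM, ⟨_, hI, ⟨bicrossBornMinusEquiv hM _ Q hI⟩⟩, h.bicross_equiv he hM⟩

theorem exists_bornStructure_of_equiv {L : Type*} [LieRing L] [LieAlgebra ℝ L]
    (h : Nonempty (L ≃ₗ⁅ℝ⁆ h4.Alg) ∨ Nonempty (L ≃ₗ⁅ℝ⁆ h7.Alg) ∨ Nonempty (L ≃ₗ⁅ℝ⁆ h10.Alg) ∨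
      Nonempty (L ≃ₗ⁅ℝ⁆ h11.Alg) ∨ Nonempty (L ≃ₗ⁅ℝ⁆ h13.Alg)) :
    ∃ (S : BornStructure L) (hS : S.IsIntegrable),
      Nonempty (BornStructure.minus hS ≃ₗ⁅ℝ⁆ heis3.Alg) := by
  have tr : ∀ {M : Type} [LieRing M] [LieAlgebra ℝ M] {s : StructureEquations 6},
      (∃ (S : BornStructure M) (hS : S.IsIntegrable),
        Nonempty (BornStructure.minus hS ≃ₗ⁅ℝ⁆ heis3.Alg)) →
      Nonempty (M ≃ₗ⁅ℝ⁆ s.Alg) → Nonempty (L ≃ₗ⁅ℝ⁆ s.Alg) →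
      ∃ (S : BornStructure L) (hS : S.IsIntegrable),
        Nonempty (BornStructure.minus hS ≃ₗ⁅ℝ⁆ heis3.Alg) := by
    rintro M _ _ s ⟨S, hS, ⟨k⟩⟩ ⟨f⟩ ⟨g⟩
    obtain ⟨k'⟩ := BornStructure.nonempty_minus_comap hS (g.trans f.symm)
    exact ⟨_, hS.comap (g.trans f.symm), ⟨k'.trans k⟩⟩
  rcases h with h | h | h | h | h
  · obtain ⟨_, _, hM, hB, k4, -⟩ := exists_bornStructure_model (-1) 0
    exact tr hB (k4 rfl rfl) h
  · obtain ⟨_, _, hM, hB, -, -, k7, -⟩ := exists_bornStructure_model 1 0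
    exact tr hB (k7 rfl rfl) h
  · obtain ⟨_, _, hM, hB, -, k10, -⟩ := exists_bornStructure_model 0 0
    exact tr hB (k10 rfl rfl) h
  -- Any value outside `{-1, 0, 1}` would serve in place of `2`.
  · obtain ⟨_, _, hM, hB, -, -, -, k11, -⟩ := exists_bornStructure_model 2 0
    exact tr hB (k11 rfl (by norm_num) (by norm_num) (by norm_num)) h
  · obtain ⟨_, _, hM, hB, -, -, -, -, k13⟩ := exists_bornStructure_model 0 1
    exact tr hB (k13 one_ne_zero) h

end Models

end

theorem mainTheorem9 :
    -- the classification
    (∀ (L : Type*) [LieRing L] [LieAlgebra ℝ L] [LieRing.IsNilpotent L],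
      Module.finrank ℝ L = 6 → ¬ IsLieAbelian L →
      ((∃ (S : BornStructure L) (hS : S.IsIntegrable),
          Nonempty (BornStructure.minus hS ≃ₗ⁅ℝ⁆ heis3.Alg)) ↔
        (Nonempty (L ≃ₗ⁅ℝ⁆ h4.Alg) ∨ Nonempty (L ≃ₗ⁅ℝ⁆ h7.Alg) ∨ Nonempty (L ≃ₗ⁅ℝ⁆ h10.Alg) ∨
          Nonempty (L ≃ₗ⁅ℝ⁆ h11.Alg) ∨ Nonempty (L ≃ₗ⁅ℝ⁆ h13.Alg)))) ∧
    -- flat Lorentzian metrics on the Heisenberg algebra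
    (∀ (Lm : Type*) [LieRing Lm] [LieAlgebra ℝ Lm], Nonempty (Lm ≃ₗ⁅ℝ⁆ heis3.Alg) →
      ∀ hm : LinearMap.BilinForm ℝ Lm,
        (IsLorentzian hm ∧ IsFlat hm) ↔ ∃ e : Module.Basis (Fin 3) ℝ Lm, IsAdaptedBasis hm e) ∧
    -- the bicross products of an abelian Lie algebra with the Heisenberg algebra
    (∀ (Lp Lm : Type*) [LieRing Lp] [LieAlgebra ℝ Lp] [LieRing Lm] [LieAlgebra ℝ Lm]
      [IsLieAbelian Lp] (hm : LinearMap.BilinForm ℝ Lm) (hh : IsPseudoMetric hm)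
      (e : Module.Basis (Fin 3) ℝ Lm), IsAdaptedBasis hm e → ∀ (Q : Lp ≃ₗ[ℝ] Lm),
      -- all solutions are in the four-parameter family
      (∀ (φ : Lm →ₗ⁅ℝ⁆ Module.End ℝ Lp) (ρ : Lp →ₗ⁅ℝ⁆ Module.End ℝ Lm),
        (∃ hM : IsMatchedPair φ ρ, (bicrossBorn hM hh Q).IsIntegrable) ↔
          ∃ x₀ y₀ x y : ℝ, HasNormalForm e (e.map Q.symm) φ ρ x₀ y₀ x y) ∧
      -- every parameter value occurs
      (∀ x₀ y₀ x y : ℝ, ∃ (φ : Lm →ₗ⁅ℝ⁆ Module.End ℝ Lp) (ρ : Lp →ₗ⁅ℝ⁆ Module.End ℝ Lm),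
        HasNormalForm e (e.map Q.symm) φ ρ x₀ y₀ x y) ∧
      -- identification of the resulting Lie algebras
      (∀ (φ : Lm →ₗ⁅ℝ⁆ Module.End ℝ Lp) (ρ : Lp →ₗ⁅ℝ⁆ Module.End ℝ Lm)
        (hM : IsMatchedPair φ ρ) (x₀ y₀ x y : ℝ),
        HasNormalForm e (e.map Q.symm) φ ρ x₀ y₀ x y →
          (y = 0 → x = -1 → Nonempty (Bicross hM ≃ₗ⁅ℝ⁆ h4.Alg)) ∧
          (y = 0 → x = 0 → Nonempty (Bicross hM ≃ₗ⁅ℝ⁆ h10.Alg)) ∧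
          (y = 0 → x = 1 → Nonempty (Bicross hM ≃ₗ⁅ℝ⁆ h7.Alg)) ∧
          (y = 0 → x ≠ -1 → x ≠ 0 → x ≠ 1 → Nonempty (Bicross hM ≃ₗ⁅ℝ⁆ h11.Alg)) ∧
          (y ≠ 0 → Nonempty (Bicross hM ≃ₗ⁅ℝ⁆ h13.Alg)))) := by
  refine ⟨?_, ?_, ?_⟩
  · intro L _ _ _ _ _
    exact ⟨fun ⟨S, hS, ⟨f⟩⟩ => S.classification hS f, exists_bornStructure_of_equiv⟩
  · rintro Lm _ _ ⟨f⟩ hm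
    exact flatLorentzian_iff f hm
  · intro Lp Lm _ _ _ _ _ hm hh e he Q
    exact ⟨fun φ ρ => exists_isIntegrable_iff_hasNormalForm he hh Q,
      exists_hasNormalForm he Q, fun φ ρ hM x₀ y₀ x y h => h.bicross_equiv he hM⟩
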